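/- Consider a homogeneous ball of mass $m>0$, radius $R>0$ and moment of inertia $\mu>0$ rolling without sliding on a cylinder with axis $Oz$ under the potential $U(z)=-m\mathrm g z$, $\mathrm g\in\mathbb R$. Put $d=mR^2$, $\nu=\sqrt{\mu/(d+\mu)}$, and let $f=f(\varphi)$ be the smooth nowhere vanishing $2\pi$-periodic function describing the cross-section. On the space with coordinates $x=(\gamma_1,\gamma_2,z,M_1,M_2,M_3)$, with $\gamma=(\gamma_1,\gamma_2,0)$, $M=\mu\omega+d\,\gamma\times(\omega\times\gamma)$, consider $$H=\tfrac12(M,\omega)+U(z),\qquad C=(\gamma,\gamma),\qquad J_k=v_1^{(k)}M_1+v_2^{(k)}M_2-\frac{m\mathrm g d}{\nu^2-1}\,\frac{v_3^{(k)}}{M_3},\quad k=1,2,$$ where, on $-1<\gamma_1<1$, $\gamma_2>0$, with $L^{(1)}(n,\ell,\cdot)=\mathsf P^{\ell}_{n}$ and $L^{(2)}(n,\ell,\cdot)=\mathsf Q^{\ell}_{n}$ the associated Legendre (Ferrers) functions of the first and second kind, $$v_1^{(k)}=\gamma_2^{3/2}L^{(k)}(\nu-\tfrac12,\tfrac32,\gamma_1),\quad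 v_2^{(k)}=\frac{L^{(k)}(\nu+\frac12,\frac32,\gamma_1)-\gamma_1(\gamma_2^2(\nu+1)+1)L^{(k)}(\nu-\frac12,\frac32,\gamma_1)}{\gamma_2^{3/2}(\nu+1)},$$ and $v_3^{(k)}=\int\frac{\gamma_1v_2^{(k)}-\gamma_2v_1^{(k)}}{f}\,d\varphi$ with $\gamma_1=\cos\varphi$, $\gamma_2=\sin\varphi$, $0<\varphi<\pi$ (any constants of integration). Let $G\subset\{-1<\gamma_1<1,\ \gamma_2>0\}$ be open and meet the circle $C=1$, and let $I\subset\mathbb R$ be a nonempty open interval. Let $\mathcal M$ be the set of points $x$ with $(\gamma_1,\gamma_2)\in G$, $z\in I$, $C=1$ and, if $\mathrm g\ne0$, $M_3\neq 0$. A *solution* is a bivector $P$ over $G\times I$ whose entries are affine in the momenta, $P_{ij}=\sum_{k=1}^3u_{ij}^k(\gamma,z)M_k+w_{ij}(\gamma,z)$ with $u^k_{ij},w_{ij}$ smooth on $G\times I$, such that at all points of $\mathcal M$ the Schouten bracket $[P,P]$ vanishes and $H,C,J_1,J_2$ are pairwise in involution, $\{F_1,F_2\}=\sum_{i,j}P_{ij}\,\partial_iF_1\,\partial_jF_2=0$.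 It is *nontrivial* if its rank is four at some point of $\mathcal M$. 1. A nontrivial solution exists if and only if $U(z)=0$ identically. 2. Suppose $U=0$. Let $k\in\{1,2\}$ be such that $v_2^{(k)}\ne0$ on $G$, let $\alpha(\gamma_1,\gamma_2,z)$ be an arbitrary nowhere vanishing smooth function on $G\times I$ and $\beta(\gamma_1,\gamma_2)$ an arbitrary smooth function on $G$. Put $\rho_k=-v_1^{(k)}/v_2^{(k)}$ and $$\sigma_k=\beta\int\left(\frac{\gamma_1(\nu^2-1)(\gamma_2-\gamma_1\rho_k)}{\alpha}+\frac{\gamma_1\,\partial\alpha/\partial\gamma_2-\gamma_2\,\partial\alpha/\partial\gamma_1}{\alpha^2}\right)dz .$$ Smooth such $\sigma_k$ exist on $G\times I$, and for each of them $$P^{(k)}=\alpha\begin{pmatrix}0&\Gamma_\alpha\\-\Gamma_\alpha^\top&0\end{pmatrix}+\beta\begin{pmatrix}0&\Gamma_\beta\\-\Gamma_\beta^\top&\mathrm M_\beta\end{pmatrix},\quad \Gamma_\alpha=\begin{pmatrix}0&0&0\\0&0&0\\1&\rho_k&\sigma_k\end{pmatrix},\quad \Gamma_\beta=\begin{pmatrix}0&0&-\gamma_2\\0&0&\gamma_1\\0&0&0\end{pmatrix},$$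 with $\mathrm M_\beta$ the skew-symmetric matrix with entries $(\mathrm M_\beta)_{12}=0$, $(\mathrm M_\beta)_{i3}=\gamma_i(\gamma_1M_2-\gamma_2M_1)(\nu^2-1)$, $i=1,2$, is a solution. On $\mathcal M$ it satisfies $P^{(k)}dC=P^{(k)}dJ_k=0$, and it has rank four at every point of $\mathcal M$ where $\beta\neq0$. The two families are distinct: at no point of $\mathcal M$ where $v_2^{(1)},v_2^{(2)}$ and the $\alpha$ of the first family are nonzero can a bivector of the first family equal one of the second. -/

import Mathlib

open scoped ContDiff Matrix

noncomputable section

/-- Associated Legendre (Ferrers) function of the first kind on `(-1, 1)`, degree `n`, order `m`. -/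
def legendreP (n m x : ℝ) : ℝ :=
  ((1 + x) / (1 - x)) ^ (m / 2) / Real.Gamma (1 - m) *
    ordinaryHypergeometric (-n) (n + 1) (1 - m) ((1 - x) / 2)

/-- Associated Legendre (Ferrers) function of the second kind on `(-1, 1)`, degree `n`,
non-integer order `m`. -/
def legendreQ (n m x : ℝ) : ℝ :=
  Real.pi / (2 * Real.sin (m * Real.pi)) *
    (Real.cos (m * Real.pi) * legendreP n m x -
      Real.Gamma (n + m + 1) / Real.Gamma (n - m + 1) * legendreP n (-m) x)

/-- The pair `L⁽¹⁾, L⁽²⁾` (indexed by `0, 1`). -/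
def legendreL (k : Fin 2) : ℝ → ℝ → ℝ → ℝ := ![legendreP, legendreQ] k

/-- Points of the configuration space, `((γ₁, γ₂), z)`. -/
abbrev Config : Type := (ℝ × ℝ) × ℝ

/-- Points of the six-dimensional space with coordinates `(γ₁, γ₂, z, M₁, M₂, M₃)`. -/
abbrev Phase : Type := Fin 6 → ℝ

/-- The configuration `((γ₁, γ₂), z)` of a point. -/
def Phase.config (x : Phase) : Config := ((x 0, x 1), x 2)

/-- The normal vector `γ = (γ₁, γ₂, 0)`. -/
def Phase.normal (x : Phase) : Fin 3 → ℝ := ![x 0, x 1, 0]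

/-- The angular momentum `M = (M₁, M₂, M₃)`. -/
def Phase.momentum (x : Phase) : Fin 3 → ℝ := ![x 3, x 4, x 5]

/-- The data of the model: mass `m`, radius `R` and moment of inertia `μ` of the homogeneous ball,
the acceleration of gravity, and the function `f(φ)` describing the cross-section of the
cylinder. -/
structure StublerModel where
  mass : ℝ
  radius : ℝ
  inertia : ℝ
  grav : ℝ
  f : ℝ → ℝ
  mass_pos : 0 < mass
  radius_pos : 0 < radius
  inertia_pos : 0 < inertia
  f_smooth : ContDiff ℝ ∞ f
  f_periodic : Function.Periodic f (2 * Real.pi)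
  f_ne_zero : ∀ φ, f φ ≠ 0

namespace StublerModel

variable (S : StublerModel)

/-- `d = m R²`. -/
def d : ℝ := S.mass * S.radius ^ 2

/-- `ν = √(μ / (d + μ))`. -/
def nu : ℝ := Real.sqrt (S.inertia / (S.d + S.inertia))

/-- The potential `U(z) = -m g z`. -/
def potential (z : ℝ) : ℝ := -(S.mass * S.grav * z)

/-- The angular velocity `ω`, the solution of `M = μ ω + d γ × (ω × γ)`. -/
def angularVelocity (x : Phase) : Fin 3 → ℝ :=
  (S.inertia + S.d * (x.normal ⬝ᵥ x.normal))⁻¹ •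
    (x.momentum + (S.d / S.inertia * (x.normal ⬝ᵥ x.momentum)) • x.normal)

theorem momentum_eq_iff (x : Phase) (w : Fin 3 → ℝ) :
    x.momentum = S.inertia • w + S.d • crossProduct x.normal (crossProduct w x.normal) ↔
      w = S.angularVelocity x := by
  have hI := S.inertia_pos
  have hd : 0 < S.d := mul_pos S.mass_pos (pow_pos S.radius_pos 2)
  have hp : 0 < S.inertia + S.d * (x 0 * x 0 + x 1 * x 1) := by
    nlinarith [mul_nonneg hd.le (add_nonneg (mul_self_nonneg (x 0)) (mul_self_nonneg (x 1)))]
  constructor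
  · intro h
    have h0 := congrFun h 0
    have h1 := congrFun h 1
    have h2 := congrFun h 2
    simp [Phase.momentum, Phase.normal, cross_apply] at h0 h1 h2
    funext i
    fin_cases i <;>
      simp [angularVelocity, Phase.momentum, Phase.normal, dotProduct, Fin.sum_univ_three,
        h0, h1, h2] <;> field_simp <;> ring
  · rintro rfl
    funext i
    fin_cases i <;>
      simp [angularVelocity, Phase.momentum, Phase.normal, dotProduct, Fin.sum_univ_three,
        cross_apply] <;> field_simp <;> ring

/-- `v₁⁽ᵏ⁾` as a function of `(γ₁, γ₂)`. -/
def v1 (k : Fin 2) (γ : ℝ × ℝ) : ℝ :=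
  γ.2 ^ (3 / 2 : ℝ) * legendreL k (S.nu - 1 / 2) (3 / 2) γ.1

/-- `v₂⁽ᵏ⁾` as a function of `(γ₁, γ₂)`. -/
def v2 (k : Fin 2) (γ : ℝ × ℝ) : ℝ :=
  1 / (γ.2 ^ (3 / 2 : ℝ) * (S.nu + 1)) *
    (legendreL k (S.nu + 1 / 2) (3 / 2) γ.1 -
      γ.1 * (γ.2 ^ 2 * (S.nu + 1) + 1) * legendreL k (S.nu - 1 / 2) (3 / 2) γ.1)

/-- `v₃⁽ᵏ⁾ = ∫ (γ₁ v₂⁽ᵏ⁾ - γ₂ v₁⁽ᵏ⁾) / f dφ` as a function of the angle `φ ∈ (0, π)`; `c` is the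
constant of integration. -/
def v3 (c : ℝ) (k : Fin 2) (φ : ℝ) : ℝ :=
  c + ∫ θ in (Real.pi / 2)..φ,
    (Real.cos θ * S.v2 k (Real.cos θ, Real.sin θ) -
      Real.sin θ * S.v1 k (Real.cos θ, Real.sin θ)) / S.f θ

/-- The energy `H = (M, ω) / 2 + U(z)`. -/
def energy (x : Phase) : ℝ :=
  1 / 2 * (x.momentum ⬝ᵥ S.angularVelocity x) + S.potential (x 2)

/-- The geometric integral `C = (γ, γ)`. -/
def geometric (x : Phase) : ℝ := x.normal ⬝ᵥ x.normal

/-- The integrals `J_k`; on the half-circle `γ₂ > 0` the angle is `φ = arccos γ₁`. -/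
def J (c : Fin 2 → ℝ) (k : Fin 2) (x : Phase) : ℝ :=
  S.v1 k (x 0, x 1) * x 3 + S.v2 k (x 0, x 1) * x 4 -
    S.mass * S.grav * S.d / (S.nu ^ 2 - 1) * (S.v3 (c k) k (Real.arccos (x 0)) / x 5)

/-- The four integrals `H, C, J₁, J₂`. -/
def integrals (c : Fin 2 → ℝ) : Fin 4 → Phase → ℝ :=
  ![S.energy, geometric, S.J c 0, S.J c 1]

/-- The part of the phase space `(γ, γ) = 1` over the configurations in `G × I`; the points with
`M₃ = 0`, where `J₁` and `J₂` have a pole in the presence of gravity, are then removed. -/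
def phaseSpace (G : Set (ℝ × ℝ)) (I : Set ℝ) : Set Phase :=
  {x | x.config ∈ G ×ˢ I ∧ geometric x = 1 ∧ (S.grav ≠ 0 → x 5 ≠ 0)}

end StublerModel

/-- Partial derivative with respect to the `m`-th coordinate. -/
def partialDeriv (m : Fin 6) (F : Phase → ℝ) (x : Phase) : ℝ :=
  fderiv ℝ F x (Pi.single m 1)

/-- The entries of a bivector (field). -/
abbrev Bivector : Type := Phase → Matrix (Fin 6) (Fin 6) ℝ

/-- The summand of the Schouten bracket before the cyclic permutation of the indices. -/
def schoutenTerm (A B : Bivector) (x : Phase) (i j k : Fin 6) : ℝ :=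
  ∑ m, (B x m k * partialDeriv m (fun y => A y i j) x +
    A x m k * partialDeriv m (fun y => B y i j) x)

/-- The entries of the Schouten bracket `[A, B]` of two bivectors. -/
def schouten (A B : Bivector) (x : Phase) (i j k : Fin 6) : ℝ :=
  -(schoutenTerm A B x i j k + schoutenTerm A B x j k i + schoutenTerm A B x k i j)

/-- The bracket `{F₁, F₂} = ∑ P_ij ∂_i F₁ ∂_j F₂`. -/
def bivectorBracket (P : Bivector) (F₁ F₂ : Phase → ℝ) (x : Phase) : ℝ :=
  ∑ i, ∑ j, P x i j * partialDeriv i F₁ x * partialDeriv j F₂ x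

/-- The vector field `P dF`. -/
def hamiltonianField (P : Bivector) (F : Phase → ℝ) (x : Phase) : Phase :=
  P x *ᵥ fun j => partialDeriv j F x

/-- Over `G × I`, the entries of `P` are affine in the momenta, with coefficients that are smooth
functions of `(γ, z)`. -/
def AffineInMomenta (G : Set (ℝ × ℝ)) (I : Set ℝ) (P : Bivector) : Prop :=
  ∃ (u : Fin 6 → Fin 6 → Fin 3 → Config → ℝ) (w : Fin 6 → Fin 6 → Config → ℝ),
    (∀ i j k, ContDiffOn ℝ ∞ (u i j k) (G ×ˢ I)) ∧
    (∀ i j, ContDiffOn ℝ ∞ (w i j) (G ×ˢ I)) ∧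
    ∀ x : Phase, x.config ∈ G ×ˢ I → ∀ i j,
      P x i j = ∑ k, u i j k x.config * x.momentum k + w i j x.config

namespace StublerModel

variable (S : StublerModel)

/-- `P` is a bivector, affine in the momenta, with `[P, P] = 0` and with the integrals
`H, C, J₁, J₂` in involution. -/
structure IsSolution (c : Fin 2 → ℝ) (G : Set (ℝ × ℝ)) (I : Set ℝ) (P : Bivector) : Prop where
  skew : ∀ x : Phase, x.config ∈ G ×ˢ I → ∀ i j, P x i j = -P x j i
  affine : AffineInMomenta G I P
  jacobi : ∀ x ∈ S.phaseSpace G I, ∀ i j k, schouten P P x i j k = 0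
  involution : ∀ x ∈ S.phaseSpace G I, ∀ a b,
    bivectorBracket P (S.integrals c a) (S.integrals c b) x = 0

/-- `ρ_k = -v₁⁽ᵏ⁾ / v₂⁽ᵏ⁾`. -/
def rho (k : Fin 2) (γ : ℝ × ℝ) : ℝ := -(S.v1 k γ / S.v2 k γ)

/-- The function under the integral sign in the definition of `σ_k`. -/
def sigmaIntegrand (k : Fin 2) (α : Config → ℝ) (q : Config) : ℝ :=
  q.1.1 * (S.nu ^ 2 - 1) * (q.1.2 - q.1.1 * S.rho k q.1) / α q +
    (q.1.1 * fderiv ℝ α q ((0, 1), 0) - q.1.2 * fderiv ℝ α q ((1, 0), 0)) / α q ^ 2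

/-- `σ` is one of the (smooth) functions `β ∫ (…) dz`. -/
def IsSigma (G : Set (ℝ × ℝ)) (I : Set ℝ) (k : Fin 2) (α : Config → ℝ) (β : ℝ × ℝ → ℝ)
    (σ : Config → ℝ) : Prop :=
  ContDiffOn ℝ ∞ σ (G ×ˢ I) ∧
  ∀ γ ∈ G, ∀ z ∈ I,
    HasDerivAt (fun ζ => σ (γ, ζ)) (β γ * S.sigmaIntegrand k α (γ, z)) z

/-- The bivectors `P⁽ᵏ⁾`, built from `α`, `β` and `σ_k`. -/
def familyP (k : Fin 2) (α : Config → ℝ) (β : ℝ × ℝ → ℝ) (σ : Config → ℝ) : Bivector := fun x =>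
  let ρ := S.rho k (x 0, x 1)
  let s := σ x.config
  let τ := (x 0 * x 4 - x 1 * x 3) * (S.nu ^ 2 - 1)
  α x.config •
    !![0, 0, 0, 0, 0, 0;
       0, 0, 0, 0, 0, 0;
       0, 0, 0, 1, ρ, s;
       0, 0, -1, 0, 0, 0;
       0, 0, -ρ, 0, 0, 0;
       0, 0, -s, 0, 0, 0] +
  β (x 0, x 1) •
    !![0, 0, 0, 0, 0, -x 1;
       0, 0, 0, 0, 0, x 0;
       0, 0, 0, 0, 0, 0;
       0, 0, 0, 0, 0, x 0 * τ;
       0, 0, 0, 0, 0, x 1 * τ;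
       x 1, -x 0, 0, -(x 0 * τ), -(x 1 * τ), 0]

end StublerModel

end

/-! On the circle the vector (v₁, v₂) is best read through its normal and tangential components n
and t. The ladder relations of the Ferrers functions then become n' = t, t' = -ν² n, so n and t are
combinations of cos νφ and sin νφ. The behaviour as φ → 0 shows that the Wronskian n₁t₂ - n₂t₁ of
the two solutions is a nonzero constant (`exists_wronskian`). Hence dJ₁ and dJ₂ have independent
momentum parts and ρ₁ ≠ ρ₂.

Without gravity no integral depends on z. A bivector of the shape `fiberBivector` annihilates dC and
sends dJ_k to a multiple of ∂_z, so involution is automatic. Its Jacobi identity reduces to three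
equations on the triples made of z and two momenta (`schouten_fiberBivector`). For the families P⁽ᵏ⁾
one of them says that ρ_k does not depend on z, one is the formula for ∂σ_k/∂z, and the last is then
the Riccati equation of ρ_k, which follows from the linear equations for v (`fderiv_rho_tangent`).
For existence alone, the vector (v₂, -v₁) replaces (1, ρ) and no division is needed.

With gravity, fix a point of the circle and z. Involution is a linear system for the entries of P,
with coefficients polynomial in the momenta after denominators are cleared. As the entries are
affine in the momenta, comparison of coefficients leaves two constants N and N'
(`radial_entries_eq_zero`, `tangential_entries_eq`, `exists_eq_gravityFrame`). The Jacobi identity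
for γ₁, z, M₃ gives N N' = 0 (`mul_eq_zero_of_jacobi`), and then the rank is at most two. The
comparison needs A ≠ 0, where v₃ = n A + t B. Since A' = ν² B and B' = 1/f - A, the function A
vanishes on no interval. Rank at least four is an open condition, so angles with A ≠ 0 suffice. -/

/-! ### Contiguous hypergeometric series and ladder relations of the Ferrers functions. -/

theorem one_le_radius_ordinaryHypergeometricSeries (a b c : ℝ) (hc : ∀ k : ℕ, (k : ℝ) ≠ -c) :
    1 ≤ (ordinaryHypergeometricSeries ℝ a b c).radius := by
  by_cases ha : ∃ k : ℕ, (k : ℝ) = -a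
  · obtain ⟨k, hk⟩ := ha
    obtain rfl : a = -(k : ℝ) := by linarith
    rw [ordinaryHypergeometric_radius_top_of_neg_nat₁]
    exact le_top
  by_cases hb : ∃ k : ℕ, (k : ℝ) = -b
  · obtain ⟨k, hk⟩ := hb
    obtain rfl : b = -(k : ℝ) := by linarith
    rw [ordinaryHypergeometric_radius_top_of_neg_nat₂]
    exact le_top
  push Not at ha hb
  rw [ordinaryHypergeometricSeries_radius_eq_one ℝ a b c fun k => ⟨ha k, hb k, hc k⟩]

theorem hasFPowerSeriesOnBall_ordinaryHypergeometric (a b c : ℝ) (hc : ∀ k : ℕ, (k : ℝ) ≠ -c) :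
    HasFPowerSeriesOnBall (ordinaryHypergeometric a b c : ℝ → ℝ)
      (ordinaryHypergeometricSeries ℝ a b c) 0 1 := by
  have h := one_le_radius_ordinaryHypergeometricSeries a b c hc
  exact ((ordinaryHypergeometricSeries ℝ a b c).hasFPowerSeriesOnBall
    (lt_of_lt_of_le one_pos h)).mono one_pos h

theorem mem_eball_zero_one {y : ℝ} (hy : |y| < 1) : y ∈ Metric.eball (0 : ℝ) 1 := by
  rw [← ENNReal.ofReal_one, Metric.eball_ofReal]
  simpa using hy

theorem analyticAt_ordinaryHypergeometric (a b c : ℝ) (hc : ∀ k : ℕ, (k : ℝ) ≠ -c) {y : ℝ}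
    (hy : |y| < 1) : AnalyticAt ℝ (ordinaryHypergeometric a b c : ℝ → ℝ) y :=
  (hasFPowerSeriesOnBall_ordinaryHypergeometric a b c hc).analyticAt_of_mem (mem_eball_zero_one hy)

theorem hasSum_ordinaryHypergeometric (a b c : ℝ) (hc : ∀ k : ℕ, (k : ℝ) ≠ -c) {y : ℝ}
    (hy : |y| < 1) :
    HasSum (fun k => ordinaryHypergeometricCoefficient a b c k * y ^ k)
      (ordinaryHypergeometric a b c y) := by
  have h := (hasFPowerSeriesOnBall_ordinaryHypergeometric a b c hc).hasSum (mem_eball_zero_one hy)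
  rw [zero_add] at h
  refine h.congr_fun fun k => ?_
  rw [ordinaryHypergeometricSeries_apply_eq, smul_eq_mul]

theorem hasSum_deriv_ordinaryHypergeometric (a b c : ℝ) (hc : ∀ k : ℕ, (k : ℝ) ≠ -c) {y : ℝ}
    (hy : |y| < 1) :
    HasSum (fun k : ℕ => (k + 1) * ordinaryHypergeometricCoefficient a b c (k + 1) * y ^ (k + 1))
      (y * deriv (ordinaryHypergeometric a b c : ℝ → ℝ) y) := by
  have h := (hasFPowerSeriesOnBall_ordinaryHypergeometric a b c hc).fderiv.hasSum
    (mem_eball_zero_one hy)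
  have h2 := h.mapL (ContinuousLinearMap.apply ℝ ℝ y)
  have e : (ContinuousLinearMap.apply ℝ ℝ y)
      (fderiv ℝ (ordinaryHypergeometric a b c : ℝ → ℝ) (0 + y)) =
      y * deriv (ordinaryHypergeometric a b c : ℝ → ℝ) y := by
    simp
  rw [e] at h2
  refine h2.congr_fun ?_
  intro k
  simp only [ContinuousLinearMap.apply_apply, FormalMultilinearSeries.derivSeries_apply_diag,
    ordinaryHypergeometricSeries_apply_eq, nsmul_eq_mul, smul_eq_mul, Nat.cast_add, Nat.cast_one]
  ring

theorem ascPochhammer_eval_succ_left (a : ℝ) (k : ℕ) :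
    (ascPochhammer ℝ (k + 1)).eval a = a * (ascPochhammer ℝ k).eval (a + 1) := by
  rw [ascPochhammer_succ_left]
  simp [Polynomial.eval_comp]

/-- The Pochhammer shifts (n+1)_k (n+1+k) = (n+1)(n+2)_k and its analogue for -(n+1) express all the
coefficients involved through the single product (-n)_k (n+2)_k / (k! (c)_k). What remains is a
rational identity in n, c, k. -/
theorem hypergeometric_coeff_relations (n c : ℝ) (hc : ∀ k : ℕ, (k : ℝ) ≠ -c) (k : ℕ) :
    2 * ((k + 1) * ordinaryHypergeometricCoefficient (-n) (n + 1) c (k + 1)) -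
        (n + c) * (ordinaryHypergeometricCoefficient (-(n + 1)) (n + 2) c (k + 1) -
          ordinaryHypergeometricCoefficient (-n) (n + 1) c (k + 1)) =
      2 * (k + n + 1) * ordinaryHypergeometricCoefficient (-n) (n + 1) c k ∧
    2 * ((k + 1) * ordinaryHypergeometricCoefficient (-(n + 1)) (n + 2) c (k + 1)) -
        (n + 2 - c) * (ordinaryHypergeometricCoefficient (-(n + 1)) (n + 2) c (k + 1) -
          ordinaryHypergeometricCoefficient (-n) (n + 1) c (k + 1)) =
      2 * (k - n - 1) * ordinaryHypergeometricCoefficient (-(n + 1)) (n + 2) c k := by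
  have hk : (c + k) ≠ 0 := fun h => hc k (by linarith)
  have hck : (ascPochhammer ℝ k).eval c ≠ 0 := by
    rw [Ne, ascPochhammer_eval_eq_zero_iff]
    rintro ⟨j, -, hj⟩
    exact hc j hj
  have hf : ((Nat.factorial k : ℕ) : ℝ) ≠ 0 := by positivity
  have h1 : (ascPochhammer ℝ k).eval (n + 1) * (n + 1 + k) =
      (n + 1) * (ascPochhammer ℝ k).eval (n + 2) := by
    rw [← ascPochhammer_succ_eval, ascPochhammer_eval_succ_left]
    norm_num [add_assoc]
  have h2 : (ascPochhammer ℝ k).eval (-(n + 1)) * (-(n + 1) + k) =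
      -(n + 1) * (ascPochhammer ℝ k).eval (-n) := by
    rw [← ascPochhammer_succ_eval, ascPochhammer_eval_succ_left]
    congr 3; ring
  have hk1 : (k : ℝ) + 1 ≠ 0 := by positivity
  simp only [ordinaryHypergeometricCoefficient, ascPochhammer_succ_eval, Nat.factorial_succ,
    Nat.cast_mul, Nat.cast_add, Nat.cast_one]
  set U := (ascPochhammer ℝ k).eval (-n)
  set V := (ascPochhammer ℝ k).eval (n + 2)
  set K : ℝ := ((Nat.factorial k : ℕ) : ℝ)
  set Z := (ascPochhammer ℝ k).eval c
  set X := (ascPochhammer ℝ k).eval (n + 1)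
  set Y := (ascPochhammer ℝ k).eval (-(n + 1))
  have e1 : K⁻¹ * U * X * Z⁻¹ * (2 * (k + n + 1)) = 2 * (K⁻¹ * U * ((n + 1) * V) * Z⁻¹) := by
    rw [← h1]; ring
  have e2 : K⁻¹ * Y * V * Z⁻¹ * (2 * (k - n - 1)) = 2 * (K⁻¹ * (-(n + 1) * U) * V * Z⁻¹) := by
    rw [← h2]; ring
  rw [h1, h2, mul_comm _ (K⁻¹ * U * X * Z⁻¹), e1, mul_comm _ (K⁻¹ * Y * V * Z⁻¹), e2]
  constructor
  · field_simp
    ring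
  · field_simp
    ring

/-- This is the generating-function form of `hypergeometric_coeff_relations`; through y = (1 - x)/2
it becomes the pair of ladder relations in the degree. -/
theorem hypergeometric_contiguous (n c : ℝ) (hc : ∀ k : ℕ, (k : ℝ) ≠ -c) {y : ℝ}
    (hy : |y| < 1) :
    2 * (1 - y) * (y * deriv (ordinaryHypergeometric (-n) (n + 1) c : ℝ → ℝ) y) =
      (n + c) * (ordinaryHypergeometric (-(n + 1)) (n + 2) c y -
        ordinaryHypergeometric (-n) (n + 1) c y) +
      2 * (n + 1) * y * ordinaryHypergeometric (-n) (n + 1) c y ∧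
    2 * (1 - y) * (y * deriv (ordinaryHypergeometric (-(n + 1)) (n + 2) c : ℝ → ℝ) y) =
      (n + 2 - c) * (ordinaryHypergeometric (-(n + 1)) (n + 2) c y -
        ordinaryHypergeometric (-n) (n + 1) c y) -
      2 * (n + 1) * y * ordinaryHypergeometric (-(n + 1)) (n + 2) c y := by
  have key : ∀ a b : ℝ, HasSum (fun k : ℕ => k * ordinaryHypergeometricCoefficient a b c k * y ^ k)
      (y * deriv (ordinaryHypergeometric a b c : ℝ → ℝ) y) := by
    intro a b
    rw [← hasSum_nat_add_iff' 1]
    simpa using hasSum_deriv_ordinaryHypergeometric a b c hc hy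
  have d0 := hasSum_deriv_ordinaryHypergeometric (-n) (n + 1) c hc hy
  have d1 := hasSum_deriv_ordinaryHypergeometric (-(n + 1)) (n + 2) c hc hy
  have t0 := key (-n) (n + 1)
  have t1 := key (-(n + 1)) (n + 2)
  have s0 := hasSum_ordinaryHypergeometric (-n) (n + 1) c hc hy
  have s1 := hasSum_ordinaryHypergeometric (-(n + 1)) (n + 2) c hc hy
  -- Both series have constant term 1, which cancels in their difference. With it dropped, every
  -- series on the left starts at y^(k+1) and matches y times a series on the right.
  have u0 := (hasSum_nat_add_iff' 1).2 s0
  have u1 := (hasSum_nat_add_iff' 1).2 s1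
  simp only [Finset.range_one, Finset.sum_singleton, pow_zero, ordinaryHypergeometricCoefficient,
    Nat.factorial_zero, ascPochhammer_zero, Polynomial.eval_one, Nat.cast_one, inv_one,
    mul_one] at u0 u1
  have l0 := (d0.mul_left 2).sub ((u1.sub u0).mul_left (n + c))
  have r0 := ((t0.mul_left 2).add (s0.mul_left (2 * (n + 1)))).mul_left y
  have l1 := (d1.mul_left 2).sub ((u1.sub u0).mul_left (n + 2 - c))
  have r1 := ((t1.mul_left 2).sub (s1.mul_left (2 * (n + 1)))).mul_left y
  have h0 := l0.unique (r0.congr_fun fun k => by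
    have := (hypergeometric_coeff_relations n c hc k).1
    simp only [ordinaryHypergeometricCoefficient] at this ⊢
    linear_combination (y ^ (k + 1)) * this)
  have h1 := l1.unique (r1.congr_fun fun k => by
    have := (hypergeometric_coeff_relations n c hc k).2
    simp only [ordinaryHypergeometricCoefficient] at this ⊢
    linear_combination (y ^ (k + 1)) * this)
  constructor
  · linear_combination h0
  · linear_combination h1

/-- The order-independent part of the Ferrers functions of half-integer order. -/
theorem hasDerivAt_legendreP (n m : ℝ) (hm : ∀ k : ℕ, (k : ℝ) ≠ m - 1) {x : ℝ} (hx : -1 < x)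
    (hx' : x < 1) :
    HasDerivAt (legendreP n m)
      (((n + 1) * x * legendreP n m x - (n - m + 1) * legendreP (n + 1) m x) / (1 - x ^ 2)) x ∧
    HasDerivAt (legendreP (n + 1) m)
      (((n + m + 1) * legendreP n m x - (n + 1) * x * legendreP (n + 1) m x) / (1 - x ^ 2)) x := by
  have hc : ∀ k : ℕ, (k : ℝ) ≠ -(1 - m) := fun k h => hm k (by linarith)
  have h1 : (1 - x) ≠ 0 := by linarith
  have h2 : 1 - x ^ 2 ≠ 0 := by nlinarith
  have hq : 0 < (1 + x) / (1 - x) := div_pos (by linarith) (by linarith)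
  have hy : |(1 - x) / 2| < 1 := by rw [abs_lt]; constructor <;> linarith
  have dq : HasDerivAt (fun t : ℝ => (1 + t) / (1 - t)) (2 / (1 - x) ^ 2) x := by
    have := ((hasDerivAt_id x).const_add 1).div ((hasDerivAt_id x).const_sub 1) h1
    convert! this using 1
    simp only [id]
    ring
  have dw := (dq.rpow_const (p := m / 2) (Or.inl hq.ne')).div_const (Real.Gamma (1 - m))
  have dy : HasDerivAt (fun t : ℝ => (1 - t) / 2) (-1 / 2) x := by
    simpa using ((hasDerivAt_id x).const_sub 1).div_const 2
  have dF : ∀ a b : ℝ, HasDerivAt (fun t : ℝ => ordinaryHypergeometric a b (1 - m) ((1 - t) / 2))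
      (deriv (ordinaryHypergeometric a b (1 - m) : ℝ → ℝ) ((1 - x) / 2) * (-1 / 2)) x := fun a b =>
    (analyticAt_ordinaryHypergeometric a b (1 - m) hc hy).differentiableAt.hasDerivAt.comp x dy
  obtain ⟨r0, r1⟩ := hypergeometric_contiguous n (1 - m) hc hy
  have e : n + 1 + 1 = n + 2 := by ring
  have hpow : ((1 + x) / (1 - x)) ^ (m / 2 - 1) =
      ((1 + x) / (1 - x)) ^ (m / 2) * ((1 - x) / (1 + x)) := by
    rw [Real.rpow_sub_one hq.ne', div_eq_mul_inv _ ((1 + x) / (1 - x)), inv_div]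
  have h3 : 1 + x ≠ 0 := by linarith
  -- The logarithmic derivative of (1+x)/(1-x) is 2/(1-x²), so the weight contributes m/(1-x²).
  have hh : 2 / (1 - x) ^ 2 * ((1 - x) / (1 + x)) * (1 - x ^ 2) = 2 := by
    field_simp
    ring
  constructor
  · convert! dw.mul (dF (-n) (n + 1)) using 1
    rw [hpow, legendreP, legendreP, e, div_eq_iff h2]
    set F0 := (ordinaryHypergeometric (-n) (n + 1) (1 - m) ((1 - x) / 2) : ℝ)
    set w := ((1 + x) / (1 - x)) ^ (m / 2)
    linear_combination (-(m / 2) * w / Real.Gamma (1 - m) * F0) * hh +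
      w / Real.Gamma (1 - m) * r0
  · convert! dw.mul (dF (-(n + 1)) (n + 2)) using 1
    · funext t; simp only [legendreP, e, Pi.mul_apply]
    rw [hpow, legendreP, legendreP, e, div_eq_iff h2]
    set F1 := (ordinaryHypergeometric (-(n + 1)) (n + 2) (1 - m) ((1 - x) / 2) : ℝ)
    set w := ((1 + x) / (1 - x)) ^ (m / 2)
    linear_combination (-(m / 2) * w / Real.Gamma (1 - m) * F1) * hh +
      w / Real.Gamma (1 - m) * r1

theorem contDiffAt_legendreP (n m : ℝ) (hm : ∀ k : ℕ, (k : ℝ) ≠ m - 1) {x : ℝ} (hx : -1 < x)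
    (hx' : x < 1) : ContDiffAt ℝ ∞ (legendreP n m) x := by
  have hc : ∀ k : ℕ, (k : ℝ) ≠ -(1 - m) := fun k h => hm k (by linarith)
  have h1 : (1 - x) ≠ 0 := by linarith
  have hq : 0 < (1 + x) / (1 - x) := div_pos (by linarith) (by linarith)
  have hy : |(1 - x) / 2| < 1 := by rw [abs_lt]; constructor <;> linarith
  have hF : ContDiffAt ℝ ∞ (fun t : ℝ => ordinaryHypergeometric (-n) (n + 1) (1 - m) ((1 - t) / 2))
      x :=
    ((analyticAt_ordinaryHypergeometric _ _ _ hc hy).contDiffAt.comp x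
      ((contDiffAt_const.sub contDiffAt_id).div_const 2))
  have hw : ContDiffAt ℝ ∞ (fun t : ℝ => ((1 + t) / (1 - t)) ^ (m / 2)) x :=
    ContDiffAt.rpow_const_of_ne ((contDiffAt_const.add contDiffAt_id).div
      (contDiffAt_const.sub contDiffAt_id) h1) hq.ne'
  exact (hw.div_const _).mul hF

theorem natCast_ne_half (k : ℕ) : (k : ℝ) ≠ 3 / 2 - 1 := by
  intro h
  have h2 : ((2 * k : ℕ) : ℝ) = (1 : ℕ) := by push_cast; linarith
  have := Nat.cast_injective h2
  omega

theorem natCast_ne_neg_five_halves (k : ℕ) : (k : ℝ) ≠ -(3 / 2) - 1 := by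
  have : (0 : ℝ) ≤ k := k.cast_nonneg
  intro h
  linarith

/-- At order 3/2 the cosine vanishes, so the second solution is just a multiple of the first-kind
function of order -3/2, and every fact about it reduces to `legendreP`. -/
theorem legendreQ_three_halves (n x : ℝ) :
    legendreQ n (3 / 2) x =
      Real.pi / 2 * (Real.Gamma (n + 3 / 2 + 1) / Real.Gamma (n - 3 / 2 + 1)) *
        legendreP n (-(3 / 2)) x := by
  have h1 : Real.sin (3 / 2 * Real.pi) = -1 := by
    rw [show 3 / 2 * Real.pi = Real.pi / 2 + Real.pi by ring, Real.sin_add_pi, Real.sin_pi_div_two]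
  have h2 : Real.cos (3 / 2 * Real.pi) = 0 := by
    rw [show 3 / 2 * Real.pi = Real.pi / 2 + Real.pi by ring, Real.cos_add_pi, Real.cos_pi_div_two,
      neg_zero]
  rw [legendreQ, h1, h2]
  ring

theorem contDiffAt_legendreL (k : Fin 2) (n : ℝ) {x : ℝ} (hx : -1 < x) (hx' : x < 1) :
    ContDiffAt ℝ ∞ (legendreL k n (3 / 2)) x := by
  fin_cases k
  · exact contDiffAt_legendreP n _ natCast_ne_half hx hx'
  · change ContDiffAt ℝ ∞ (legendreQ n (3 / 2)) x
    rw [funext (legendreQ_three_halves n)]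
    exact contDiffAt_const.mul (contDiffAt_legendreP n _ natCast_ne_neg_five_halves hx hx')

theorem hasDerivAt_legendreL (k : Fin 2) {ν : ℝ} (h0 : 0 < ν) (h1 : ν < 1) {x : ℝ} (hx : -1 < x)
    (hx' : x < 1) :
    HasDerivAt (legendreL k (ν - 1 / 2) (3 / 2))
      (((ν + 1 / 2) * x * legendreL k (ν - 1 / 2) (3 / 2) x -
        (ν - 1) * legendreL k (ν + 1 / 2) (3 / 2) x) / (1 - x ^ 2)) x ∧
    HasDerivAt (legendreL k (ν + 1 / 2) (3 / 2))
      (((ν + 2) * legendreL k (ν - 1 / 2) (3 / 2) x -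
        (ν + 1 / 2) * x * legendreL k (ν + 1 / 2) (3 / 2) x) / (1 - x ^ 2)) x := by
  have e : ν + 1 / 2 = ν - 1 / 2 + 1 := by ring
  fin_cases k
  · obtain ⟨d0, d1⟩ := hasDerivAt_legendreP (ν - 1 / 2) (3 / 2) natCast_ne_half hx hx'
    rw [← e] at d0 d1
    change HasDerivAt (legendreP _ _) (((ν + 1 / 2) * x * legendreP _ _ x -
      (ν - 1) * legendreP _ _ x) / _) x ∧ HasDerivAt (legendreP _ _) (((ν + 2) * legendreP _ _ x -
      (ν + 1 / 2) * x * legendreP _ _ x) / _) x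
    constructor
    · convert! d0 using 2
      ring
    · convert! d1 using 2
      ring
  · obtain ⟨d0, d1⟩ := hasDerivAt_legendreP (ν - 1 / 2) (-(3 / 2)) natCast_ne_neg_five_halves hx hx'
    rw [← e] at d0 d1
    -- Passing from order 3/2 to -3/2 exchanges the coefficients ν + 2 and ν - 1 of the ladder
    -- relations. Raising the degree multiplies the Gamma quotient by (ν + 2)/(ν - 1), which undoes
    -- the exchange.
    have g1 : Real.Gamma (ν + 1 / 2 + 3 / 2 + 1) =
        (ν + 2) * Real.Gamma (ν - 1 / 2 + 3 / 2 + 1) := by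
      rw [show ν + 1 / 2 + 3 / 2 + 1 = (ν + 2) + 1 by ring, Real.Gamma_add_one (by linarith)]
      congr 2; ring
    have g2 : Real.Gamma (ν + 1 / 2 - 3 / 2 + 1) =
        (ν - 1) * Real.Gamma (ν - 1 / 2 - 3 / 2 + 1) := by
      rw [show ν + 1 / 2 - 3 / 2 + 1 = (ν - 1) + 1 by ring, Real.Gamma_add_one (by linarith)]
      congr 2; ring
    have hn : ν - 1 ≠ 0 := by linarith
    change HasDerivAt (legendreQ _ _) (((ν + 1 / 2) * x * legendreQ _ _ x -
      (ν - 1) * legendreQ _ _ x) / _) x ∧ HasDerivAt (legendreQ _ _) (((ν + 2) * legendreQ _ _ x -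
      (ν + 1 / 2) * x * legendreQ _ _ x) / _) x
    simp only [funext (legendreQ_three_halves _)]
    constructor
    · convert! d0.const_mul _ using 1
      rw [g1, g2]
      field_simp
      ring
    · convert! d1.const_mul _ using 1
      rw [g1, g2]
      field_simp
      ring

/-! ### The vectors (v₁, v₂) along the unit circle and their Wronskian. -/

namespace StublerModel

variable (S : StublerModel)

theorem d_pos : 0 < S.d := mul_pos S.mass_pos (pow_pos S.radius_pos 2)

theorem nu_sq : S.nu ^ 2 = S.inertia / (S.d + S.inertia) :=
  Real.sq_sqrt (div_nonneg S.inertia_pos.le (add_pos S.d_pos S.inertia_pos).le)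

theorem nu_pos : 0 < S.nu :=
  Real.sqrt_pos.2 (div_pos S.inertia_pos (add_pos S.d_pos S.inertia_pos))

theorem nu_lt_one : S.nu < 1 := by
  have h : S.nu ^ 2 < 1 := by
    rw [S.nu_sq, div_lt_one (add_pos S.d_pos S.inertia_pos)]
    linarith [S.d_pos]
  nlinarith [S.nu_pos]

theorem contDiffAt_v1 (k : Fin 2) {γ : ℝ × ℝ} (h1 : -1 < γ.1) (h2 : γ.1 < 1) (h3 : 0 < γ.2) :
    ContDiffAt ℝ ∞ (S.v1 k) γ :=
  (contDiffAt_snd.rpow_const_of_ne h3.ne').mul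
    ((contDiffAt_legendreL k _ h1 h2).comp γ contDiffAt_fst)

theorem contDiffAt_v2 (k : Fin 2) {γ : ℝ × ℝ} (h1 : -1 < γ.1) (h2 : γ.1 < 1) (h3 : 0 < γ.2) :
    ContDiffAt ℝ ∞ (S.v2 k) γ := by
  have hr : ContDiffAt ℝ ∞ (fun γ : ℝ × ℝ => γ.2 ^ (3 / 2 : ℝ) * (S.nu + 1)) γ :=
    (contDiffAt_snd.rpow_const_of_ne h3.ne').mul contDiffAt_const
  have hr0 : γ.2 ^ (3 / 2 : ℝ) * (S.nu + 1) ≠ 0 :=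
    mul_ne_zero (Real.rpow_pos_of_pos h3 _).ne' (by linarith [S.nu_pos])
  refine (contDiffAt_const.div hr hr0).mul (ContDiffAt.sub
    ((contDiffAt_legendreL k _ h1 h2).comp γ contDiffAt_fst) (ContDiffAt.mul ?_
    ((contDiffAt_legendreL k _ h1 h2).comp γ contDiffAt_fst)))
  fun_prop

theorem cos_mem_Ioo {θ : ℝ} (h : θ ∈ Set.Ioo 0 Real.pi) :
    -1 < Real.cos θ ∧ Real.cos θ < 1 ∧ 0 < Real.sin θ := by
  have hs := Real.sin_pos_of_mem_Ioo h
  have := Real.sin_sq_add_cos_sq θ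
  refine ⟨by nlinarith, by nlinarith, hs⟩

/-- The equations satisfied by `v₁`, `v₂` along the unit circle. -/
theorem hasDerivAt_v_circle (k : Fin 2) {θ : ℝ} (h : θ ∈ Set.Ioo 0 Real.pi) :
    HasDerivAt (fun t => S.v1 k (Real.cos t, Real.sin t))
      ((S.nu ^ 2 - 1) * Real.sin θ * (Real.cos θ * S.v1 k (Real.cos θ, Real.sin θ) +
        Real.sin θ * S.v2 k (Real.cos θ, Real.sin θ))) θ ∧
    HasDerivAt (fun t => S.v2 k (Real.cos t, Real.sin t))
      (-((S.nu ^ 2 - 1) * Real.cos θ * (Real.cos θ * S.v1 k (Real.cos θ, Real.sin θ) +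
        Real.sin θ * S.v2 k (Real.cos θ, Real.sin θ)))) θ := by
  obtain ⟨hx, hx', hs⟩ := cos_mem_Ioo h
  obtain ⟨d0, d1⟩ := hasDerivAt_legendreL k S.nu_pos S.nu_lt_one hx hx'
  have e0 := d0.comp θ (Real.hasDerivAt_cos θ)
  have e1 := d1.comp θ (Real.hasDerivAt_cos θ)
  have er := (Real.hasDerivAt_sin θ).rpow_const (p := 3 / 2) (Or.inl hs.ne')
  have hν : S.nu + 1 ≠ 0 := by linarith [S.nu_pos]
  -- In terms of the square root of sin θ all half-integer powers are polynomial, and the identities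
  -- become algebraic with cos² θ = 1 - w⁴.
  set w := Real.sin θ ^ (1 / 2 : ℝ) with hw
  have hw0 : w ≠ 0 := (Real.rpow_pos_of_pos hs _).ne'
  have hw2 : Real.sin θ = w ^ 2 := by
    rw [hw, ← Real.rpow_natCast, ← Real.rpow_mul hs.le]; norm_num
  have hw3 : Real.sin θ ^ (3 / 2 : ℝ) = w ^ 3 := by
    rw [hw, ← Real.rpow_natCast, ← Real.rpow_mul hs.le]; norm_num
  have hw1 : Real.sin θ ^ (3 / 2 - 1 : ℝ) = w := by rw [hw]; norm_num
  have hc : 1 - Real.cos θ ^ 2 = w ^ 4 := by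
    rw [← Real.sin_sq, hw2]; ring
  have hc2 : Real.cos θ ^ 2 = 1 - w ^ 4 := by linarith
  set L0 := legendreL k (S.nu - 1 / 2) (3 / 2) (Real.cos θ) with hL0
  set L1 := legendreL k (S.nu + 1 / 2) (3 / 2) (Real.cos θ) with hL1
  have E1 : S.v1 k (Real.cos θ, Real.sin θ) = w ^ 3 * L0 := by simp only [v1, hw3, hL0]
  have E2 : S.v2 k (Real.cos θ, Real.sin θ) = 1 / (w ^ 3 * (S.nu + 1)) *
      (L1 - Real.cos θ * ((w ^ 2) ^ 2 * (S.nu + 1) + 1) * L0) := by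
    simp only [v2, hw3, hL0, hL1, ← hw2]
  have E3 : Real.cos θ * S.v1 k (Real.cos θ, Real.sin θ) +
      Real.sin θ * S.v2 k (Real.cos θ, Real.sin θ) = (L1 - Real.cos θ * L0) / (w * (S.nu + 1)) := by
    rw [E1, E2, hw2]; field_simp; ring
  rw [E3]
  constructor
  · convert! er.mul e0 using 1
    simp only [Function.comp, ← hL0, hw1, hw3, hc]
    rw [hw2]
    field_simp
    ring
  · have en := (hasDerivAt_const θ (1 : ℝ)).div (er.mul_const (S.nu + 1))
      (by rw [hw3]; exact mul_ne_zero (pow_ne_zero 3 hw0) hν)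
    have ep := ((Real.hasDerivAt_cos θ).mul
      ((((Real.hasDerivAt_sin θ).pow 2).mul_const (S.nu + 1)).add_const 1)).mul e0
    convert! en.mul (e1.sub ep) using 1
    simp only [Function.comp, ← hL0, ← hL1, hw1, hw3, hc, Pi.mul_apply, Pi.sub_apply, Pi.div_apply,
      Pi.pow_apply]
    rw [hw2]
    set c := Real.cos θ
    field_simp
    norm_num only
    clear * - hc2
    generalize S.nu = n at *
    grind

/-- The normal component `γ₁ v₁ + γ₂ v₂` along the unit circle. -/
noncomputable def normalPart (k : Fin 2) (θ : ℝ) : ℝ :=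
  Real.cos θ * S.v1 k (Real.cos θ, Real.sin θ) + Real.sin θ * S.v2 k (Real.cos θ, Real.sin θ)

/-- The tangential component `γ₁ v₂ - γ₂ v₁` along the unit circle. -/
noncomputable def tangentPart (k : Fin 2) (θ : ℝ) : ℝ :=
  Real.cos θ * S.v2 k (Real.cos θ, Real.sin θ) - Real.sin θ * S.v1 k (Real.cos θ, Real.sin θ)

/-- The derivative of (v₁, v₂) along the circle is orthogonal to the normal, so only the rotation of
the normal contributes. -/
theorem hasDerivAt_normalPart (k : Fin 2) {θ : ℝ} (h : θ ∈ Set.Ioo 0 Real.pi) :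
    HasDerivAt (S.normalPart k) (S.tangentPart k θ) θ := by
  obtain ⟨d1, d2⟩ := S.hasDerivAt_v_circle k h
  convert! ((Real.hasDerivAt_cos θ).mul d1).add ((Real.hasDerivAt_sin θ).mul d2) using 1
  simp only [tangentPart]
  ring

theorem hasDerivAt_tangentPart (k : Fin 2) {θ : ℝ} (h : θ ∈ Set.Ioo 0 Real.pi) :
    HasDerivAt (S.tangentPart k) (-S.nu ^ 2 * S.normalPart k θ) θ := by
  obtain ⟨d1, d2⟩ := S.hasDerivAt_v_circle k h
  convert! ((Real.hasDerivAt_cos θ).mul d2).sub ((Real.hasDerivAt_sin θ).mul d1) using 1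
  simp only [normalPart]
  linear_combination ((S.nu ^ 2 - 1) * (Real.cos θ * S.v1 k (Real.cos θ, Real.sin θ) +
    Real.sin θ * S.v2 k (Real.cos θ, Real.sin θ))) * Real.sin_sq_add_cos_sq θ

theorem v1_circle (k : Fin 2) (θ : ℝ) : S.v1 k (Real.cos θ, Real.sin θ) =
    Real.cos θ * S.normalPart k θ - Real.sin θ * S.tangentPart k θ := by
  simp only [normalPart, tangentPart]
  linear_combination (-S.v1 k (Real.cos θ, Real.sin θ)) * Real.sin_sq_add_cos_sq θ

/-- The components of `v` are harmonic oscillations of frequency `ν`. -/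
theorem exists_normalPart_eq (k : Fin 2) : ∃ A B : ℝ, ∀ θ ∈ Set.Ioo 0 Real.pi,
    S.normalPart k θ = A * Real.cos (S.nu * θ) + B * Real.sin (S.nu * θ) ∧
    S.tangentPart k θ = S.nu * (B * Real.cos (S.nu * θ) - A * Real.sin (S.nu * θ)) := by
  have hν := S.nu_pos.ne'
  have hconst : ∀ g : ℝ → ℝ, (∀ θ ∈ Set.Ioo 0 Real.pi, HasDerivAt g 0 θ) →
      ∃ A, ∀ θ ∈ Set.Ioo 0 Real.pi, g θ = A := fun g hg =>
    isOpen_Ioo.exists_is_const_of_deriv_eq_zero isPreconnected_Ioo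
      (fun θ h => (hg θ h).differentiableAt.differentiableWithinAt) fun θ h => (hg θ h).deriv
  have dc : ∀ θ, HasDerivAt (fun t => Real.cos (S.nu * t)) (-Real.sin (S.nu * θ) * S.nu) θ :=
    fun θ => by simpa using ((hasDerivAt_id θ).const_mul S.nu).cos
  have ds : ∀ θ, HasDerivAt (fun t => Real.sin (S.nu * t)) (Real.cos (S.nu * θ) * S.nu) θ :=
    fun θ => by simpa using ((hasDerivAt_id θ).const_mul S.nu).sin
  -- The two first integrals come from solving for A and B in the general solution of n' = t, t' =
  -- -ν² n.
  obtain ⟨A, hA⟩ := hconst (fun t => S.normalPart k t * Real.cos (S.nu * t) -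
    S.tangentPart k t * Real.sin (S.nu * t) / S.nu) fun θ h => by
      convert! ((S.hasDerivAt_normalPart k h).mul (dc θ)).sub
        (((S.hasDerivAt_tangentPart k h).mul (ds θ)).div_const S.nu) using 1
      field_simp
      ring
  obtain ⟨B, hB⟩ := hconst (fun t => S.normalPart k t * Real.sin (S.nu * t) +
    S.tangentPart k t * Real.cos (S.nu * t) / S.nu) fun θ h => by
      convert! ((S.hasDerivAt_normalPart k h).mul (ds θ)).add
        (((S.hasDerivAt_tangentPart k h).mul (dc θ)).div_const S.nu) using 1
      field_simp
      ring
  refine ⟨A, B, fun θ h => ?_⟩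
  have h1 := Real.sin_sq_add_cos_sq (S.nu * θ)
  rw [← hA θ h, ← hB θ h]
  constructor
  · linear_combination (-S.normalPart k θ) * h1
  · field_simp
    linear_combination (-S.tangentPart k θ) * h1

/-- Splitting sin^(3/2) into powers of 1 ± cos θ cancels the pole of the Legendre weight at γ₁ = 1.
The remaining factor has a finite nonzero limit as θ → 0. -/
theorem v1_zero_circle {θ : ℝ} (h : θ ∈ Set.Ioo 0 Real.pi) :
    S.v1 0 (Real.cos θ, Real.sin θ) = (1 + Real.cos θ) ^ (3 / 2 : ℝ) / Real.Gamma (1 - 3 / 2) *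
      ordinaryHypergeometric (-(S.nu - 1 / 2)) (S.nu - 1 / 2 + 1) (1 - 3 / 2)
        ((1 - Real.cos θ) / 2) := by
  obtain ⟨hx, hx', hs⟩ := cos_mem_Ioo h
  have h1 : 0 < 1 + Real.cos θ := by linarith
  have h2 : 0 < 1 - Real.cos θ := by linarith
  have e : Real.sin θ ^ (3 / 2 : ℝ) =
      (1 + Real.cos θ) ^ (3 / 4 : ℝ) * (1 - Real.cos θ) ^ (3 / 4 : ℝ) := by
    rw [← Real.mul_rpow h1.le h2.le,
      show (1 + Real.cos θ) * (1 - Real.cos θ) = Real.sin θ ^ 2 by rw [Real.sin_sq]; ring,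
      ← Real.rpow_natCast, ← Real.rpow_mul hs.le]
    norm_num
  have e2 : (1 + Real.cos θ) ^ (3 / 2 : ℝ) =
      (1 + Real.cos θ) ^ (3 / 4 : ℝ) * (1 + Real.cos θ) ^ (3 / 4 : ℝ) := by
    rw [← Real.rpow_add h1]; norm_num
  have h3 : (1 - Real.cos θ) ^ (3 / 4 : ℝ) ≠ 0 := (Real.rpow_pos_of_pos h2 _).ne'
  change Real.sin θ ^ (3 / 2 : ℝ) * legendreP _ _ _ = _
  rw [legendreP, e, e2, show (3 / 2 / 2 : ℝ) = 3 / 4 by norm_num, Real.div_rpow h1.le h2.le]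
  field_simp

/-- For order -3/2 the powers of 1 - cos θ add up instead of cancelling, so this component tends to
0 as θ → 0 without vanishing nearby. The constant is nonzero because 0 < ν < 1 keeps both Gamma
arguments off the poles. -/
theorem v1_one_circle : ∃ K : ℝ, K ≠ 0 ∧ ∀ θ ∈ Set.Ioo 0 Real.pi,
    S.v1 1 (Real.cos θ, Real.sin θ) = K * ((1 - Real.cos θ) ^ (3 / 2 : ℝ) *
      ordinaryHypergeometric (-(S.nu - 1 / 2)) (S.nu - 1 / 2 + 1) (1 - -(3 / 2))
        ((1 - Real.cos θ) / 2)) := by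
  have h0 := S.nu_pos
  have h1 := S.nu_lt_one
  refine ⟨Real.pi / 2 * (Real.Gamma (S.nu - 1 / 2 + 3 / 2 + 1) /
    Real.Gamma (S.nu - 1 / 2 - 3 / 2 + 1)) / Real.Gamma (1 - -(3 / 2)), ?_, fun θ h => ?_⟩
  · have g1 : Real.Gamma (S.nu - 1 / 2 + 3 / 2 + 1) ≠ 0 := (Real.Gamma_pos_of_pos (by linarith)).ne'
    have g2 : Real.Gamma (S.nu - 1 / 2 - 3 / 2 + 1) ≠ 0 := by
      refine Real.Gamma_ne_zero fun m hm => ?_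
      have e : S.nu = 1 - m := by linarith
      rcases m with _ | m
      · simp at e; linarith
      · push_cast at e
        have : (0 : ℝ) ≤ m := m.cast_nonneg
        linarith
    have g3 : Real.Gamma (1 - -(3 / 2)) ≠ 0 := (Real.Gamma_pos_of_pos (by norm_num)).ne'
    have := Real.pi_pos.ne'
    positivity
  obtain ⟨hx, hx', hs⟩ := cos_mem_Ioo h
  have h1 : 0 < 1 + Real.cos θ := by linarith
  have h2 : 0 < 1 - Real.cos θ := by linarith
  have e : Real.sin θ ^ (3 / 2 : ℝ) =
      (1 + Real.cos θ) ^ (3 / 4 : ℝ) * (1 - Real.cos θ) ^ (3 / 4 : ℝ) := by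
    rw [← Real.mul_rpow h1.le h2.le,
      show (1 + Real.cos θ) * (1 - Real.cos θ) = Real.sin θ ^ 2 by rw [Real.sin_sq]; ring,
      ← Real.rpow_natCast, ← Real.rpow_mul hs.le]
    norm_num
  have e2 : (1 - Real.cos θ) ^ (3 / 2 : ℝ) =
      (1 - Real.cos θ) ^ (3 / 4 : ℝ) * (1 - Real.cos θ) ^ (3 / 4 : ℝ) := by
    rw [← Real.rpow_add h2]; norm_num
  have h3 : (1 + Real.cos θ) ^ (3 / 4 : ℝ) ≠ 0 := (Real.rpow_pos_of_pos h1 _).ne'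
  have h4 : (1 - Real.cos θ) ^ (3 / 4 : ℝ) ≠ 0 := (Real.rpow_pos_of_pos h2 _).ne'
  change Real.sin θ ^ (3 / 2 : ℝ) * legendreQ _ _ _ = _
  rw [legendreQ_three_halves, legendreP, e, e2, show (-(3 / 2) / 2 : ℝ) = -(3 / 4) by norm_num,
    Real.div_rpow h1.le h2.le, Real.rpow_neg h1.le, Real.rpow_neg h2.le]
  field_simp

theorem tendsto_hypergeometric_cos (a b c : ℝ) (hc : ∀ k : ℕ, (k : ℝ) ≠ -c) :
    Filter.Tendsto (fun θ : ℝ => (ordinaryHypergeometric a b c ((1 - Real.cos θ) / 2) : ℝ))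
      (nhdsWithin 0 (Set.Ioo 0 Real.pi)) (nhds 1) := by
  have h1 : ContinuousAt (ordinaryHypergeometric a b c : ℝ → ℝ) ((1 - Real.cos 0) / 2) :=
    (analyticAt_ordinaryHypergeometric a b c hc (by norm_num)).continuousAt
  have h2 : ContinuousAt (fun θ : ℝ => (ordinaryHypergeometric a b c ((1 - Real.cos θ) / 2) : ℝ))
      0 := ContinuousAt.comp (f := fun θ => (1 - Real.cos θ) / 2) h1 (by fun_prop)
  have h3 := h2.tendsto
  simp only [Real.cos_zero, sub_self, zero_div, ordinaryHypergeometric_zero] at h3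
  exact h3.mono_left nhdsWithin_le_nhds

/-- `J₁` and `J₂` are independent: the Wronskian of `v⁽¹⁾`, `v⁽²⁾` does not vanish. -/
theorem exists_wronskian : ∃ W : ℝ, W ≠ 0 ∧ ∀ θ ∈ Set.Ioo 0 Real.pi,
    S.normalPart 0 θ * S.tangentPart 1 θ - S.normalPart 1 θ * S.tangentPart 0 θ = W := by
  obtain ⟨A0, B0, h0⟩ := S.exists_normalPart_eq 0
  obtain ⟨A1, B1, h1⟩ := S.exists_normalPart_eq 1
  obtain ⟨K, hK, hK1⟩ := S.v1_one_circle
  have hne : (nhdsWithin (0 : ℝ) (Set.Ioo 0 Real.pi)).NeBot :=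
    left_nhdsWithin_Ioo_neBot Real.pi_pos
  -- At θ = 0 the first coordinate is the normal one, so the limit of v₁ reads off the cosine
  -- amplitude.
  have hlim : ∀ (k : Fin 2) (A B : ℝ), (∀ θ ∈ Set.Ioo 0 Real.pi,
      S.normalPart k θ = A * Real.cos (S.nu * θ) + B * Real.sin (S.nu * θ) ∧
      S.tangentPart k θ = S.nu * (B * Real.cos (S.nu * θ) - A * Real.sin (S.nu * θ))) →
      Filter.Tendsto (fun θ => S.v1 k (Real.cos θ, Real.sin θ))
        (nhdsWithin 0 (Set.Ioo 0 Real.pi)) (nhds A) := by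
    intro k A B h
    have hcont : ContinuousAt (fun θ => Real.cos θ * (A * Real.cos (S.nu * θ) +
        B * Real.sin (S.nu * θ)) - Real.sin θ * (S.nu * (B * Real.cos (S.nu * θ) -
        A * Real.sin (S.nu * θ)))) 0 := by fun_prop
    have ht := hcont.tendsto.mono_left (nhdsWithin_le_nhds (s := Set.Ioo 0 Real.pi))
    simp only [mul_zero, Real.cos_zero, Real.sin_zero, zero_mul, mul_one, add_zero, one_mul,
      sub_zero] at ht
    refine ht.congr' (eventually_nhdsWithin_of_forall fun θ hθ => ?_)
    beta_reduce
    rw [S.v1_circle, (h θ hθ).1, (h θ hθ).2]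
  have c0 : ∀ k : ℕ, (k : ℝ) ≠ -(1 - 3 / 2) := fun k h => natCast_ne_half k (by linarith)
  have c1 : ∀ k : ℕ, (k : ℝ) ≠ -(1 - -(3 / 2)) :=
    fun k h => natCast_ne_neg_five_halves k (by linarith)
  have hA0 : A0 ≠ 0 := by
    have t1 := hlim 0 A0 B0 h0
    have t2 : Filter.Tendsto (fun θ : ℝ => (1 + Real.cos θ) ^ (3 / 2 : ℝ))
        (nhdsWithin 0 (Set.Ioo 0 Real.pi)) (nhds (2 ^ (3 / 2 : ℝ))) := by
      have hcont : ContinuousAt (fun θ : ℝ => (1 + Real.cos θ) ^ (3 / 2 : ℝ)) 0 :=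
        ContinuousAt.rpow_const (by fun_prop) (Or.inl (by norm_num))
      have := hcont.tendsto
      rw [Real.cos_zero, one_add_one_eq_two] at this
      exact this.mono_left nhdsWithin_le_nhds
    have t3 := (t2.div_const (Real.Gamma (1 - 3 / 2))).mul
      (tendsto_hypergeometric_cos (-(S.nu - 1 / 2)) (S.nu - 1 / 2 + 1) _ c0)
    have t4 := t3.congr' (eventually_nhdsWithin_of_forall fun θ hθ => (S.v1_zero_circle hθ).symm)
    rw [tendsto_nhds_unique t1 t4, mul_one]
    refine div_ne_zero (Real.rpow_pos_of_pos two_pos _).ne' (Real.Gamma_ne_zero fun m hm => ?_)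
    exact natCast_ne_half m (by linarith)
  have hF := tendsto_hypergeometric_cos (-(S.nu - 1 / 2)) (S.nu - 1 / 2 + 1) _ c1
  have hA1 : A1 = 0 := by
    have t1 := hlim 1 A1 B1 h1
    have t2 : Filter.Tendsto (fun θ : ℝ => (1 - Real.cos θ) ^ (3 / 2 : ℝ))
        (nhdsWithin 0 (Set.Ioo 0 Real.pi)) (nhds 0) := by
      have hcont : ContinuousAt (fun θ : ℝ => (1 - Real.cos θ) ^ (3 / 2 : ℝ)) 0 :=
        ContinuousAt.rpow_const (by fun_prop) (Or.inr (by norm_num))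
      have := hcont.tendsto
      rw [Real.cos_zero, sub_self, Real.zero_rpow (by norm_num)] at this
      exact this.mono_left nhdsWithin_le_nhds
    have t4 := ((t2.mul hF).const_mul K).congr'
      (eventually_nhdsWithin_of_forall fun θ hθ => (hK1 θ hθ).symm)
    rw [tendsto_nhds_unique t1 t4]
    ring
  -- With both amplitudes zero the second vector would vanish identically, against the explicit form
  -- of v₁ for small θ. The Wronskian ν (A₀B₁ - A₁B₀) then reduces to ν A₀B₁.
  have hB1 : B1 ≠ 0 := by
    rintro rfl
    obtain ⟨θ, hθ, hθ'⟩ := ((hF.eventually_ne one_ne_zero).and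
      (eventually_mem_nhdsWithin)).exists
    have hz := S.v1_circle 1 θ
    rw [(h1 θ hθ').1, (h1 θ hθ').2, hA1, hK1 θ hθ'] at hz
    simp only [zero_mul, add_zero, sub_zero, mul_zero] at hz
    exact mul_ne_zero hK (mul_ne_zero
      (Real.rpow_pos_of_pos (sub_pos.2 (cos_mem_Ioo hθ').2.1) (3 / 2)).ne' hθ) hz
  refine ⟨S.nu * (A0 * B1), mul_ne_zero S.nu_pos.ne' (mul_ne_zero hA0 hB1), fun θ hθ => ?_⟩
  rw [(h0 θ hθ).1, (h0 θ hθ).2, (h1 θ hθ).1, (h1 θ hθ).2, hA1]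
  linear_combination (S.nu * A0 * B1) * Real.sin_sq_add_cos_sq (S.nu * θ)

end StublerModel

/-! ### Differentials of the integrals on the circle. -/

theorem exists_angle {x y : ℝ} (h1 : -1 < x) (h2 : x < 1) (h3 : 0 < y) (h : x * x + y * y = 1) :
    Real.arccos x ∈ Set.Ioo 0 Real.pi ∧ Real.cos (Real.arccos x) = x ∧
      Real.sin (Real.arccos x) = y := by
  refine ⟨⟨Real.arccos_pos.2 h2, lt_of_le_of_ne (Real.arccos_le_pi x) ?_⟩,
    Real.cos_arccos h1.le h2.le, ?_⟩
  · rw [Ne, Real.arccos_eq_pi]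
    exact h1.not_ge
  · rw [Real.sin_arccos, show 1 - x ^ 2 = y ^ 2 by linarith, Real.sqrt_sq h3.le]

theorem linear_apply_pair (L : ℝ × ℝ →L[ℝ] ℝ) (a b : ℝ) :
    L (a, b) = a * L (1, 0) + b * L (0, 1) := by
  rw [show (a, b) = a • ((1 : ℝ), (0 : ℝ)) + b • ((0 : ℝ), (1 : ℝ)) by ext <;> simp, map_add,
    map_smul, map_smul, smul_eq_mul, smul_eq_mul]

namespace StublerModel

variable (S : StublerModel)

theorem hasDerivAt_circle (θ : ℝ) :
    HasDerivAt (fun t => (Real.cos t, Real.sin t)) (-Real.sin θ, Real.cos θ) θ :=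
  (Real.hasDerivAt_cos θ).prodMk (Real.hasDerivAt_sin θ)

/-- The functions v_i of two variables satisfy the equations only along the circle, so only their
derivative in the tangent direction (-γ₂, γ₁) is controlled. -/
theorem fderiv_v_tangent (k : Fin 2) {γ : ℝ × ℝ} (h1 : -1 < γ.1) (h2 : γ.1 < 1) (h3 : 0 < γ.2)
    (h : γ.1 * γ.1 + γ.2 * γ.2 = 1) :
    fderiv ℝ (S.v1 k) γ (-γ.2, γ.1) =
      (S.nu ^ 2 - 1) * γ.2 * (γ.1 * S.v1 k γ + γ.2 * S.v2 k γ) ∧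
    fderiv ℝ (S.v2 k) γ (-γ.2, γ.1) =
      -((S.nu ^ 2 - 1) * γ.1 * (γ.1 * S.v1 k γ + γ.2 * S.v2 k γ)) := by
  obtain ⟨hm, hc, hs⟩ := exists_angle h1 h2 h3 h
  have d1 := (S.contDiffAt_v1 k h1 h2 h3).differentiableAt (by simp)
  have d2 := (S.contDiffAt_v2 k h1 h2 h3).differentiableAt (by simp)
  obtain ⟨e1, e2⟩ := S.hasDerivAt_v_circle k hm
  have hγ : γ = (Real.cos (Real.arccos γ.1), Real.sin (Real.arccos γ.1)) := by rw [hc, hs]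
  have f1 := HasFDerivAt.comp_hasDerivAt (Real.arccos γ.1) (hγ ▸ d1.hasFDerivAt)
    (hasDerivAt_circle (Real.arccos γ.1))
  have f2 := HasFDerivAt.comp_hasDerivAt (Real.arccos γ.1) (hγ ▸ d2.hasFDerivAt)
    (hasDerivAt_circle (Real.arccos γ.1))
  have u1 := f1.unique e1
  have u2 := f2.unique e2
  rw [hc, hs] at u1 u2
  exact ⟨u1, u2⟩

theorem hasDerivAt_v3 (c : ℝ) (k : Fin 2) {θ : ℝ} (h : θ ∈ Set.Ioo 0 Real.pi) :
    HasDerivAt (S.v3 c k) (S.tangentPart k θ / S.f θ) θ := by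
  have hcont : ContinuousOn (fun t => S.tangentPart k t / S.f t) (Set.Ioo 0 Real.pi) := fun t ht =>
    ((S.hasDerivAt_tangentPart k ht).continuousAt.div S.f_smooth.continuous.continuousAt
      (S.f_ne_zero t)).continuousWithinAt
  have hpi : Real.pi / 2 ∈ Set.Ioo 0 Real.pi := ⟨by positivity, by linarith [Real.pi_pos]⟩
  have hsub : Set.uIcc (Real.pi / 2) θ ⊆ Set.Ioo 0 Real.pi :=
    Set.OrdConnected.uIcc_subset Set.ordConnected_Ioo hpi h
  exact (intervalIntegral.integral_hasDerivAt_right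
    ((hcont.mono hsub).intervalIntegrable)
    (hcont.stronglyMeasurableAtFilter isOpen_Ioo θ h)
    (hcont.continuousAt (isOpen_Ioo.mem_nhds h))).const_add c

theorem gradient_geometric (x : Phase) :
    (fun m => partialDeriv m geometric x) = ![2 * x 0, 2 * x 1, 0, 0, 0, 0] := by
  have hp : ∀ i : Fin 6, HasFDerivAt (fun y : Phase => y i) (ContinuousLinearMap.proj (R := ℝ) i) x :=
    fun i => (ContinuousLinearMap.proj (R := ℝ) (φ := fun _ : Fin 6 => ℝ) i).hasFDerivAt
  have h : HasFDerivAt geometric (x 0 • ContinuousLinearMap.proj (R := ℝ) 0 +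
      x 0 • ContinuousLinearMap.proj (R := ℝ) 0 + (x 1 • ContinuousLinearMap.proj (R := ℝ) 1 +
      x 1 • ContinuousLinearMap.proj (R := ℝ) 1)) x := by
    have := ((hp 0).mul (hp 0)).add ((hp 1).mul (hp 1))
    convert! this using 1
    funext y
    simp [geometric, Phase.normal, dotProduct, Fin.sum_univ_three]
  funext m
  rw [partialDeriv, h.fderiv]
  fin_cases m <;> simp [two_mul]

/-- The radial derivative of J_k depends on how J_k extends off the circle and is left unspecified.
Being proportional to dC, it never matters; only the tangential combination γ₁∂₂ - γ₂∂₁ is recorded.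
-/
theorem gradient_J (c : Fin 2 → ℝ) (k : Fin 2) (x : Phase) (h1 : -1 < x 0) (h2 : x 0 < 1)
    (h3 : 0 < x 1) (h : x 0 * x 0 + x 1 * x 1 = 1) (h5 : S.grav ≠ 0 → x 5 ≠ 0) :
    ∃ j0 j1 : ℝ, (fun m => partialDeriv m (S.J c k) x) =
      ![j0, j1, 0, S.v1 k (x 0, x 1), S.v2 k (x 0, x 1),
        S.mass * S.grav * S.d / (S.nu ^ 2 - 1) * S.v3 (c k) k (Real.arccos (x 0)) / x 5 ^ 2] ∧
      x 0 * j1 - x 1 * j0 =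
        (S.nu ^ 2 - 1) * (x 0 * S.v1 k (x 0, x 1) + x 1 * S.v2 k (x 0, x 1)) *
          (x 1 * x 3 - x 0 * x 4) -
        S.mass * S.grav * S.d / (S.nu ^ 2 - 1) *
          (S.tangentPart k (Real.arccos (x 0)) / S.f (Real.arccos (x 0))) / x 5 := by
  obtain ⟨hm, hc, hs⟩ := exists_angle h1 h2 h3 h
  set K := S.mass * S.grav * S.d / (S.nu ^ 2 - 1) with hK
  set T := S.tangentPart k (Real.arccos (x 0)) / S.f (Real.arccos (x 0)) with hT
  have hp : ∀ i : Fin 6, HasFDerivAt (fun y : Phase => y i) (ContinuousLinearMap.proj (R := ℝ) i) x :=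
    fun i => (ContinuousLinearMap.proj (R := ℝ) (φ := fun _ : Fin 6 => ℝ) i).hasFDerivAt
  have hγ : HasFDerivAt (fun y : Phase => (y 0, y 1)) _ x := (hp 0).prodMk (hp 1)
  have d1 := ((S.contDiffAt_v1 k (γ := (x 0, x 1)) h1 h2 h3).differentiableAt (by simp)).hasFDerivAt
  have d2 := ((S.contDiffAt_v2 k (γ := (x 0, x 1)) h1 h2 h3).differentiableAt (by simp)).hasFDerivAt
  have e1 := HasFDerivAt.comp x d1 hγ
  have e2 := HasFDerivAt.comp x d2 hγ
  have e3 : HasFDerivAt (fun y : Phase => K * (S.v3 (c k) k (Real.arccos (y 0)) / y 5))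
      (K • ((-(T / x 1) / x 5) • ContinuousLinearMap.proj (R := ℝ) (φ := fun _ : Fin 6 => ℝ) 0 -
        (S.v3 (c k) k (Real.arccos (x 0)) / x 5 ^ 2) •
          ContinuousLinearMap.proj (R := ℝ) (φ := fun _ : Fin 6 => ℝ) 5)) x := by
    -- Without gravity the coefficient of v₃/M₃ is zero, so points with M₃ = 0 cause no trouble.
    by_cases hg : S.grav = 0
    · have : K = 0 := by rw [hK, hg]; simp
      rw [this]
      simpa using hasFDerivAt_const (0 : ℝ) x
    have h5' := h5 hg
    have da := (S.hasDerivAt_v3 (c k) k hm).comp (x 0)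
      (Real.hasDerivAt_arccos h1.ne' h2.ne)
    have hsq : Real.sqrt (1 - x 0 ^ 2) = x 1 := by
      rw [← hs, Real.sin_arccos]
    have db := (da.comp_hasFDerivAt x (hp 0)).mul ((hasDerivAt_inv h5').comp_hasFDerivAt x (hp 5))
    have dd := db.const_mul K
    convert! dd using 1
    rw [hsq, ← hT]
    ext v
    simp
    field_simp
    ring
  have hJ : HasFDerivAt (S.J c k) _ x := ((e1.mul (hp 3)).add (e2.mul (hp 4))).sub e3
  have key : ∀ v : Phase, fderiv ℝ (S.J c k) x v =
      S.v1 k (x 0, x 1) * v 3 + x 3 * fderiv ℝ (S.v1 k) (x 0, x 1) (v 0, v 1) +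
      (S.v2 k (x 0, x 1) * v 4 + x 4 * fderiv ℝ (S.v2 k) (x 0, x 1) (v 0, v 1)) -
      K * (-(T / x 1) / x 5 * v 0 - S.v3 (c k) k (Real.arccos (x 0)) / x 5 ^ 2 * v 5) := by
    intro v
    rw [hJ.fderiv]
    simp
  obtain ⟨t1, t2⟩ := S.fderiv_v_tangent k (γ := (x 0, x 1)) h1 h2 h3 h
  refine ⟨partialDeriv 0 (S.J c k) x, partialDeriv 1 (S.J c k) x, ?_, ?_⟩
  · funext m
    have h0 : ((0 : ℝ), (0 : ℝ)) = 0 := rfl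
    fin_cases m
    · rfl
    · rfl
    all_goals
      simp [partialDeriv, key, h0]
    ring
  · rw [linear_apply_pair] at t1 t2
    simp only [partialDeriv, key]
    simp only [Pi.single_apply, Fin.reduceEq, if_true, if_false]
    dsimp only at t1 t2
    have h6 : x 1 * (T / x 1) = T := mul_div_cancel₀ T h3.ne'
    linear_combination x 3 * t1 + x 4 * t2 + (-K / x 5) * h6

theorem gradient_energy (x : Phase) (h : x 0 * x 0 + x 1 * x 1 = 1) :
    ∃ h0 h1 : ℝ, (fun m => partialDeriv m S.energy x) =
      ![h0, h1, -(S.mass * S.grav),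
        (x 3 + S.d / S.inertia * (x 0 * x 3 + x 1 * x 4) * x 0) / (S.inertia + S.d),
        (x 4 + S.d / S.inertia * (x 0 * x 3 + x 1 * x 4) * x 1) / (S.inertia + S.d),
        x 5 / (S.inertia + S.d)] ∧
      x 0 * h1 - x 1 * h0 = S.d / S.inertia * (x 0 * x 3 + x 1 * x 4) * (x 0 * x 4 - x 1 * x 3) /
        (S.inertia + S.d) := by
  have hI := S.inertia_pos
  have hd := S.d_pos
  have hp : ∀ i : Fin 6, HasFDerivAt (fun y : Phase => y i) (ContinuousLinearMap.proj (R := ℝ) i) x :=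
    fun i => (ContinuousLinearMap.proj (R := ℝ) (φ := fun _ : Fin 6 => ℝ) i).hasFDerivAt
  have hE : S.energy = fun y => 1 / 2 * ((S.inertia + S.d * (y 0 * y 0 + y 1 * y 1))⁻¹ *
      (y 3 * y 3 + y 4 * y 4 + y 5 * y 5 + S.d / S.inertia * ((y 0 * y 3 + y 1 * y 4) *
        (y 0 * y 3 + y 1 * y 4)))) + -(S.mass * S.grav * y 2) := by
    funext y
    simp [energy, potential, angularVelocity, Phase.momentum, Phase.normal, dotProduct,
      Fin.sum_univ_three]
    ring
  have hA := (((hp 0).mul (hp 0)).add ((hp 1).mul (hp 1)))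
  have hA' := (hA.const_mul S.d).const_add S.inertia
  have hN : S.inertia + S.d * (x 0 * x 0 + x 1 * x 1) ≠ 0 := by rw [h]; positivity
  have hB := ((hp 0).mul (hp 3)).add ((hp 1).mul (hp 4))
  have hM := ((((hp 3).mul (hp 3)).add ((hp 4).mul (hp 4))).add ((hp 5).mul (hp 5))).add
    ((hB.mul hB).const_mul (S.d / S.inertia))
  have hH := ((((hasDerivAt_inv hN).comp_hasFDerivAt x hA').mul hM).const_mul (1 / 2)).add
    ((hp 2).const_mul (S.mass * S.grav)).neg
  have hH' := hH.congr_of_eventuallyEq (f₁ := S.energy) (Filter.Eventually.of_forall (congrFun hE))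
  have e : S.inertia + S.d * (x 0 * x 0 + x 1 * x 1) = S.inertia + S.d := by rw [h, mul_one]
  have hs : S.inertia + S.d ≠ 0 := by positivity
  refine ⟨partialDeriv 0 S.energy x, partialDeriv 1 S.energy x, ?_, ?_⟩
  · funext m
    fin_cases m
    · rfl
    · rfl
    all_goals
      simp only [partialDeriv, hH'.fderiv]
      simp [e]
      try field_simp
      try ring
  · simp only [partialDeriv, hH'.fderiv]
    simp [e]
    field_simp
    ring

end StublerModel

/-! ### Bivectors of the gravity-free shape: Jacobi identity, kernel and rank. -/

/-- The skew matrix with seven independent entries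
`(z, M₁), (z, M₂), (z, M₃), (γ₁, M₃), (γ₂, M₃), (M₁, M₃), (M₂, M₃)`. -/
noncomputable def skewOfEntries (e : Fin 7 → ℝ) : Matrix (Fin 6) (Fin 6) ℝ :=
  !![0, 0, 0, 0, 0, e 3;
     0, 0, 0, 0, 0, e 4;
     0, 0, 0, e 0, e 1, e 2;
     0, 0, -e 0, 0, 0, e 5;
     0, 0, -e 1, 0, 0, e 6;
     -e 3, -e 4, -e 2, -e 5, -e 6, 0]

theorem skewOfEntries_skew (e : Fin 7 → ℝ) (i j : Fin 6) :
    skewOfEntries e i j = -skewOfEntries e j i := by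
  fin_cases i <;> fin_cases j <;> simp [skewOfEntries]

theorem partialDeriv_skewOfEntries (E : Fin 7 → Phase → ℝ) (x : Phase) (m i j : Fin 6) :
    partialDeriv m (fun y => skewOfEntries (fun a => E a y) i j) x =
      skewOfEntries (fun a => partialDeriv m (E a) x) i j := by
  fin_cases i <;> fin_cases j <;> simp [skewOfEntries, partialDeriv]

/-- For a skew field the bracket is totally antisymmetric, which leaves the twenty strictly
increasing triples. -/
theorem schouten_skewOfEntries_eq_zero (E : Fin 7 → Phase → ℝ) (x : Phase)
    (h : ∀ i j k : Fin 6, i < j → j < k →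
      schouten (fun y => skewOfEntries (fun a => E a y))
        (fun y => skewOfEntries (fun a => E a y)) x i j k = 0) (i j k : Fin 6) :
    schouten (fun y => skewOfEntries (fun a => E a y))
        (fun y => skewOfEntries (fun a => E a y)) x i j k = 0 := by
  set P : Bivector := fun y => skewOfEntries (fun a => E a y) with hP
  have hterm : ∀ i j k, schoutenTerm P P x j i k = -schoutenTerm P P x i j k := by
    intro i j k
    simp only [schoutenTerm, ← Finset.sum_neg_distrib]
    refine Finset.sum_congr rfl fun m _ => ?_
    rw [hP, partialDeriv_skewOfEntries, partialDeriv_skewOfEntries,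
      skewOfEntries_skew (fun a => partialDeriv m (E a) x) j i]
    ring
  have hself : ∀ i k, schoutenTerm P P x i i k = 0 := fun i k => by linarith [hterm i i k]
  have hcyc : ∀ i j k, schouten P P x i j k = schouten P P x j k i := by
    intro i j k
    simp only [schouten]
    ring
  have hswap : ∀ i j k, schouten P P x j i k = -schouten P P x i j k := by
    intro i j k
    simp only [schouten, hterm i j k, hterm j k i, hterm k i j]
    ring
  have hrep : ∀ i k, schouten P P x i i k = 0 := fun i k => by linarith [hswap i i k]
  have hpair : ∀ i j k, i < j → schouten P P x i j k = 0 := by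
    intro i j k hij
    rcases lt_trichotomy j k with hjk | rfl | hjk
    · exact h i j k hij hjk
    · rw [hcyc, hrep]
    rcases lt_trichotomy i k with hik | rfl | hik
    · rw [hcyc i j k, hcyc j k i, hswap i k j, h i k j hik hjk, neg_zero]
    · rw [hcyc, hcyc, hrep]
    · rw [← hcyc k i j]
      exact h k i j hik hij
  rcases lt_trichotomy i j with hij | rfl | hij
  · exact hpair i j k hij
  · exact hrep i k
  · rw [hswap, hpair j i k hij, neg_zero]

/-- The entries of the bivectors `{z, Mᵢ} = Aᵢ`, `{γ, M₃} = β (-γ₂, γ₁)`,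
`{Mᵢ, M₃} = β l γᵢ (γ₁ M₂ - γ₂ M₁)`. -/
noncomputable def fiberEntries (l : ℝ) (A : Fin 3 → Config → ℝ) (β : ℝ × ℝ → ℝ) (a : Fin 7) (y : Phase) : ℝ :=
  ![A 0 y.config, A 1 y.config, A 2 y.config, -(β (y 0, y 1) * y 1), β (y 0, y 1) * y 0,
    β (y 0, y 1) * (y 0 * ((y 0 * y 4 - y 1 * y 3) * l)),
    β (y 0, y 1) * (y 1 * ((y 0 * y 4 - y 1 * y 3) * l))] a

/-- The bivector with entries `fiberEntries`. -/
noncomputable def fiberBivector (l : ℝ) (A : Fin 3 → Config → ℝ) (β : ℝ × ℝ → ℝ) : Bivector := fun y =>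
  skewOfEntries (fun a => fiberEntries l A β a y)

/-- The matrix of first derivatives of the entries `fiberEntries`. -/
noncomputable def fiberDerivs (l : ℝ) (A : Fin 3 → Config → ℝ) (β : ℝ × ℝ → ℝ) (x : Phase) :
    Fin 7 → Fin 6 → ℝ :=
  let da (i : Fin 3) : Fin 6 → ℝ := ![fderiv ℝ (A i) x.config ((1, 0), 0),
    fderiv ℝ (A i) x.config ((0, 1), 0), fderiv ℝ (A i) x.config ((0, 0), 1), 0, 0, 0]
  let b := β (x 0, x 1)
  let b0 := fderiv ℝ β (x 0, x 1) (1, 0)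
  let b1 := fderiv ℝ β (x 0, x 1) (0, 1)
  let t := (x 0 * x 4 - x 1 * x 3) * l
  ![da 0, da 1, da 2,
    ![-(b0 * x 1), -(b1 * x 1 + b), 0, 0, 0, 0],
    ![b0 * x 0 + b, b1 * x 0, 0, 0, 0, 0],
    ![b0 * (x 0 * t) + b * (t + x 0 * (x 4 * l)), b1 * (x 0 * t) - b * (x 0 * (x 3 * l)), 0,
      -(b * (x 0 * (x 1 * l))), b * (x 0 * (x 0 * l)), 0],
    ![b0 * (x 1 * t) + b * (x 1 * (x 4 * l)), b1 * (x 1 * t) + b * (t - x 1 * (x 3 * l)), 0,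
      -(b * (x 1 * (x 1 * l))), b * (x 1 * (x 0 * l)), 0]]

theorem partialDeriv_fiberEntries (l : ℝ) (A : Fin 3 → Config → ℝ) (β : ℝ × ℝ → ℝ) (x : Phase)
    (hA : ∀ i, DifferentiableAt ℝ (A i) x.config) (hβ : DifferentiableAt ℝ β (x 0, x 1))
    (a : Fin 7) (m : Fin 6) :
    partialDeriv m (fiberEntries l A β a) x = fiberDerivs l A β x a m := by
  have hp : ∀ i : Fin 6, HasFDerivAt (fun y : Phase => y i) (ContinuousLinearMap.proj (R := ℝ) i) x :=
    fun i => (ContinuousLinearMap.proj (R := ℝ) (φ := fun _ : Fin 6 => ℝ) i).hasFDerivAt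
  have hγ : HasFDerivAt (fun y : Phase => (y 0, y 1)) _ x := (hp 0).prodMk (hp 1)
  have hq : HasFDerivAt Phase.config _ x := hγ.prodMk (hp 2)
  have eA : ∀ i, HasFDerivAt (fun y : Phase => A i y.config) _ x := fun i =>
    HasFDerivAt.comp x (hA i).hasFDerivAt hq
  have eβ : HasFDerivAt (fun y : Phase => β (y 0, y 1)) _ x :=
    HasFDerivAt.comp x hβ.hasFDerivAt hγ
  have et := (((hp 0).mul (hp 4)).sub ((hp 1).mul (hp 3))).mul_const l
  have z2 : ((0 : ℝ), (0 : ℝ)) = 0 := rfl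
  have z3 : ((0 : ℝ × ℝ), (0 : ℝ)) = 0 := rfl
  fin_cases a
  · change fderiv ℝ (fun y : Phase => A 0 y.config) x _ = _
    rw [(eA 0).fderiv]
    fin_cases m <;> simp [fiberDerivs, z2, z3]
  · change fderiv ℝ (fun y : Phase => A 1 y.config) x _ = _
    rw [(eA 1).fderiv]
    fin_cases m <;> simp [fiberDerivs, z2, z3]
  · change fderiv ℝ (fun y : Phase => A 2 y.config) x _ = _
    rw [(eA 2).fderiv]
    fin_cases m <;> simp [fiberDerivs, z2, z3]
  · have h := (eβ.mul (hp 1)).neg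
    change fderiv ℝ (-((fun y : Phase => β (y 0, y 1)) * fun y : Phase => y 1)) x _ = _
    rw [h.fderiv]
    fin_cases m <;> simp [-mul_eq_mul_left_iff, fiberDerivs, z2] <;> ring
  · have h := eβ.mul (hp 0)
    change fderiv ℝ ((fun y : Phase => β (y 0, y 1)) * fun y : Phase => y 0) x _ = _
    rw [h.fderiv]
    fin_cases m <;> simp [-mul_eq_mul_left_iff, fiberDerivs, z2] <;> ring
  · have h := eβ.mul ((hp 0).mul et)
    change fderiv ℝ (fun y : Phase => β (y 0, y 1) * (y 0 * ((y 0 * y 4 - y 1 * y 3) * l))) x _ = _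
    rw [HasFDerivAt.fderiv (f := fun y : Phase =>
      β (y 0, y 1) * (y 0 * ((y 0 * y 4 - y 1 * y 3) * l))) h]
    fin_cases m <;> simp [-mul_eq_mul_left_iff, fiberDerivs, z2] <;> ring
  · have h := eβ.mul ((hp 1).mul et)
    change fderiv ℝ (fun y : Phase => β (y 0, y 1) * (y 1 * ((y 0 * y 4 - y 1 * y 3) * l))) x _ = _
    rw [HasFDerivAt.fderiv (f := fun y : Phase =>
      β (y 0, y 1) * (y 1 * ((y 0 * y 4 - y 1 * y 3) * l))) h]
    fin_cases m <;> simp [-mul_eq_mul_left_iff, fiberDerivs, z2] <;> ring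

/-- The Jacobi identity for `fiberBivector`. -/
theorem schouten_fiberBivector (l : ℝ) (A : Fin 3 → Config → ℝ) (β : ℝ × ℝ → ℝ) (x : Phase)
    (hA : ∀ i, DifferentiableAt ℝ (A i) x.config) (hβ : DifferentiableAt ℝ β (x 0, x 1))
    (c1 : β (x 0, x 1) * (x 0 * l * (x 0 * A 1 x.config - x 1 * A 0 x.config) -
        (x 0 * fderiv ℝ (A 0) x.config ((0, 1), 0) - x 1 * fderiv ℝ (A 0) x.config ((1, 0), 0))) +
      (A 0 x.config * fderiv ℝ (A 2) x.config ((0, 0), 1) -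
        A 2 x.config * fderiv ℝ (A 0) x.config ((0, 0), 1)) = 0)
    (c2 : β (x 0, x 1) * (x 1 * l * (x 0 * A 1 x.config - x 1 * A 0 x.config) -
        (x 0 * fderiv ℝ (A 1) x.config ((0, 1), 0) - x 1 * fderiv ℝ (A 1) x.config ((1, 0), 0))) +
      (A 1 x.config * fderiv ℝ (A 2) x.config ((0, 0), 1) -
        A 2 x.config * fderiv ℝ (A 1) x.config ((0, 0), 1)) = 0)
    (c3 : A 0 x.config * fderiv ℝ (A 1) x.config ((0, 0), 1) =
      A 1 x.config * fderiv ℝ (A 0) x.config ((0, 0), 1)) (i j k : Fin 6) :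
    schouten (fiberBivector l A β) (fiberBivector l A β) x i j k = 0 := by
  refine schouten_skewOfEntries_eq_zero (fiberEntries l A β) x (fun i j k hij hjk => ?_) i j k
  simp only [schouten, schoutenTerm, partialDeriv_skewOfEntries, Fin.sum_univ_six,
    partialDeriv_fiberEntries l A β x hA hβ]
  fin_cases i <;> fin_cases j <;> first | (exfalso; revert hij; decide) | skip
  all_goals fin_cases k <;> first | (exfalso; revert hjk; decide) | skip
  all_goals
    simp [skewOfEntries, fiberDerivs, fiberEntries]
    try first
      | ring1
      | linear_combination 2 * c1
      | linear_combination 2 * c2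
      | linear_combination 2 * c3
      | linear_combination -2 * c1
      | linear_combination -2 * c2
      | linear_combination -2 * c3

theorem bivectorBracket_eq (P : Bivector) (F₁ F₂ : Phase → ℝ) (x : Phase) :
    bivectorBracket P F₁ F₂ x =
      (fun i => partialDeriv i F₁ x) ⬝ᵥ (P x *ᵥ fun j => partialDeriv j F₂ x) := by
  simp only [bivectorBracket, dotProduct, Matrix.mulVec, Finset.mul_sum]
  exact Finset.sum_congr rfl fun i _ => Finset.sum_congr rfl fun j _ => by ring

theorem bivectorBracket_swap (P : Bivector) (F₁ F₂ : Phase → ℝ) (x : Phase)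
    (h : ∀ i j, P x i j = -P x j i) :
    bivectorBracket P F₁ F₂ x = -bivectorBracket P F₂ F₁ x := by
  simp only [bivectorBracket, ← Finset.sum_neg_distrib]
  rw [Finset.sum_comm]
  refine Finset.sum_congr rfl fun i _ => Finset.sum_congr rfl fun j _ => ?_
  rw [h j i]
  ring

theorem contDiffOn_skewOfEntries {U : Fin 7 → Config → ℝ} {s : Set Config}
    (hU : ∀ a, ContDiffOn ℝ ∞ (U a) s) (i j : Fin 6) :
    ContDiffOn ℝ ∞ (fun q => skewOfEntries (fun a => U a q) i j) s := by
  have h0 : ContDiffOn ℝ ∞ (fun _ : Config => (0 : ℝ)) s := contDiffOn_const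
  fin_cases i <;> fin_cases j <;> first
    | exact h0
    | exact hU _
    | exact (hU _).neg

theorem affineInMomenta_fiberBivector (l : ℝ) {G : Set (ℝ × ℝ)} {I : Set ℝ}
    {A : Fin 3 → Config → ℝ} {β : ℝ × ℝ → ℝ} (hA : ∀ i, ContDiffOn ℝ ∞ (A i) (G ×ˢ I))
    (hβ : ContDiffOn ℝ ∞ β G) : AffineInMomenta G I (fiberBivector l A β) := by
  have hβ' : ContDiffOn ℝ ∞ (fun q : Config => β q.1) (G ×ˢ I) :=
    hβ.comp contDiffOn_fst fun q hq => hq.1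
  have h0 : ContDiffOn ℝ ∞ (fun _ : Config => (0 : ℝ)) (G ×ˢ I) := contDiffOn_const
  have hx : ContDiffOn ℝ ∞ (fun q : Config => q.1.1) (G ×ˢ I) := by fun_prop
  have hy : ContDiffOn ℝ ∞ (fun q : Config => q.1.2) (G ×ˢ I) := by fun_prop
  let U : Fin 3 → Fin 7 → Config → ℝ := fun k a q =>
    ![![0, 0, 0], ![0, 0, 0], ![0, 0, 0], ![0, 0, 0], ![0, 0, 0],
      ![-(β q.1 * (q.1.1 * q.1.2) * l), β q.1 * (q.1.1 * q.1.1) * l, 0],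
      ![-(β q.1 * (q.1.2 * q.1.2) * l), β q.1 * (q.1.2 * q.1.1) * l, 0]] a k
  let W : Fin 7 → Config → ℝ := fun a q =>
    ![A 0 q, A 1 q, A 2 q, -(β q.1 * q.1.2), β q.1 * q.1.1, 0, 0] a
  refine ⟨fun i j k q => skewOfEntries (fun a => U k a q) i j,
    fun i j q => skewOfEntries (fun a => W a q) i j, fun i j k => ?_, fun i j => ?_,
    fun x _ i j => ?_⟩
  · refine contDiffOn_skewOfEntries (fun a => ?_) i j
    fin_cases a <;> fin_cases k <;> first
      | exact h0
      | exact ((hβ'.mul (hx.mul hy)).mul contDiffOn_const).neg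
      | exact ((hβ'.mul (hy.mul hy)).mul contDiffOn_const).neg
      | exact (hβ'.mul (hx.mul hx)).mul contDiffOn_const
      | exact (hβ'.mul (hy.mul hx)).mul contDiffOn_const
  · refine contDiffOn_skewOfEntries (fun a => ?_) i j
    fin_cases a <;> first
      | exact h0
      | exact hA _
      | exact (hβ'.mul hy).neg
      | exact hβ'.mul hx
  · fin_cases i <;> fin_cases j <;>
      simp [fiberBivector, skewOfEntries, fiberEntries, U, W, Fin.sum_univ_three, Phase.config,
        Phase.momentum] <;> ring

theorem fiberBivector_skew (l : ℝ) (A : Fin 3 → Config → ℝ) (β : ℝ × ℝ → ℝ) (x : Phase)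
    (i j : Fin 6) : fiberBivector l A β x i j = -fiberBivector l A β x j i :=
  skewOfEntries_skew _ i j

theorem fiberBivector_mulVec_geometric (l : ℝ) (A : Fin 3 → Config → ℝ) (β : ℝ × ℝ → ℝ)
    (x : Phase) : fiberBivector l A β x *ᵥ ![2 * x 0, 2 * x 1, 0, 0, 0, 0] = 0 := by
  funext i
  fin_cases i <;>
    simp [fiberBivector, skewOfEntries, fiberEntries, Matrix.mulVec, dotProduct, Fin.sum_univ_six]
  ring

/-- The hypothesis is the tangential derivative of J_k without gravity; it is what makes the M₃
component cancel, leaving a multiple of ∂_z. -/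
theorem fiberBivector_mulVec_linear (l : ℝ) (A : Fin 3 → Config → ℝ) (β : ℝ × ℝ → ℝ)
    (x : Phase) (j0 j1 a b : ℝ)
    (h : x 0 * j1 - x 1 * j0 = l * (x 0 * a + x 1 * b) * (x 1 * x 3 - x 0 * x 4)) :
    fiberBivector l A β x *ᵥ ![j0, j1, 0, a, b, 0] =
      ![0, 0, A 0 x.config * a + A 1 x.config * b, 0, 0, 0] := by
  funext i
  fin_cases i <;>
    simp [fiberBivector, skewOfEntries, fiberEntries, Matrix.mulVec, dotProduct, Fin.sum_univ_six]
  linear_combination (-β (x 0, x 1)) * h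

/-- A factorization through ℝ⁴ bounds the rank above, and compression to a four-dimensional subspace
bounds it below. -/
theorem rank_fiberBivector (l : ℝ) (A : Fin 3 → Config → ℝ) (β : ℝ × ℝ → ℝ) (x : Phase)
    (hx : x 0 * x 0 + x 1 * x 1 = 1) (hβ : β (x 0, x 1) ≠ 0)
    (hA : A 0 x.config ≠ 0 ∨ A 1 x.config ≠ 0) : (fiberBivector l A β x).rank = 4 := by
  set b := β (x 0, x 1) with hb
  set a0 := A 0 x.config with ha0
  set a1 := A 1 x.config with ha1
  set a2 := A 2 x.config with ha2
  set t := (x 0 * x 4 - x 1 * x 3) * l with ht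
  have hP : fiberBivector l A β x =
      skewOfEntries ![a0, a1, a2, -(b * x 1), b * x 0, b * (x 0 * t), b * (x 1 * t)] := rfl
  apply le_antisymm
  · have e : fiberBivector l A β x =
        (!![0, 0, -(b * x 1), 0; 0, 0, b * x 0, 0; 1, 0, 0, 0; 0, a0, b * (x 0 * t), 0;
          0, a1, b * (x 1 * t), 0; 0, a2, 0, 1] : Matrix (Fin 6) (Fin 4) ℝ) *
        (!![0, 0, 0, a0, a1, a2; 0, 0, -1, 0, 0, 0; 0, 0, 0, 0, 0, 1;
          b * x 1, -(b * x 0), 0, -(b * (x 0 * t)), -(b * (x 1 * t)), 0] :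
          Matrix (Fin 4) (Fin 6) ℝ) := by
      rw [hP]
      ext i j
      fin_cases i <;> fin_cases j <;>
        simp [skewOfEntries, Matrix.mul_apply, Fin.sum_univ_four]
    rw [e]
    exact (Matrix.rank_mul_le_left _ _).trans (Matrix.rank_le_width _)
  -- The rows are z, the direction (A₁, A₂) in the plane of M₁, M₂, the tangent to the circle, and
  -- M₃. The compressed matrix has Pfaffian ± (A₁² + A₂²) β.
  · let U : Matrix (Fin 4) (Fin 6) ℝ :=
      !![0, 0, 1, 0, 0, 0; 0, 0, 0, a0, a1, 0; -x 1, x 0, 0, 0, 0, 0; 0, 0, 0, 0, 0, 1]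
    set n := a0 * a0 + a1 * a1 with hn
    have hn0 : n ≠ 0 := by
      intro h
      rcases hA with h' | h' <;> apply h' <;> nlinarith [mul_self_nonneg a0, mul_self_nonneg a1]
    set s := a0 * (b * (x 0 * t)) + a1 * (b * (x 1 * t)) with hs
    have e : U * fiberBivector l A β x * Uᵀ =
        !![0, n, 0, a2; -n, 0, 0, s; 0, 0, 0, b; -a2, -s, -b, 0] := by
      rw [hP]
      ext i j
      fin_cases i <;> fin_cases j <;>
        simp [skewOfEntries, Matrix.mul_apply, Fin.sum_univ_six, U, hn, hs]
      all_goals first | ring1 | linear_combination b * hx | linear_combination (-b) * hx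
    have hdet : (U * fiberBivector l A β x * Uᵀ).det = (n * b) ^ 2 := by
      rw [e]
      simp [Matrix.det_succ_row_zero, Fin.sum_univ_succ, Fin.succAbove]
      ring
    have hu : IsUnit (U * fiberBivector l A β x * Uᵀ) := by
      rw [Matrix.isUnit_iff_isUnit_det, hdet]
      exact (pow_ne_zero 2 (mul_ne_zero hn0 hβ)).isUnit
    have h4 := Matrix.rank_of_isUnit _ hu
    rw [Fintype.card_fin] at h4
    rw [← h4]
    exact (Matrix.rank_mul_le_left _ _).trans (Matrix.rank_mul_le_right _ _)

/-! ### Solutions in the absence of gravity. -/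

namespace StublerModel

variable (S : StublerModel)

theorem mem_phaseSpace_iff {G : Set (ℝ × ℝ)} {I : Set ℝ} {x : Phase} :
    x ∈ S.phaseSpace G I ↔ ((x 0, x 1) ∈ G ∧ x 2 ∈ I) ∧ x 0 * x 0 + x 1 * x 1 = 1 ∧
      (S.grav ≠ 0 → x 5 ≠ 0) := by
  simp [phaseSpace, Phase.config, geometric, Phase.normal, dotProduct, Fin.sum_univ_three]

/-- In the absence of gravity `fiberBivector` is a solution. -/
theorem isSolution_fiberBivector (hg : S.grav = 0) (c : Fin 2 → ℝ) {G : Set (ℝ × ℝ)} {I : Set ℝ}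
    (hG : IsOpen G) (hI : IsOpen I) (hGdom : ∀ γ ∈ G, -1 < γ.1 ∧ γ.1 < 1 ∧ 0 < γ.2)
    {A : Fin 3 → Config → ℝ} {β : ℝ × ℝ → ℝ} (hA : ∀ i, ContDiffOn ℝ ∞ (A i) (G ×ˢ I))
    (hβ : ContDiffOn ℝ ∞ β G)
    (c1 : ∀ q ∈ G ×ˢ I, q.1.1 * q.1.1 + q.1.2 * q.1.2 = 1 →
      β q.1 * (q.1.1 * (S.nu ^ 2 - 1) * (q.1.1 * A 1 q - q.1.2 * A 0 q) -
        (q.1.1 * fderiv ℝ (A 0) q ((0, 1), 0) - q.1.2 * fderiv ℝ (A 0) q ((1, 0), 0))) +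
      (A 0 q * fderiv ℝ (A 2) q ((0, 0), 1) - A 2 q * fderiv ℝ (A 0) q ((0, 0), 1)) = 0)
    (c2 : ∀ q ∈ G ×ˢ I, q.1.1 * q.1.1 + q.1.2 * q.1.2 = 1 →
      β q.1 * (q.1.2 * (S.nu ^ 2 - 1) * (q.1.1 * A 1 q - q.1.2 * A 0 q) -
        (q.1.1 * fderiv ℝ (A 1) q ((0, 1), 0) - q.1.2 * fderiv ℝ (A 1) q ((1, 0), 0))) +
      (A 1 q * fderiv ℝ (A 2) q ((0, 0), 1) - A 2 q * fderiv ℝ (A 1) q ((0, 0), 1)) = 0)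
    (c3 : ∀ q ∈ G ×ˢ I, A 0 q * fderiv ℝ (A 1) q ((0, 0), 1) =
      A 1 q * fderiv ℝ (A 0) q ((0, 0), 1)) :
    S.IsSolution c G I (fiberBivector (S.nu ^ 2 - 1) A β) := by
  refine ⟨fun x _ => fiberBivector_skew _ A β x, affineInMomenta_fiberBivector _ hA hβ,
    fun x hx i j k => ?_, fun x hx a b => ?_⟩
  · obtain ⟨⟨hxG, hxI⟩, hx1, -⟩ := S.mem_phaseSpace_iff.1 hx
    have hq : x.config ∈ G ×ˢ I := ⟨hxG, hxI⟩
    exact schouten_fiberBivector _ A β x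
      (fun i => ((hA i).contDiffAt ((hG.prod hI).mem_nhds hq)).differentiableAt (by simp))
      ((hβ.contDiffAt (hG.mem_nhds hxG)).differentiableAt (by simp))
      (c1 x.config hq hx1) (c2 x.config hq hx1) (c3 x.config hq) i j k
  · obtain ⟨⟨hxG, hxI⟩, hx1, h5⟩ := S.mem_phaseSpace_iff.1 hx
    obtain ⟨hd1, hd2, hd3⟩ := hGdom _ hxG
    -- Since P dJ_k points along ∂_z and no integral depends on z, every bracket with J_k vanishes.
    have hzero : ∀ a : Fin 4, partialDeriv 2 (S.integrals c a) x = 0 := by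
      obtain ⟨h0, h1, hH, -⟩ := S.gradient_energy x hx1
      have hJ : ∀ k, partialDeriv 2 (S.J c k) x = 0 := fun k => by
        obtain ⟨j0, j1, hJ, -⟩ := S.gradient_J c k x hd1 hd2 hd3 hx1 h5
        simpa using congrFun hJ 2
      intro a
      fin_cases a
      · exact (congrFun hH 2).trans (by simp [hg])
      · exact (congrFun (gradient_geometric x) 2).trans (by simp)
      · exact hJ 0
      · exact hJ 1
    have hCas : ∀ F, bivectorBracket (fiberBivector (S.nu ^ 2 - 1) A β) F geometric x = 0 := by
      intro F
      rw [bivectorBracket_eq, gradient_geometric, fiberBivector_mulVec_geometric,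
        dotProduct_zero]
    have hJ : ∀ a k, bivectorBracket (fiberBivector (S.nu ^ 2 - 1) A β) (S.integrals c a)
        (S.J c k) x = 0 := by
      intro a k
      obtain ⟨j0, j1, hJ, hJt⟩ := S.gradient_J c k x hd1 hd2 hd3 hx1 h5
      simp only [hg, mul_zero, zero_mul, zero_div, sub_zero] at hJ hJt
      rw [bivectorBracket_eq, hJ, fiberBivector_mulVec_linear _ A β x _ _ _ _ hJt]
      simp [dotProduct, Fin.sum_univ_six, hzero]
    have hswap := fun F₁ F₂ => bivectorBracket_swap (fiberBivector (S.nu ^ 2 - 1) A β) F₁ F₂ x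
      (fiberBivector_skew _ A β x)
    have hb : ∀ b : Fin 4, b ≠ 0 → ∀ a, bivectorBracket (fiberBivector (S.nu ^ 2 - 1) A β)
        (S.integrals c a) (S.integrals c b) x = 0 := by
      intro b hb a
      fin_cases b
      · exact absurd rfl hb
      · exact hCas _
      · exact hJ a 0
      · exact hJ a 1
    by_cases h : b = 0
    · by_cases h' : a = 0
      · rw [h, h']
        linarith [hswap (S.integrals c 0) (S.integrals c 0)]
      · rw [hswap, hb a h' b, neg_zero]
    · exact hb b h a

theorem hamiltonianField_J_fiberBivector (hg : S.grav = 0) (c : Fin 2 → ℝ) (k : Fin 2)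
    (A : Fin 3 → Config → ℝ) (β : ℝ × ℝ → ℝ) (x : Phase) (h1 : -1 < x 0) (h2 : x 0 < 1)
    (h3 : 0 < x 1) (hx : x 0 * x 0 + x 1 * x 1 = 1)
    (hA : A 0 x.config * S.v1 k (x 0, x 1) + A 1 x.config * S.v2 k (x 0, x 1) = 0) :
    hamiltonianField (fiberBivector (S.nu ^ 2 - 1) A β) (S.J c k) x = 0 := by
  obtain ⟨j0, j1, hJ, hJt⟩ := S.gradient_J c k x h1 h2 h3 hx fun h => absurd hg h
  simp only [hg, mul_zero, zero_mul, zero_div, sub_zero] at hJ hJt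
  rw [hamiltonianField, hJ, fiberBivector_mulVec_linear _ A β x _ _ _ _ hJt, hA]
  funext i
  fin_cases i <;> rfl

theorem v_zero_ne {x y : ℝ} (h1 : -1 < x) (h2 : x < 1) (h3 : 0 < y) (h : x * x + y * y = 1) :
    S.v2 0 (x, y) ≠ 0 ∨ -S.v1 0 (x, y) ≠ 0 := by
  obtain ⟨hm, hc, hs⟩ := exists_angle h1 h2 h3 h
  obtain ⟨W, hW, hW'⟩ := S.exists_wronskian
  by_contra! hcon
  have e := hW' _ hm
  simp only [normalPart, tangentPart, hc, hs] at e
  rw [hcon.1, neg_eq_zero.1 hcon.2] at e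
  exact hW (by rw [← e]; ring)

/-- `ρ₁ ≠ ρ₂` on the unit circle. -/
theorem rho_ne {x y : ℝ} (h1 : -1 < x) (h2 : x < 1) (h3 : 0 < y) (h : x * x + y * y = 1)
    (h0 : S.v2 0 (x, y) ≠ 0) (h0' : S.v2 1 (x, y) ≠ 0) : S.rho 0 (x, y) ≠ S.rho 1 (x, y) := by
  obtain ⟨hm, hc, hs⟩ := exists_angle h1 h2 h3 h
  obtain ⟨W, hW, hW'⟩ := S.exists_wronskian
  intro hcon
  have e := hW' _ hm
  simp only [normalPart, tangentPart, hc, hs] at e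
  rw [rho, rho, neg_inj, div_eq_div_iff h0 h0'] at hcon
  apply hW
  rw [← e]
  linear_combination (x * x + y * y) * hcon

theorem fderiv_config_comp {g : ℝ × ℝ → ℝ} {q : Config} (hg : DifferentiableAt ℝ g q.1)
    (v : Config) : fderiv ℝ (fun p : Config => g p.1) q v = fderiv ℝ g q.1 v.1 := by
  have := HasFDerivAt.comp q hg.hasFDerivAt (hasFDerivAt_fst (𝕜 := ℝ) (p := q))
  rw [show (fun p : Config => g p.1) = g ∘ Prod.fst from rfl, this.fderiv]
  rfl

theorem exists_isSolution_rank_four (hg : S.grav = 0) (c : Fin 2 → ℝ) {G : Set (ℝ × ℝ)}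
    {I : Set ℝ} (hG : IsOpen G) (hI : IsOpen I)
    (hGdom : ∀ γ ∈ G, -1 < γ.1 ∧ γ.1 < 1 ∧ 0 < γ.2)
    (hGne : ∃ γ ∈ G, γ.1 ^ 2 + γ.2 ^ 2 = 1) (hIne : I.Nonempty) :
    ∃ P : Bivector, S.IsSolution c G I P ∧ ∃ x ∈ S.phaseSpace G I, (P x).rank = 4 := by
  have sm1 : ∀ γ ∈ G, ContDiffAt ℝ ∞ (S.v1 0) γ := fun γ h =>
    S.contDiffAt_v1 0 (hGdom γ h).1 (hGdom γ h).2.1 (hGdom γ h).2.2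
  have sm2 : ∀ γ ∈ G, ContDiffAt ℝ ∞ (S.v2 0) γ := fun γ h =>
    S.contDiffAt_v2 0 (hGdom γ h).1 (hGdom γ h).2.1 (hGdom γ h).2.2
  have df1 : ∀ q ∈ G ×ˢ I, ∀ v, fderiv ℝ (fun p : Config => S.v1 0 p.1) q v =
      fderiv ℝ (S.v1 0) q.1 v.1 := fun q hq v =>
    fderiv_config_comp ((sm1 _ hq.1).differentiableAt (by simp)) v
  have df2 : ∀ q ∈ G ×ˢ I, ∀ v, fderiv ℝ (fun p : Config => S.v2 0 p.1) q v =
      fderiv ℝ (S.v2 0) q.1 v.1 := fun q hq v =>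
    fderiv_config_comp ((sm2 _ hq.1).differentiableAt (by simp)) v
  -- The vector (v₂, -v₁) is orthogonal to (v₁, v₂), as (1, ρ) is, but it is defined where v₂
  -- vanishes. The Jacobi conditions become the equations of v₂ and v₁ along the circle.
  refine ⟨fiberBivector (S.nu ^ 2 - 1)
    ![fun q => S.v2 0 q.1, fun q => -S.v1 0 q.1, fun _ => 0] (fun _ => 1),
    S.isSolution_fiberBivector hg c hG hI hGdom (fun i => ?_) contDiffOn_const
    (fun q hq h => ?_) (fun q hq h => ?_) (fun q hq => ?_), ?_⟩
  · fin_cases i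
    · exact fun q hq => ((sm2 _ hq.1).comp q contDiffAt_fst).contDiffWithinAt
    · exact fun q hq => ((sm1 _ hq.1).comp q contDiffAt_fst).neg.contDiffWithinAt
    · exact contDiffOn_const
  · obtain ⟨h1, h2, h3⟩ := hGdom _ hq.1
    have t2 := (S.fderiv_v_tangent 0 h1 h2 h3 h).2
    rw [linear_apply_pair] at t2
    simp [df2 q hq]
    linear_combination -t2
  · obtain ⟨h1, h2, h3⟩ := hGdom _ hq.1
    have t1 := (S.fderiv_v_tangent 0 h1 h2 h3 h).1
    rw [linear_apply_pair] at t1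
    simp [df1 q hq]
    linear_combination t1
  · have h0 : ((0 : ℝ), (0 : ℝ)) = 0 := rfl
    simp [df1 q hq, df2 q hq, h0]
  · obtain ⟨γ, hγ, h⟩ := hGne
    obtain ⟨z, hz⟩ := hIne
    obtain ⟨h1, h2, h3⟩ := hGdom _ hγ
    have h' : γ.1 * γ.1 + γ.2 * γ.2 = 1 := by linarith
    refine ⟨![γ.1, γ.2, z, 0, 0, 0], S.mem_phaseSpace_iff.2 ⟨⟨hγ, hz⟩, h', fun h => absurd hg h⟩, ?_⟩
    exact rank_fiberBivector _ _ _ _ h' one_ne_zero (S.v_zero_ne h1 h2 h3 h')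

end StublerModel

/-! ### The two families P⁽ᵏ⁾. -/

namespace StublerModel

variable (S : StublerModel)

theorem familyP_eq (k : Fin 2) (α : Config → ℝ) (β : ℝ × ℝ → ℝ) (σ : Config → ℝ) :
    S.familyP k α β σ = fiberBivector (S.nu ^ 2 - 1)
      ![α, fun q => α q * S.rho k q.1, fun q => α q * σ q] β := by
  funext x
  ext i j
  fin_cases i <;> fin_cases j <;>
    simp [familyP, fiberBivector, skewOfEntries, fiberEntries, Phase.config]

theorem contDiffAt_rho (k : Fin 2) {γ : ℝ × ℝ} (h1 : -1 < γ.1) (h2 : γ.1 < 1) (h3 : 0 < γ.2)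
    (h : S.v2 k γ ≠ 0) : ContDiffAt ℝ ∞ (S.rho k) γ :=
  ((S.contDiffAt_v1 k h1 h2 h3).div (S.contDiffAt_v2 k h1 h2 h3) h).neg

/-- A quotient of two components of a solution of a linear system satisfies a Riccati equation; here
its right-hand side is a perfect square. -/
theorem fderiv_rho_tangent (k : Fin 2) {γ : ℝ × ℝ} (h1 : -1 < γ.1) (h2 : γ.1 < 1) (h3 : 0 < γ.2)
    (h : γ.1 * γ.1 + γ.2 * γ.2 = 1) (h0 : S.v2 k γ ≠ 0) :
    γ.1 * fderiv ℝ (S.rho k) γ (0, 1) - γ.2 * fderiv ℝ (S.rho k) γ (1, 0) =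
      -((S.nu ^ 2 - 1) * (γ.2 - γ.1 * S.rho k γ) ^ 2) := by
  obtain ⟨t1, t2⟩ := S.fderiv_v_tangent k h1 h2 h3 h
  have d1 := ((S.contDiffAt_v1 k h1 h2 h3).differentiableAt (by simp)).hasFDerivAt
  have d2 := ((S.contDiffAt_v2 k h1 h2 h3).differentiableAt (by simp)).hasFDerivAt
  have e := (d1.mul ((hasDerivAt_inv h0).comp_hasFDerivAt γ d2)).neg
  have e' := e.congr_of_eventuallyEq (f₁ := S.rho k) (Filter.Eventually.of_forall fun y => by
    simp [rho, div_eq_mul_inv])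
  have hl := linear_apply_pair (fderiv ℝ (S.rho k) γ) (-γ.2) γ.1
  have : γ.1 * fderiv ℝ (S.rho k) γ (0, 1) - γ.2 * fderiv ℝ (S.rho k) γ (1, 0) =
      fderiv ℝ (S.rho k) γ (-γ.2, γ.1) := by rw [hl]; ring
  rw [this, e'.fderiv]
  simp only [neg_apply, add_apply, smul_apply, smul_eq_mul, t1, t2, rho, Function.comp]
  field_simp
  ring

/-- The members of the two families are solutions. -/
theorem isSolution_familyP (hg : S.grav = 0) (c : Fin 2 → ℝ) {G : Set (ℝ × ℝ)} {I : Set ℝ}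
    (hG : IsOpen G) (hI : IsOpen I) (hGdom : ∀ γ ∈ G, -1 < γ.1 ∧ γ.1 < 1 ∧ 0 < γ.2)
    (k : Fin 2) (hv : ∀ γ ∈ G, S.v2 k γ ≠ 0) {α : Config → ℝ} {β : ℝ × ℝ → ℝ} {σ : Config → ℝ}
    (hα : ContDiffOn ℝ ∞ α (G ×ˢ I)) (hα0 : ∀ q ∈ G ×ˢ I, α q ≠ 0) (hβ : ContDiffOn ℝ ∞ β G)
    (hσ : S.IsSigma G I k α β σ) : S.IsSolution c G I (S.familyP k α β σ) := by
  have hρ : ∀ q ∈ G ×ˢ I, ContDiffAt ℝ ∞ (S.rho k) q.1 := fun q hq =>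
    S.contDiffAt_rho k (hGdom _ hq.1).1 (hGdom _ hq.1).2.1 (hGdom _ hq.1).2.2 (hv _ hq.1)
  have hρ' : ContDiffOn ℝ ∞ (fun q : Config => S.rho k q.1) (G ×ˢ I) := fun q hq =>
    ((hρ q hq).comp q contDiffAt_fst).contDiffWithinAt
  have hαd : ∀ q ∈ G ×ˢ I, DifferentiableAt ℝ α q := fun q hq =>
    (hα.contDiffAt ((hG.prod hI).mem_nhds hq)).differentiableAt (by simp)
  have hσd : ∀ q ∈ G ×ˢ I, DifferentiableAt ℝ σ q := fun q hq =>
    (hσ.1.contDiffAt ((hG.prod hI).mem_nhds hq)).differentiableAt (by simp)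
  have hρd : ∀ q ∈ G ×ˢ I, DifferentiableAt ℝ (fun q : Config => S.rho k q.1) q := fun q hq =>
    (hρ'.contDiffAt ((hG.prod hI).mem_nhds hq)).differentiableAt (by simp)
  have D1 : ∀ q ∈ G ×ˢ I, ∀ v, fderiv ℝ (fun p : Config => α p * S.rho k p.1) q v =
      α q * fderiv ℝ (S.rho k) q.1 v.1 + S.rho k q.1 * fderiv ℝ α q v := fun q hq v => by
    rw [fderiv_fun_mul (hαd q hq) (hρd q hq), add_apply, smul_apply, smul_apply,
      fderiv_config_comp ((hρ q hq).differentiableAt (by simp)), smul_eq_mul, smul_eq_mul]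
  have D2 : ∀ q ∈ G ×ˢ I, ∀ v, fderiv ℝ (fun p : Config => α p * σ p) q v =
      α q * fderiv ℝ σ q v + σ q * fderiv ℝ α q v := fun q hq v => by
    rw [fderiv_fun_mul (hαd q hq) (hσd q hq), add_apply, smul_apply, smul_apply, smul_eq_mul,
      smul_eq_mul]
  have D3 : ∀ q ∈ G ×ˢ I, fderiv ℝ σ q ((0, 0), 1) = β q.1 * S.sigmaIntegrand k α q :=
    fun q hq => by
    have hz : HasDerivAt (fun ζ : ℝ => (q.1, ζ)) ((0 : ℝ × ℝ), (1 : ℝ)) q.2 :=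
      (hasDerivAt_const q.2 q.1).prodMk (hasDerivAt_id q.2)
    have := HasFDerivAt.comp_hasDerivAt q.2 (hσd q hq).hasFDerivAt hz
    exact this.unique (hσ.2 q.1 hq.1 q.2 hq.2)
  rw [familyP_eq]
  refine S.isSolution_fiberBivector hg c hG hI hGdom (fun i => ?_) hβ
    (fun q hq h => ?_) (fun q hq h => ?_) (fun q hq => ?_)
  · fin_cases i
    · exact hα
    · exact hα.mul hρ'
    · exact hα.mul hσ.1
  -- Solved for ∂σ/∂z, this Jacobi condition is exactly the definition of σ.
  · have h0 := hα0 q hq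
    simp [D2 q hq, D3 q hq, sigmaIntegrand]
    field_simp
    ring
  -- Once ∂σ/∂z is substituted, the derivatives of α cancel and the Riccati equation of ρ remains.
  · have h0 := hα0 q hq
    have t := S.fderiv_rho_tangent k (hGdom _ hq.1).1 (hGdom _ hq.1).2.1 (hGdom _ hq.1).2.2 h
      (hv _ hq.1)
    have z : fderiv ℝ (S.rho k) q.1 (0, 0) = 0 := map_zero _
    simp [D1 q hq, D2 q hq, D3 q hq, sigmaIntegrand, z]
    field_simp
    linear_combination (-β q.1 * α q) * t
  · have z : fderiv ℝ (S.rho k) q.1 (0, 0) = 0 := map_zero _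
    simp [D1 q hq, z]
    ring

end StublerModel

/-! ### Smooth primitives with parameters and the existence of σ. -/

theorem hasFDerivAt_intervalIntegral_param {E F : Type} [NormedAddCommGroup E] [NormedSpace ℝ E]
    [NormedAddCommGroup F] [NormedSpace ℝ F] {f : E × ℝ → F} {V : Set (E × ℝ)} (hV : IsOpen V)
    (hf : ContDiffOn ℝ ∞ f V) {q₀ : E} (hq : ∀ t ∈ Set.Icc (0 : ℝ) 1, (q₀, t) ∈ V) :
    HasFDerivAt (fun q => ∫ t in (0 : ℝ)..1, f (q, t))
      (∫ t in (0 : ℝ)..1, (fderiv ℝ f (q₀, t)).comp (ContinuousLinearMap.inl ℝ E ℝ)) q₀ := by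
  have hf' : ContinuousOn (fun p => (fderiv ℝ f p).comp (ContinuousLinearMap.inl ℝ E ℝ)) V :=
    (hf.continuousOn_fderiv_of_isOpen hV (by simp)).clm_comp continuousOn_const
  have hK : IsCompact ({q₀} ×ˢ Set.Icc (0 : ℝ) 1) := isCompact_singleton.prod isCompact_Icc
  have hKV : {q₀} ×ˢ Set.Icc (0 : ℝ) 1 ⊆ V := by
    rintro ⟨q, t⟩ ⟨rfl, ht⟩
    exact hq t ht
  obtain ⟨C, hC⟩ := hK.exists_bound_of_continuousOn (hf'.mono hKV)
  have hW := hf'.norm.isOpen_inter_preimage hV (isOpen_Iio (a := C + 1))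
  -- The compact segment over q₀ has a tube on which the derivative is bounded by C + 1; this
  -- constant is the dominating function.
  obtain ⟨u, v, hu, -, hqu, hv, huv⟩ := generalized_tube_lemma isCompact_singleton isCompact_Icc
    hW fun p hp => ⟨hKV hp, by
      simp only [Set.mem_preimage, Set.mem_Iio]
      linarith [hC p hp]⟩
  have hq₀ : q₀ ∈ u := hqu rfl
  have hI : Set.uIoc (0 : ℝ) 1 ⊆ Set.Icc 0 1 := by
    rw [Set.uIoc_of_le zero_le_one]
    exact Set.Ioc_subset_Icc_self
  have hcont : ∀ q ∈ u, ContinuousOn (fun t => f (q, t)) (Set.Icc 0 1) := fun q hq' =>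
    hf.continuousOn.comp (by fun_prop) fun t ht => (huv ⟨hq', hv ht⟩).1
  refine intervalIntegral.hasFDerivAt_integral_of_dominated_of_fderiv_le
    (F := fun q t => f (q, t))
    (F' := fun q t => (fderiv ℝ f (q, t)).comp (ContinuousLinearMap.inl ℝ E ℝ))
    (bound := fun _ => C + 1) (hu.mem_nhds hq₀) ?_ ?_ ?_ ?_ ?_ ?_
  · filter_upwards [hu.mem_nhds hq₀] with q hq'
    exact ((hcont q hq').mono hI).aestronglyMeasurable measurableSet_uIoc
  · apply ContinuousOn.intervalIntegrable
    rw [Set.uIcc_of_le zero_le_one]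
    exact hcont q₀ hq₀
  · refine ContinuousOn.aestronglyMeasurable (ContinuousOn.mono (s := Set.Icc 0 1) ?_ hI)
      measurableSet_uIoc
    exact hf'.comp (by fun_prop) fun t ht => hq t ht
  · refine Filter.Eventually.of_forall fun t ht q hq' => ?_
    exact le_of_lt (huv (⟨hq', hv (hI ht)⟩ : (q, t) ∈ u ×ˢ v)).2
  · exact intervalIntegrable_const
  · refine Filter.Eventually.of_forall fun t ht q hq' => ?_
    have hp : (q, t) ∈ V := (huv (⟨hq', hv (hI ht)⟩ : (q, t) ∈ u ×ˢ v)).1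
    have hd := ((hf.contDiffAt (hV.mem_nhds hp)).differentiableAt (by simp)).hasFDerivAt
    exact HasFDerivAt.comp q hd (hasFDerivAt_prodMk_left q t)

/-- The target space is generalized inside the induction because the derivative of the integrand
takes values in a space of linear maps. -/
theorem contDiffOn_intervalIntegral_param_nat {E : Type} [NormedAddCommGroup E] [NormedSpace ℝ E]
    {V : Set (E × ℝ)} (hV : IsOpen V) {U : Set E} (hU : IsOpen U)
    (hUV : ∀ q ∈ U, ∀ t ∈ Set.Icc (0 : ℝ) 1, (q, t) ∈ V) (n : ℕ) :
    ∀ {F : Type} [NormedAddCommGroup F] [NormedSpace ℝ F] {f : E × ℝ → F},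
      ContDiffOn ℝ ∞ f V → ContDiffOn ℝ n (fun q => ∫ t in (0 : ℝ)..1, f (q, t)) U := by
  induction n with
  | zero =>
    intro F _ _ f hf
    rw [Nat.cast_zero, contDiffOn_zero]
    exact fun q hq =>
      (hasFDerivAt_intervalIntegral_param hV hf (hUV q hq)).continuousAt.continuousWithinAt
  | succ n ih =>
    intro F _ _ f hf
    push_cast
    rw [contDiffOn_succ_iff_fderiv_of_isOpen hU]
    refine ⟨fun q hq => (hasFDerivAt_intervalIntegral_param hV hf
      (hUV q hq)).differentiableAt.differentiableWithinAt, by simp, ?_⟩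
    have hf' : ContDiffOn ℝ ∞
        (fun p => (fderiv ℝ f p).comp (ContinuousLinearMap.inl ℝ E ℝ)) V :=
      (hf.fderiv_of_isOpen hV (by simp)).clm_comp contDiffOn_const
    exact (ih hf').congr fun q hq =>
      (hasFDerivAt_intervalIntegral_param hV hf (hUV q hq)).fderiv

/-- Smooth dependence of an integral on parameters. -/
theorem contDiffOn_intervalIntegral_param {E F : Type} [NormedAddCommGroup E] [NormedSpace ℝ E]
    [NormedAddCommGroup F] [NormedSpace ℝ F] {f : E × ℝ → F} {V : Set (E × ℝ)} (hV : IsOpen V)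
    {U : Set E} (hU : IsOpen U) (hUV : ∀ q ∈ U, ∀ t ∈ Set.Icc (0 : ℝ) 1, (q, t) ∈ V)
    (hf : ContDiffOn ℝ ∞ f V) :
    ContDiffOn ℝ ∞ (fun q => ∫ t in (0 : ℝ)..1, f (q, t)) U :=
  contDiffOn_infty.2 fun n => contDiffOn_intervalIntegral_param_nat hV hU hUV n hf

/-- Rescaling the integral from z₀ to z onto [0, 1] turns the moving endpoint into a parameter,
which gives joint smoothness; the unscaled form gives the derivative in z. -/
theorem exists_smooth_primitive {G : Set (ℝ × ℝ)} {I : Set ℝ} (hG : IsOpen G) (hI : IsOpen I)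
    (hI' : I.OrdConnected) (hIne : I.Nonempty) {g : Config → ℝ} (hg : ContDiffOn ℝ ∞ g (G ×ˢ I)) :
    ∃ σ : Config → ℝ, ContDiffOn ℝ ∞ σ (G ×ˢ I) ∧
      ∀ γ ∈ G, ∀ z ∈ I, HasDerivAt (fun ζ => σ (γ, ζ)) (g (γ, z)) z := by
  obtain ⟨z₀, hz₀⟩ := hIne
  have hmap : ContDiff ℝ ∞ fun p : Config × ℝ => ((p.1.1, z₀ + (p.1.2 - z₀) * p.2) : Config) := by
    fun_prop
  have hopen : IsOpen (G ×ˢ I) := hG.prod hI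
  have hV := hopen.preimage hmap.continuous
  have hUV : ∀ q ∈ G ×ˢ I, ∀ t ∈ Set.Icc (0 : ℝ) 1, (q, t) ∈
      (fun p : Config × ℝ => ((p.1.1, z₀ + (p.1.2 - z₀) * p.2) : Config)) ⁻¹' (G ×ˢ I) := by
    rintro ⟨γ, z⟩ ⟨hγ, hz⟩ t ht
    refine ⟨hγ, ?_⟩
    have := (hI'.convex).add_smul_sub_mem hz₀ hz ht
    simpa [mul_comm] using this
  have hint := contDiffOn_intervalIntegral_param hV hopen hUV
    (hg.comp hmap.contDiffOn (Set.mapsTo_preimage _ _))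
  refine ⟨fun q => (q.2 - z₀) * ∫ t in (0 : ℝ)..1, g (q.1, z₀ + (q.2 - z₀) * t),
    ContDiffOn.mul (by fun_prop) hint, fun γ hγ z hz => ?_⟩
  have e : (fun ζ : ℝ => (ζ - z₀) * ∫ t in (0 : ℝ)..1, g (γ, z₀ + (ζ - z₀) * t)) =
      fun ζ => ∫ t in z₀..ζ, g (γ, t) := by
    funext ζ
    rw [← smul_eq_mul, intervalIntegral.smul_integral_comp_add_mul (fun t => g (γ, t))]
    simp
  have hcont : ContinuousOn (fun t => g (γ, t)) I :=
    hg.continuousOn.comp (by fun_prop) fun t ht => ⟨hγ, ht⟩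
  change HasDerivAt (fun ζ : ℝ => (ζ - z₀) * ∫ t in (0 : ℝ)..1, g (γ, z₀ + (ζ - z₀) * t)) _ z
  rw [e]
  exact intervalIntegral.integral_hasDerivAt_right
    ((hcont.mono (hI'.uIcc_subset hz₀ hz)).intervalIntegrable)
    (hcont.stronglyMeasurableAtFilter hI z hz) (hcont.continuousAt (hI.mem_nhds hz))

namespace StublerModel

variable (S : StublerModel)

theorem exists_isSigma {G : Set (ℝ × ℝ)} {I : Set ℝ}
    (hG : IsOpen G) (hI : IsOpen I) (hI' : I.OrdConnected) (hIne : I.Nonempty)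
    (hGdom : ∀ γ ∈ G, -1 < γ.1 ∧ γ.1 < 1 ∧ 0 < γ.2)
    (k : Fin 2) (hv : ∀ γ ∈ G, S.v2 k γ ≠ 0) {α : Config → ℝ} {β : ℝ × ℝ → ℝ}
    (hα : ContDiffOn ℝ ∞ α (G ×ˢ I)) (hα0 : ∀ q ∈ G ×ˢ I, α q ≠ 0) (hβ : ContDiffOn ℝ ∞ β G) :
    ∃ σ : Config → ℝ, S.IsSigma G I k α β σ := by
  have hρ : ContDiffOn ℝ ∞ (fun q : Config => S.rho k q.1) (G ×ˢ I) := fun q hq =>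
    ((S.contDiffAt_rho k (hGdom _ hq.1).1 (hGdom _ hq.1).2.1 (hGdom _ hq.1).2.2
      (hv _ hq.1)).comp q contDiffAt_fst).contDiffWithinAt
  have hd : ∀ v : Config, ContDiffOn ℝ ∞ (fun q => fderiv ℝ α q v) (G ×ˢ I) := fun v =>
    (hα.fderiv_of_isOpen (hG.prod hI) (by simp)).clm_apply contDiffOn_const
  have hx : ContDiffOn ℝ ∞ (fun q : Config => q.1.1) (G ×ˢ I) := by fun_prop
  have hy : ContDiffOn ℝ ∞ (fun q : Config => q.1.2) (G ×ˢ I) := by fun_prop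
  have hg : ContDiffOn ℝ ∞ (S.sigmaIntegrand k α) (G ×ˢ I) :=
    (((hx.mul contDiffOn_const).mul (hy.sub (hx.mul hρ))).div hα hα0).add
      (((hx.mul (hd _)).sub (hy.mul (hd _))).div (hα.pow 2) fun q hq => pow_ne_zero 2 (hα0 q hq))
  exact exists_smooth_primitive hG hI hI' hIne
    ((hβ.comp contDiffOn_fst fun q hq => hq.1).mul hg)

end StublerModel

/-! ### Comparison of coefficients in the involution equations. -/

/-- Six nonzero sample values determine the polynomial; the value 0 must be avoided, as the
equations hold only for M₃ ≠ 0. -/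
theorem coeffs_eq_zero_of_quintic {c0 c1 c2 c3 c4 c5 : ℝ}
    (h : ∀ m : ℝ, m ≠ 0 → c0 + c1 * m + c2 * m ^ 2 + c3 * m ^ 3 + c4 * m ^ 4 + c5 * m ^ 5 = 0) :
    c0 = 0 ∧ c1 = 0 ∧ c2 = 0 ∧ c3 = 0 ∧ c4 = 0 ∧ c5 = 0 := by
  have h1 := h 1 (by norm_num)
  have h2 := h (-1) (by norm_num)
  have h3 := h 2 (by norm_num)
  have h4 := h (-2) (by norm_num)
  have h5 := h 3 (by norm_num)
  have h6 := h (-3) (by norm_num)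
  norm_num at h1 h2 h3 h4 h5 h6
  refine ⟨?_, ?_, ?_, ?_, ?_, ?_⟩ <;> linarith

theorem coeffs_eq_zero_of_quadratic {c0 c1 c2 c3 c4 c5 : ℝ}
    (h : ∀ p q : ℝ, c0 + c1 * p + c2 * q + c3 * p ^ 2 + c4 * (p * q) + c5 * q ^ 2 = 0) :
    c0 = 0 ∧ c1 = 0 ∧ c2 = 0 ∧ c3 = 0 ∧ c4 = 0 ∧ c5 = 0 := by
  have h1 := h 0 0
  have h2 := h 1 0
  have h3 := h (-1) 0
  have h4 := h 0 1
  have h5 := h 0 (-1)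
  have h6 := h 1 1
  norm_num at h1 h2 h3 h4 h5 h6
  refine ⟨?_, ?_, ?_, ?_, ?_, ?_⟩ <;> linarith

/-- The affine function of three variables with given coefficients. -/
def affineEval (k : Fin 4 → ℝ) (p q m : ℝ) : ℝ := k 0 * p + k 1 * q + k 2 * m + k 3

theorem affineEval_eq_zero {k : Fin 4 → ℝ} (h0 : k 0 = 0) (h1 : k 1 = 0) (h2 : k 2 = 0)
    (h3 : k 3 = 0) (p q m : ℝ) : affineEval k p q m = 0 := by
  simp [affineEval, h0, h1, h2, h3]

/-- The five unknowns are the entries of the radial row. Ordering by powers of m, the third equation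
removes everything except rf = c m together with a proportional term of rz, and the first equation
then excludes c ≠ 0. -/
theorem radial_entries_eq_zero {κ h F A A' B l : ℝ} (hκ : κ ≠ 0) (hh : h ≠ 0) (hF : F ≠ 0)
    (hA' : A' ≠ 0) (hl : l ≠ 0) {rf rz rn rt rm : Fin 4 → ℝ}
    (E1 : ∀ p q m, m ≠ 0 → l * q * m ^ 2 * affineEval rf p q m + m ^ 2 * affineEval rn p q m +
      κ * A * affineEval rm p q m = 0)
    (E2 : ∀ p q m, m ≠ 0 → -(κ * F * m) * affineEval rf p q m + m ^ 2 * affineEval rt p q m +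
      κ * B * affineEval rm p q m = 0)
    (E3 : ∀ p q m, m ≠ 0 → κ * F * q * m * affineEval rf p q m - h * m ^ 2 * affineEval rz p q m +
      (m ^ 3 - κ * (A' * p + B * q)) * affineEval rm p q m = 0) (p q m : ℝ) (hm : m ≠ 0) :
    affineEval rf p q m = 0 ∧ affineEval rz p q m = 0 ∧ affineEval rn p q m = 0 ∧
      affineEval rt p q m = 0 ∧ affineEval rm p q m = 0 := by
  have hκF : κ * F ≠ 0 := mul_ne_zero hκ hF
  have P3 := fun p q => coeffs_eq_zero_of_quintic
    (c0 := -κ * (A' * p + B * q) * (rm 0 * p + rm 1 * q + rm 3))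
    (c1 := κ * F * q * (rf 0 * p + rf 1 * q + rf 3) - κ * (A' * p + B * q) * rm 2)
    (c2 := -h * (rz 0 * p + rz 1 * q + rz 3) + κ * F * q * rf 2)
    (c3 := -h * rz 2 + (rm 0 * p + rm 1 * q + rm 3)) (c4 := rm 2) (c5 := 0) fun m hm => by
      have := E3 p q m hm
      simp only [affineEval] at this
      linear_combination this
  have m2 : rm 2 = 0 := (P3 0 0).2.2.2.2.1
  have a3 := coeffs_eq_zero_of_quadratic (c0 := -h * rz 2 + rm 3) (c1 := rm 0) (c2 := rm 1)
    (c3 := 0) (c4 := 0) (c5 := 0) fun p q => by linear_combination (P3 p q).2.2.2.1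
  obtain ⟨z2, m0, m1, -⟩ := a3
  have a0 := (P3 1 0).1
  rw [m0] at a0
  have m3 : rm 3 = 0 := by
    have : κ * A' * rm 3 = 0 := by linear_combination -a0
    exact (mul_eq_zero.1 this).resolve_left (mul_ne_zero hκ hA')
  have z2' : rz 2 = 0 := by
    have : h * rz 2 = 0 := by linear_combination m3 - z2
    exact (mul_eq_zero.1 this).resolve_left hh
  obtain ⟨-, -, f3, -, f0, f1⟩ := coeffs_eq_zero_of_quadratic (c0 := 0) (c1 := 0)
    (c2 := κ * F * rf 3) (c3 := 0) (c4 := κ * F * rf 0) (c5 := κ * F * rf 1) fun p q => by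
      have := (P3 p q).2.1
      rw [m2] at this
      linear_combination this
  obtain ⟨z3, z0, z1, -⟩ := coeffs_eq_zero_of_quadratic (c0 := -h * rz 3) (c1 := -h * rz 0)
    (c2 := -h * rz 1 + κ * F * rf 2) (c3 := 0) (c4 := 0) (c5 := 0) fun p q => by
      linear_combination (P3 p q).2.2.1
  have f3 := (mul_eq_zero.1 f3).resolve_left hκF
  have f0 := (mul_eq_zero.1 f0).resolve_left hκF
  have f1 := (mul_eq_zero.1 f1).resolve_left hκF
  have hm0 : ∀ p q m, affineEval rm p q m = 0 := affineEval_eq_zero m0 m1 m2 m3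
  have hn : ∀ p q m, m ≠ 0 → affineEval rn p q m = -(l * rf 2 * (q * m)) := fun p q m hm => by
    have := E1 p q m hm
    rw [hm0] at this
    simp only [affineEval, f0, f1, f3] at this ⊢
    have h2 : m ^ 2 ≠ 0 := pow_ne_zero 2 hm
    refine mul_left_cancel₀ h2 ?_
    linear_combination this
  -- An affine function cannot equal a multiple of q m; the mixed difference over the four sign
  -- choices of (q, m) isolates the coefficient.
  have f2 : rf 2 = 0 := by
    have e1 := hn 0 1 1 (by norm_num)
    have e2 := hn 0 1 (-1) (by norm_num)
    have e3 := hn 0 (-1) 1 (by norm_num)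
    have e4 := hn 0 (-1) (-1) (by norm_num)
    simp only [affineEval] at e1 e2 e3 e4
    have : l * rf 2 = 0 := by linarith
    exact (mul_eq_zero.1 this).resolve_left hl
  have hf0 : ∀ p q m, affineEval rf p q m = 0 := affineEval_eq_zero f0 f1 f2 f3
  refine ⟨hf0 p q m, ?_, ?_, ?_, hm0 p q m⟩
  · have := E3 p q m hm
    rw [hf0, hm0] at this
    have h2 : h * m ^ 2 ≠ 0 := mul_ne_zero hh (pow_ne_zero 2 hm)
    exact (mul_eq_zero.1 (show h * m ^ 2 * affineEval rz p q m = 0 by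
      linear_combination -this)).resolve_left h2
  · rw [hn p q m hm, f2]
    ring
  · have := E2 p q m hm
    rw [hf0, hm0] at this
    exact (mul_eq_zero.1 (show m ^ 2 * affineEval rt p q m = 0 by
      linear_combination this)).resolve_left (pow_ne_zero 2 hm)

/-- The ten unknowns are the remaining entries, with forty coefficients in all. Sorting each
equation by powers of m and then of p, q leaves two free numbers: the constant terms of the (normal,
vertical) and (normal, tangential) momentum entries. -/
theorem tangential_entries_eq {κ h F A A' B l : ℝ} (hκ : κ ≠ 0) (hh : h ≠ 0) (hF : F ≠ 0)
    (hA : A ≠ 0) (hA' : A' ≠ 0) (hl : l ≠ 0)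
    {fz fn ft fm zn zt zm nt nm tm : Fin 4 → ℝ}
    (E1 : ∀ p q m, m ≠ 0 → m ^ 3 * affineEval nt p q m + κ * F * m ^ 2 * affineEval fn p q m +
      κ * B * m * affineEval nm p q m + l * q * m ^ 3 * affineEval ft p q m +
      (l * κ * B * q * m + κ ^ 2 * A * F) * affineEval fm p q m -
      κ * A * m * affineEval tm p q m = 0)
    (E2 : ∀ p q m, m ≠ 0 → h * m ^ 3 * affineEval zn p q m -
      κ * F * q * m ^ 2 * affineEval fn p q m +
      (m ^ 4 - κ * (A' * p + B * q) * m) * affineEval nm p q m -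
      l * h * q * m ^ 3 * affineEval fz p q m +
      (l * q * (m ^ 4 - κ * (A' * p + B * q) * m) - κ ^ 2 * A * F * q) * affineEval fm p q m +
      κ * A * h * m * affineEval zm p q m = 0)
    (E3 : ∀ p q m, m ≠ 0 → h * m ^ 3 * affineEval zt p q m -
      κ * F * q * m ^ 2 * affineEval ft p q m +
      (m ^ 4 - κ * (A' * p + B * q) * m) * affineEval tm p q m +
      κ * F * h * m ^ 2 * affineEval fz p q m -
      (κ * F * (m ^ 3 - κ * (A' * p + B * q)) + κ ^ 2 * B * F * q) * affineEval fm p q m +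
      κ * B * h * m * affineEval zm p q m = 0) :
    ∃ N N' : ℝ, ∀ p q m : ℝ, affineEval fz p q m = 0 ∧ affineEval ft p q m = 0 ∧
      affineEval fm p q m = 0 ∧ affineEval nm p q m = N ∧ A * affineEval tm p q m = B * N ∧
      A * h * affineEval zm p q m = (A' * p + B * q) * N ∧ affineEval nt p q m = N' ∧
      κ * F * affineEval fn p q m = -(N' * m) ∧ h * affineEval zn p q m = -(q * N' + m * N) ∧
      A * h * affineEval zt p q m = -(m * B * N) := by
  have hκF : κ * F ≠ 0 := mul_ne_zero hκ hF
  have P1 := fun p q => coeffs_eq_zero_of_quintic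
    (c0 := κ ^ 2 * A * F * (fm 0 * p + fm 1 * q + fm 3))
    (c1 := κ * B * (nm 0 * p + nm 1 * q + nm 3) - κ * A * (tm 0 * p + tm 1 * q + tm 3) +
      l * κ * B * q * (fm 0 * p + fm 1 * q + fm 3) + κ ^ 2 * A * F * fm 2)
    (c2 := κ * F * (fn 0 * p + fn 1 * q + fn 3) + κ * B * nm 2 - κ * A * tm 2 +
      l * κ * B * q * fm 2)
    (c3 := (nt 0 * p + nt 1 * q + nt 3) + κ * F * fn 2 + l * q * (ft 0 * p + ft 1 * q + ft 3))
    (c4 := nt 2 + l * q * ft 2) (c5 := 0) fun m hm => by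
      have := E1 p q m hm
      simp only [affineEval] at this
      linear_combination this
  have P2 := fun p q => coeffs_eq_zero_of_quintic
    (c0 := -κ ^ 2 * A * F * q * (fm 0 * p + fm 1 * q + fm 3))
    (c1 := -κ * (A' * p + B * q) * (nm 0 * p + nm 1 * q + nm 3) +
      κ * A * h * (zm 0 * p + zm 1 * q + zm 3) -
      l * q * κ * (A' * p + B * q) * (fm 0 * p + fm 1 * q + fm 3) - κ ^ 2 * A * F * q * fm 2)
    (c2 := -κ * F * q * (fn 0 * p + fn 1 * q + fn 3) - κ * (A' * p + B * q) * nm 2 +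
      κ * A * h * zm 2 - l * q * κ * (A' * p + B * q) * fm 2)
    (c3 := h * (zn 0 * p + zn 1 * q + zn 3) - κ * F * q * fn 2 -
      l * h * q * (fz 0 * p + fz 1 * q + fz 3))
    (c4 := h * zn 2 + (nm 0 * p + nm 1 * q + nm 3) - l * h * q * fz 2 +
      l * q * (fm 0 * p + fm 1 * q + fm 3))
    (c5 := nm 2 + l * q * fm 2) fun m hm => by
      have := E2 p q m hm
      simp only [affineEval] at this
      linear_combination this
  obtain ⟨m3, m0, m1, -⟩ := coeffs_eq_zero_of_quadratic (c0 := fm 3) (c1 := fm 0) (c2 := fm 1)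
    (c3 := 0) (c4 := 0) (c5 := 0) fun p q => by
      have hne : κ ^ 2 * A * F ≠ 0 := mul_ne_zero (mul_ne_zero (pow_ne_zero 2 hκ) hA) hF
      linear_combination (mul_eq_zero.1 (P1 p q).1).resolve_left hne
  have nm2 : nm 2 = 0 := by linear_combination (P2 0 0).2.2.2.2.2
  have m2 : fm 2 = 0 := (mul_eq_zero.1 (show l * fm 2 = 0 by
    linear_combination (P2 0 1).2.2.2.2.2 - nm2)).resolve_left hl
  have hfm : ∀ p q m, affineEval fm p q m = 0 := affineEval_eq_zero m0 m1 m2 m3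
  simp only [m0, m1, m2, m3, nm2] at P1 P2
  have P3 := fun p q => coeffs_eq_zero_of_quintic (c0 := 0)
    (c1 := -κ * (A' * p + B * q) * (tm 0 * p + tm 1 * q + tm 3) +
      κ * B * h * (zm 0 * p + zm 1 * q + zm 3))
    (c2 := -κ * F * q * (ft 0 * p + ft 1 * q + ft 3) - κ * (A' * p + B * q) * tm 2 +
      κ * F * h * (fz 0 * p + fz 1 * q + fz 3) + κ * B * h * zm 2)
    (c3 := h * (zt 0 * p + zt 1 * q + zt 3) - κ * F * q * ft 2 + κ * F * h * fz 2)
    (c4 := h * zt 2 + (tm 0 * p + tm 1 * q + tm 3)) (c5 := tm 2) fun m hm => by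
      have := E3 p q m hm
      rw [hfm] at this
      simp only [affineEval] at this
      linear_combination this
  have tm2 : tm 2 = 0 := (P3 0 0).2.2.2.2.2
  simp only [tm2] at P1 P3
  obtain ⟨n3, n0, n1, -⟩ := coeffs_eq_zero_of_quadratic (c0 := fn 3) (c1 := fn 0) (c2 := fn 1)
    (c3 := 0) (c4 := 0) (c5 := 0) fun p q => by
      refine mul_left_cancel₀ hκF ?_
      linear_combination (P1 p q).2.2.1
  simp only [n0, n1, n3] at P2
  have zm2 : zm 2 = 0 := (mul_eq_zero.1 (show κ * A * h * zm 2 = 0 by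
    linear_combination (P2 0 0).2.2.1)).resolve_left (mul_ne_zero (mul_ne_zero hκ hA) hh)
  obtain ⟨c0, c1, c2, c3, c4, -⟩ := coeffs_eq_zero_of_quadratic (c0 := A * h * zm 3)
    (c1 := -A' * nm 3 + A * h * zm 0) (c2 := -B * nm 3 + A * h * zm 1) (c3 := -A' * nm 0)
    (c4 := -A' * nm 1 - B * nm 0) (c5 := -B * nm 1) fun p q => by
      refine mul_left_cancel₀ hκ ?_
      linear_combination (P2 p q).2.1
  have nm0 : nm 0 = 0 := (mul_eq_zero.1 c3).resolve_left (neg_ne_zero.2 hA')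
  have nm1 : nm 1 = 0 := (mul_eq_zero.1 (show A' * nm 1 = 0 by
    linear_combination -c4 - B * nm0)).resolve_left hA'
  simp only [nm0, nm1] at P1 P2
  obtain ⟨d0, d1, d2, -⟩ := coeffs_eq_zero_of_quadratic (c0 := B * nm 3 - A * tm 3)
    (c1 := -A * tm 0) (c2 := -A * tm 1) (c3 := 0) (c4 := 0) (c5 := 0) fun p q => by
      refine mul_left_cancel₀ hκ ?_
      linear_combination (P1 p q).2.1
  have tm0 := (mul_eq_zero.1 d1).resolve_left (neg_ne_zero.2 hA)
  have tm1 := (mul_eq_zero.1 d2).resolve_left (neg_ne_zero.2 hA)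
  have zn2 : h * zn 2 = -nm 3 := by linear_combination (P2 0 0).2.2.2.2.1
  have fz2 : fz 2 = 0 := (mul_eq_zero.1 (show l * h * fz 2 = 0 by
    linear_combination zn2 - (P2 0 1).2.2.2.2.1)).resolve_left (mul_ne_zero hl hh)
  have nt2 : nt 2 = 0 := by linear_combination (P1 0 0).2.2.2.2.1
  have ft2 : ft 2 = 0 := (mul_eq_zero.1 (show l * ft 2 = 0 by
    linear_combination (P1 0 1).2.2.2.2.1 - nt2)).resolve_left hl
  obtain ⟨e0, e1, e2, -, e4, e5⟩ := coeffs_eq_zero_of_quadratic (c0 := nt 3 + κ * F * fn 2)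
    (c1 := nt 0) (c2 := nt 1 + l * ft 3) (c3 := 0) (c4 := l * ft 0) (c5 := l * ft 1)
    fun p q => by linear_combination (P1 p q).2.2.2.1
  have ft0 := (mul_eq_zero.1 e4).resolve_left hl
  have ft1 := (mul_eq_zero.1 e5).resolve_left hl
  simp only [zm2, fz2, ft2, ft0, ft1] at P3
  obtain ⟨g0, g1, g2, -⟩ := coeffs_eq_zero_of_quadratic (c0 := h * fz 3) (c1 := h * fz 0)
    (c2 := h * fz 1 - ft 3) (c3 := 0) (c4 := 0) (c5 := 0) fun p q => by
      refine mul_left_cancel₀ hκF ?_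
      linear_combination (P3 p q).2.2.1
  have fz3 := (mul_eq_zero.1 g0).resolve_left hh
  have fz0 := (mul_eq_zero.1 g1).resolve_left hh
  obtain ⟨k0, k1, k2, -, -, k5⟩ := coeffs_eq_zero_of_quadratic (c0 := h * zn 3) (c1 := h * zn 0)
    (c2 := h * zn 1 - κ * F * fn 2) (c3 := 0) (c4 := 0) (c5 := -(l * h) * fz 1) fun p q => by
      linear_combination (P2 p q).2.2.2.1 + l * h * q * (p * fz0 + fz3)
  have fz1 := (mul_eq_zero.1 k5).resolve_left (neg_ne_zero.2 (mul_ne_zero hl hh))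
  have ft3 : ft 3 = 0 := by linear_combination h * fz1 - g2
  obtain ⟨s3, s0, s1, -⟩ := coeffs_eq_zero_of_quadratic (c0 := h * zt 3) (c1 := h * zt 0)
    (c2 := h * zt 1) (c3 := 0) (c4 := 0) (c5 := 0) fun p q => by
      linear_combination (P3 p q).2.2.2.1
  have zt2 : h * zt 2 = -tm 3 := by linear_combination (P3 0 0).2.2.2.2.1
  refine ⟨nm 3, nt 3, fun p q m => ⟨affineEval_eq_zero fz0 fz1 fz2 fz3 p q m,
    affineEval_eq_zero ft0 ft1 ft2 ft3 p q m, hfm p q m, ?_, ?_, ?_, ?_, ?_, ?_, ?_⟩⟩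
  · simp only [affineEval, nm0, nm1, nm2]; ring
  · simp only [affineEval, tm0, tm1, tm2]; linear_combination -d0
  · simp only [affineEval, zm2]; linear_combination c0 + p * c1 + q * c2
  · simp only [affineEval, e1, nt2]; linear_combination q * e2 - q * l * ft3
  · simp only [affineEval, n0, n1, n3]; linear_combination m * e0
  · simp only [affineEval]; linear_combination k0 + p * k1 + q * k2 + m * zn2 + q * e0
  · simp only [affineEval]
    linear_combination A * s3 + A * p * s0 + A * q * s1 + A * m * zt2 + m * d0

/-! ### The involution equations in the adapted frame. -/

/-- The orthonormal frame adapted to the unit circle: radial and tangential directions, `z`, and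
the normal, tangential and vertical components of the momentum. -/
def frame (c s : ℝ) : Matrix (Fin 6) (Fin 6) ℝ :=
  !![c, s, 0, 0, 0, 0;
     -s, c, 0, 0, 0, 0;
     0, 0, 1, 0, 0, 0;
     0, 0, 0, c, s, 0;
     0, 0, 0, -s, c, 0;
     0, 0, 0, 0, 0, 1]

theorem frame_transpose_mul {c s : ℝ} (h : c * c + s * s = 1) : (frame c s)ᵀ * frame c s = 1 := by
  ext i j
  fin_cases i <;> fin_cases j <;>
    simp [frame, Matrix.mul_apply, Fin.sum_univ_six] <;> linarith

theorem bivectorBracket_frame {c s : ℝ} (h : c * c + s * s = 1) (P : Bivector)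
    (F₁ F₂ : Phase → ℝ) (x : Phase) :
    bivectorBracket P F₁ F₂ x = (frame c s *ᵥ fun i => partialDeriv i F₁ x) ⬝ᵥ
      ((frame c s * P x * (frame c s)ᵀ) *ᵥ (frame c s *ᵥ fun j => partialDeriv j F₂ x)) := by
  rw [bivectorBracket_eq, Matrix.mulVec_mulVec, Matrix.mul_assoc _ _ (frame c s),
    frame_transpose_mul h, Matrix.mul_one, ← Matrix.mulVec_mulVec,
    Matrix.dotProduct_mulVec _ (frame c s), ← Matrix.vecMul_transpose (frame c s),
    Matrix.vecMul_vecMul, frame_transpose_mul h, Matrix.vecMul_one]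

/-- Consequences of the involution of the integrals for the entries of the bivector in the
adapted frame. -/
theorem frame_constraints {T : Matrix (Fin 6) (Fin 6) ℝ} (hT : ∀ i j, T i j = -T j i)
    {κ h F A B l n2 N p q m a₀ b₀ a₁ b₁ r₀ r₁ rH : ℝ} (hm : m ≠ 0) (hN : N ≠ 0) (hn2 : n2 ≠ 0)
    (hl : l = 1 - n2) (hW : a₀ * b₁ - a₁ * b₀ ≠ 0)
    {gC gH g₀ g₁ : Fin 6 → ℝ} (eC : gC = ![2, 0, 0, 0, 0, 0])
    (eH : gH = ![rH, (1 / n2 - 1) * p * q / N, -h / N, p / (n2 * N), q / N, m / N])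
    (e₀ : g₀ = ![r₀, l * a₀ * q - κ * F * b₀ / m, 0, a₀, b₀, κ * (a₀ * A + b₀ * B) / m ^ 2])
    (e₁ : g₁ = ![r₁, l * a₁ * q - κ * F * b₁ / m, 0, a₁, b₁, κ * (a₁ * A + b₁ * B) / m ^ 2])
    (hCH : gC ⬝ᵥ (T *ᵥ gH) = 0) (hC0 : gC ⬝ᵥ (T *ᵥ g₀) = 0) (hC1 : gC ⬝ᵥ (T *ᵥ g₁) = 0)
    (hH0 : gH ⬝ᵥ (T *ᵥ g₀) = 0) (hH1 : gH ⬝ᵥ (T *ᵥ g₁) = 0) (h01 : g₀ ⬝ᵥ (T *ᵥ g₁) = 0) :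
    (l * q * m ^ 2 * T 0 1 + m ^ 2 * T 0 3 + κ * A * T 0 5 = 0 ∧
      -(κ * F * m) * T 0 1 + m ^ 2 * T 0 4 + κ * B * T 0 5 = 0 ∧
      κ * F * q * m * T 0 1 - h * m ^ 2 * T 0 2 + (m ^ 3 - κ * (A / n2 * p + B * q)) * T 0 5 = 0) ∧
    m ^ 3 * T 3 4 + κ * F * m ^ 2 * T 1 3 + κ * B * m * T 3 5 + l * q * m ^ 3 * T 1 4 +
      (l * κ * B * q * m + κ ^ 2 * A * F) * T 1 5 - κ * A * m * T 4 5 = 0 ∧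
    h * m ^ 3 * T 2 3 - κ * F * q * m ^ 2 * T 1 3 +
      (m ^ 4 - κ * (A / n2 * p + B * q) * m) * T 3 5 - l * h * q * m ^ 3 * T 1 2 +
      (l * q * (m ^ 4 - κ * (A / n2 * p + B * q) * m) - κ ^ 2 * A * F * q) * T 1 5 +
      κ * A * h * m * T 2 5 = 0 ∧
    h * m ^ 3 * T 2 4 - κ * F * q * m ^ 2 * T 1 4 +
      (m ^ 4 - κ * (A / n2 * p + B * q) * m) * T 4 5 + κ * F * h * m ^ 2 * T 1 2 -
      (κ * F * (m ^ 3 - κ * (A / n2 * p + B * q)) + κ ^ 2 * B * F * q) * T 1 5 +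
      κ * B * h * m * T 2 5 = 0 := by
  have hm2 : m ^ 2 ≠ 0 := pow_ne_zero 2 hm
  obtain ⟨Ω, h_om⟩ : ∃ Ω : (Fin 6 → ℝ) → (Fin 6 → ℝ) → ℝ, ∀ ξ η, Ω ξ η = ξ ⬝ᵥ (T *ᵥ η) :=
    ⟨_, fun _ _ => rfl⟩
  rw [← h_om] at hCH hC0 hC1 hH0 hH1 h01
  have al : ∀ ξ ξ' η, Ω (ξ + ξ') η = Ω ξ η + Ω ξ' η := fun ξ ξ' η => by
    simp only [h_om, add_dotProduct]
  have ar : ∀ ξ η η', Ω ξ (η + η') = Ω ξ η + Ω ξ η' := fun ξ η η' => by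
    simp only [h_om, Matrix.mulVec_add, dotProduct_add]
  have sl : ∀ (t : ℝ) ξ η, Ω (t • ξ) η = t * Ω ξ η := fun t ξ η => by
    simp only [h_om, smul_dotProduct, smul_eq_mul]
  have sr : ∀ (t : ℝ) ξ η, Ω ξ (t • η) = t * Ω ξ η := fun t ξ η => by
    simp only [h_om, Matrix.mulVec_smul, dotProduct_smul, smul_eq_mul]
  have hsk : ∀ ξ η, Ω ξ η = -Ω η ξ := fun ξ η => by
    have e : T = -Tᵀ := by ext i j; exact hT i j
    rw [h_om, h_om, Matrix.dotProduct_mulVec, dotProduct_comm, ← Matrix.mulVec_transpose]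
    conv_rhs => rw [e]
    rw [Matrix.neg_mulVec, dotProduct_neg, neg_neg]
  have hd : ∀ ξ, Ω ξ ξ = 0 := fun ξ => by linarith [hsk ξ ξ]
  -- After multiplication by nonzero factors, the four differentials span the same space as `er`,
  -- `u`, `w`, `E`: the Wronskian lets u and w replace dJ₁ and dJ₂, and E is what is left of dH
  -- after subtracting its parts along `er`, `u` and `w`. The values of v⁽ᵏ⁾ thereby disappear.
  set er : Fin 6 → ℝ := ![1, 0, 0, 0, 0, 0] with her
  set u : Fin 6 → ℝ := ![0, l * q * m ^ 2, 0, m ^ 2, 0, κ * A] with hu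
  set w : Fin 6 → ℝ := ![0, -(κ * F * m), 0, 0, m ^ 2, κ * B] with hw
  set E : Fin 6 → ℝ := ![0, κ * F * q * m, -(h * m ^ 2), 0, 0,
    m ^ 3 - κ * (A / n2 * p + B * q)] with hE
  have dC : gC = (2 : ℝ) • er := by
    rw [eC, her]
    funext i
    fin_cases i <;> simp
  have d0 : m ^ 2 • g₀ = (m ^ 2 * r₀) • er + a₀ • u + b₀ • w := by
    rw [e₀, her, hu, hw]
    funext i
    fin_cases i <;> simp <;> field_simp <;> ring
  have d1 : m ^ 2 • g₁ = (m ^ 2 * r₁) • er + a₁ • u + b₁ • w := by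
    rw [e₁, her, hu, hw]
    funext i
    fin_cases i <;> simp <;> field_simp <;> ring
  have dH : (N * m ^ 2) • gH = (N * m ^ 2 * rH) • er + E + (p / n2) • u + q • w := by
    rw [eH, her, hu, hw, hE, hl]
    funext i
    fin_cases i <;> simp <;> field_simp <;> ring
  have k0 : a₀ * Ω er u + b₀ * Ω er w = 0 := by
    have : Ω er (m ^ 2 • g₀) = 0 := by
      rw [dC, sl] at hC0
      rw [sr]; linear_combination m ^ 2 / 2 * hC0
    rw [d0, ar, ar, sr, sr, sr, hd] at this
    linear_combination this
  have k1 : a₁ * Ω er u + b₁ * Ω er w = 0 := by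
    have : Ω er (m ^ 2 • g₁) = 0 := by
      rw [dC, sl] at hC1
      rw [sr]; linear_combination m ^ 2 / 2 * hC1
    rw [d1, ar, ar, sr, sr, sr, hd] at this
    linear_combination this
  have hru : Ω er u = 0 := (mul_eq_zero.1 (show (a₀ * b₁ - a₁ * b₀) * Ω er u = 0 by
    linear_combination b₁ * k0 - b₀ * k1)).resolve_left hW
  have hrw : Ω er w = 0 := (mul_eq_zero.1 (show (a₀ * b₁ - a₁ * b₀) * Ω er w = 0 by
    linear_combination a₀ * k1 - a₁ * k0)).resolve_left hW
  have hrE : Ω er E = 0 := by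
    have : Ω er ((N * m ^ 2) • gH) = 0 := by
      rw [dC, sl] at hCH
      rw [sr]; linear_combination N * m ^ 2 / 2 * hCH
    rw [dH, ar, ar, ar, sr, sr, sr, hd, hru, hrw] at this
    linear_combination this
  have hur : Ω u er = 0 := by rw [hsk, hru, neg_zero]
  have hwr : Ω w er = 0 := by rw [hsk, hrw, neg_zero]
  have hEr : Ω E er = 0 := by rw [hsk, hrE, neg_zero]
  have huw : Ω u w = 0 := by
    have : Ω (m ^ 2 • g₀) (m ^ 2 • g₁) = 0 := by rw [sl, sr, h01]; ring
    rw [d0, d1] at this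
    simp only [al, ar, sl, sr, hd, hru, hrw, hur, hwr, hsk w u] at this
    exact (mul_eq_zero.1 (show (a₀ * b₁ - a₁ * b₀) * Ω u w = 0 by
      linear_combination this)).resolve_left hW
  have hwu : Ω w u = 0 := by rw [hsk, huw, neg_zero]
  have j0 : a₀ * Ω E u + b₀ * Ω E w = 0 := by
    have : Ω ((N * m ^ 2) • gH) (m ^ 2 • g₀) = 0 := by rw [sl, sr, hH0]; ring
    rw [dH, d0] at this
    simp only [al, ar, sl, sr, hd, hru, hrw, hur, hwr, hEr, huw, hwu] at this
    linear_combination this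
  have j1 : a₁ * Ω E u + b₁ * Ω E w = 0 := by
    have : Ω ((N * m ^ 2) • gH) (m ^ 2 • g₁) = 0 := by rw [sl, sr, hH1]; ring
    rw [dH, d1] at this
    simp only [al, ar, sl, sr, hd, hru, hrw, hur, hwr, hEr, huw, hwu] at this
    linear_combination this
  have hEu : Ω E u = 0 := (mul_eq_zero.1 (show (a₀ * b₁ - a₁ * b₀) * Ω E u = 0 by
    linear_combination b₁ * j0 - b₀ * j1)).resolve_left hW
  have hEw : Ω E w = 0 := (mul_eq_zero.1 (show (a₀ * b₁ - a₁ * b₀) * Ω E w = 0 by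
    linear_combination a₀ * j1 - a₁ * j0)).resolve_left hW
  have t0 : ∀ i, T i i = 0 := fun i => by linarith [hT i i]
  simp only [h_om, her, hu, hw, hE, dotProduct, Matrix.mulVec, Fin.sum_univ_six]
    at hru hrw hrE huw hEu hEw
  simp [t0, hT 2 1, hT 3 1, hT 4 1, hT 5 1, hT 3 2, hT 4 2, hT 5 2, hT 4 3, hT 5 3,
    hT 5 4] at hru hrw hrE huw hEu hEw
  refine ⟨⟨?_, ?_, ?_⟩, ?_, ?_, ?_⟩
  · linear_combination hru
  · linear_combination hrw
  · linear_combination hrE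
  · refine mul_left_cancel₀ hm ?_
    linear_combination huw
  · refine mul_left_cancel₀ hm ?_
    linear_combination -hEu
  · refine mul_left_cancel₀ hm ?_
    linear_combination -hEw

/-- The point over the angle `θ` with given components of the momentum in the adapted frame. -/
noncomputable def circlePoint (θ z p q m : ℝ) : Phase :=
  ![Real.cos θ, Real.sin θ, z, Real.cos θ * p - Real.sin θ * q, Real.sin θ * p + Real.cos θ * q, m]

/-- Over a fixed configuration the change of frame is constant, and M is linear in its normal,
tangential and vertical components, so affinity survives. -/
theorem exists_affineEval_frame {G : Set (ℝ × ℝ)} {I : Set ℝ} {P : Bivector}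
    (hP : AffineInMomenta G I P) {θ z : ℝ} (hθ : (Real.cos θ, Real.sin θ) ∈ G) (hz : z ∈ I)
    (R : Matrix (Fin 6) (Fin 6) ℝ) :
    ∃ K : Fin 6 → Fin 6 → Fin 4 → ℝ, ∀ p q m i j,
      (R * P (circlePoint θ z p q m) * Rᵀ) i j = affineEval (K i j) p q m := by
  obtain ⟨u, w, -, -, h⟩ := hP
  set c := Real.cos θ with hc
  set s := Real.sin θ with hs
  obtain ⟨U, hU⟩ : ∃ U : Fin 3 → Matrix (Fin 6) (Fin 6) ℝ, ∀ k i j, u i j k ((c, s), z) = U k i j :=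
    ⟨fun k => Matrix.of fun i j => u i j k ((c, s), z), fun _ _ _ => rfl⟩
  obtain ⟨W, hW⟩ : ∃ W : Matrix (Fin 6) (Fin 6) ℝ, ∀ i j, w i j ((c, s), z) = W i j :=
    ⟨Matrix.of fun i j => w i j ((c, s), z), fun _ _ => rfl⟩
  refine ⟨fun i j => ![(R * (c • U 0 + s • U 1) * Rᵀ) i j, (R * (-s • U 0 + c • U 1) * Rᵀ) i j,
    (R * U 2 * Rᵀ) i j, (R * W * Rᵀ) i j], fun p q m i j => ?_⟩
  have e : P (circlePoint θ z p q m) =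
      p • (c • U 0 + s • U 1) + q • (-s • U 0 + c • U 1) + m • U 2 + W := by
    ext i j
    rw [h (circlePoint θ z p q m) ⟨hθ, hz⟩ i j, Fin.sum_univ_three]
    simp [circlePoint, Phase.config, Phase.momentum, hU, hW, ← hc, ← hs]
    ring
  rw [e]
  simp only [Matrix.mul_add, Matrix.add_mul, Matrix.mul_smul, Matrix.smul_mul, Matrix.add_apply,
    Matrix.smul_apply, smul_eq_mul, affineEval, Matrix.cons_val]
  ring

/-- The general form, in the adapted frame, of a bivector affine in the momenta for which the
integrals are in involution in the presence of gravity. -/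
noncomputable def gravityFrame (e h A A' B N N' p q m : ℝ) : Matrix (Fin 6) (Fin 6) ℝ :=
  !![0, 0, 0, 0, 0, 0;
     0, 0, 0, -(N' * m / e), 0, 0;
     0, 0, 0, -((q * N' + m * N) / h), -(m * B * N / (A * h)), (A' * p + B * q) * N / (A * h);
     0, N' * m / e, (q * N' + m * N) / h, 0, N', N;
     0, 0, m * B * N / (A * h), -N', 0, B * N / A;
     0, 0, -((A' * p + B * q) * N / (A * h)), -N, -(B * N / A), 0]

/-- When N or N' vanishes the bivector is decomposable, hence it factors through ℝ². -/
theorem rank_gravityFrame_le (e h A A' B N N' p q m : ℝ) (hh : h ≠ 0) (hA : A ≠ 0)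
    (hN : N * N' = 0) : (gravityFrame e h A A' B N N' p q m).rank ≤ 2 := by
  rcases mul_eq_zero.1 hN with rfl | rfl
  · have e : gravityFrame e h A A' B 0 N' p q m =
        (!![0, 0; 0, N' * m / e; 0, q * N' / h; 1, 0; 0, N'; 0, 0] : Matrix (Fin 6) (Fin 2) ℝ) *
        (!![0, N' * m / e, q * N' / h, 0, N', 0; 0, 0, 0, -1, 0, 0] :
          Matrix (Fin 2) (Fin 6) ℝ) := by
      ext i j
      fin_cases i <;> fin_cases j <;> simp [gravityFrame, Matrix.mul_apply, Fin.sum_univ_two]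
    rw [e]
    exact (Matrix.rank_mul_le_left _ _).trans (Matrix.rank_le_width _)
  · have e : gravityFrame e h A A' B N 0 p q m =
        (!![0, 0; 0, 0; (A' * p + B * q) / (A * h), m / h; 1, 0; B / A, 0; 0, 1] :
          Matrix (Fin 6) (Fin 2) ℝ) *
        (!![0, 0, m * N / h, 0, 0, N;
          0, 0, -((A' * p + B * q) * N / (A * h)), -N, -(B * N / A), 0] :
          Matrix (Fin 2) (Fin 6) ℝ) := by
      ext i j
      fin_cases i <;> fin_cases j <;>
        simp [gravityFrame, Matrix.mul_apply, Fin.sum_univ_two] <;> field_simp <;> ring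
    rw [e]
    exact (Matrix.rank_mul_le_left _ _).trans (Matrix.rank_le_width _)

/-! ### Semicontinuity of the rank and derivatives along the fibres. -/

theorem isOpen_setOf_le_rank (n : ℕ) : IsOpen {M : Matrix (Fin 6) (Fin 6) ℝ | n ≤ M.rank} := by
  let Φ : Matrix (Fin 6) (Fin 6) ℝ →ₗ[ℝ] ((Fin 6 → ℝ) →L[ℝ] (Fin 6 → ℝ)) :=
    LinearMap.toContinuousLinearMap.toLinearMap ∘ₗ Matrix.toLin'.toLinearMap
  have hΦ : Continuous Φ := Φ.continuous_of_finiteDimensional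
  convert! (isOpen_setOfPred_nat_le_rank (𝕜 := ℝ) (E := Fin 6 → ℝ) (F := Fin 6 → ℝ) n).preimage hΦ
    using 1
  ext M
  simp only [Set.mem_ofPred_eq, Set.mem_preimage, LinearMap.rank, ← Module.finrank_eq_rank,
    Nat.cast_le]
  rfl

theorem eq_circlePoint {y : Phase} {θ : ℝ} (h0 : y 0 = Real.cos θ) (h1 : y 1 = Real.sin θ) :
    y = circlePoint θ (y 2) (Real.cos θ * y 3 + Real.sin θ * y 4)
      (-Real.sin θ * y 3 + Real.cos θ * y 4) (y 5) := by
  have h := Real.sin_sq_add_cos_sq θ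
  funext i
  fin_cases i <;> simp [circlePoint, h0, h1]
  · linear_combination -y 3 * h
  · linear_combination -y 4 * h

theorem contDiffAt_apply_of_affineInMomenta {G : Set (ℝ × ℝ)} {I : Set ℝ} (hG : IsOpen G)
    (hI : IsOpen I) {P : Bivector} (hP : AffineInMomenta G I P) {x : Phase}
    (hx : x.config ∈ G ×ˢ I) (i j : Fin 6) : ContDiffAt ℝ ∞ (fun y => P y i j) x := by
  obtain ⟨u, w, hu, hw, h⟩ := hP
  have hp : ∀ i : Fin 6, ContDiff ℝ ∞ (fun y : Phase => y i) := fun i => contDiff_apply ℝ ℝ i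
  have hq : ContDiff ℝ ∞ Phase.config := ((hp 0).prodMk (hp 1)).prodMk (hp 2)
  have hU : IsOpen (G ×ˢ I) := hG.prod hI
  have hm : ∀ k, ContDiff ℝ ∞ (fun y : Phase => y.momentum k) := fun k => by
    fin_cases k
    · exact hp 3
    · exact hp 4
    · exact hp 5
  have main : ContDiffAt ℝ ∞ (fun y : Phase => ∑ k, u i j k y.config * y.momentum k +
      w i j y.config) x :=
    (ContDiffAt.sum fun k _ => (((hu i j k).contDiffAt (hU.mem_nhds hx)).comp x
      hq.contDiffAt).mul (hm k).contDiffAt).add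
      (((hw i j).contDiffAt (hU.mem_nhds hx)).comp x hq.contDiffAt)
  refine main.congr_of_eventuallyEq ?_
  filter_upwards [hq.continuous.continuousAt.preimage_mem_nhds (hU.mem_nhds hx)] with y hy
  exact h y hy i j

/-- Written as a derivative along the vector P dx_k, the term can be computed on a single line
through the point. -/
theorem schoutenTerm_self (P : Bivector) (x : Phase) (i j k : Fin 6) :
    schoutenTerm P P x i j k = 2 * fderiv ℝ (fun y => P y i j) x (fun m => P x m k) := by
  have e := LinearMap.pi_apply_eq_sum_univ (fderiv ℝ (fun y => P y i j) x : Phase →ₗ[ℝ] ℝ)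
    (fun m => P x m k)
  rw [ContinuousLinearMap.coe_coe] at e
  rw [e, Finset.mul_sum]
  refine Finset.sum_congr rfl fun m _ => ?_
  rw [show (fun j => if m = j then (1 : ℝ) else 0) = Pi.single m 1 by
    funext j; simp [Pi.single_apply, eq_comm]]
  simp only [partialDeriv, smul_eq_mul]
  ring

/-- The form of P is known only over the circle. This suffices for vectors v with no component along
γ, whose lines stay over one point of the circle. -/
theorem fderiv_apply_eq_of_line {F : Phase → ℝ} {x v : Phase} (h : DifferentiableAt ℝ F x)
    {g : ℝ → ℝ} {g' : ℝ} (hg : HasDerivAt g g' 0) (hFg : ∀ᶠ t in nhds (0 : ℝ), F (x + t • v) = g t) :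
    fderiv ℝ F x v = g' := by
  have h1 : HasDerivAt (fun t : ℝ => F (x + t • v)) (fderiv ℝ F x v) 0 :=
    h.hasFDerivAt.hasLineDerivAt v
  exact h1.unique (hg.congr_of_eventuallyEq hFg)

/-! ### No solution of rank four in the presence of gravity. -/

namespace StublerModel

variable (S : StublerModel)

/-- The functions `v₃⁽ᵏ⁾` in terms of the normal and tangential parts of `(v₁⁽ᵏ⁾, v₂⁽ᵏ⁾)`. -/
theorem exists_v3_eq (c : Fin 2 → ℝ) : ∃ A B : ℝ → ℝ, ∀ θ ∈ Set.Ioo 0 Real.pi,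
    HasDerivAt A (S.nu ^ 2 * B θ) θ ∧ HasDerivAt B ((S.f θ)⁻¹ - A θ) θ ∧
      ∀ k, S.v3 (c k) k θ = S.normalPart k θ * A θ + S.tangentPart k θ * B θ := by
  obtain ⟨W, hW, hW'⟩ := S.exists_wronskian
  -- Cramer's rule for the two equations k = 1, 2, with the Wronskian as determinant.
  refine ⟨fun θ => (S.v3 (c 0) 0 θ * S.tangentPart 1 θ - S.v3 (c 1) 1 θ * S.tangentPart 0 θ) / W,
    fun θ => (S.normalPart 0 θ * S.v3 (c 1) 1 θ - S.normalPart 1 θ * S.v3 (c 0) 0 θ) / W,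
    fun θ hθ => ?_⟩
  have w := hW' θ hθ
  have a := fun k => S.hasDerivAt_normalPart k hθ
  have b := fun k => S.hasDerivAt_tangentPart k hθ
  have v := fun k => S.hasDerivAt_v3 (c k) k hθ
  have hf := S.f_ne_zero θ
  refine ⟨?_, ?_, fun k => ?_⟩
  · refine ((((v 0).mul (b 1)).sub ((v 1).mul (b 0))).div_const W).congr_deriv ?_
    field_simp
    ring
  · refine ((((a 0).mul (v 1)).sub ((a 1).mul (v 0))).div_const W).congr_deriv ?_
    field_simp
    linear_combination w
  · dsimp only
    field_simp
    rw [← w]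
    fin_cases k <;> simp <;> ring

/-- If A vanished near θ, the first equation would give B = 0 there and the second 1/f = 0. -/
theorem frequently_ne_zero_of_v3_eq {A B : ℝ → ℝ} (h : ∀ θ ∈ Set.Ioo 0 Real.pi,
    HasDerivAt A (S.nu ^ 2 * B θ) θ ∧ HasDerivAt B ((S.f θ)⁻¹ - A θ) θ) {θ : ℝ}
    (hθ : θ ∈ Set.Ioo 0 Real.pi) : ∃ᶠ t in nhds θ, A t ≠ 0 := by
  rw [Filter.Frequently]
  simp only [not_not]
  intro hA
  have hnu : S.nu ^ 2 ≠ 0 := pow_ne_zero 2 S.nu_pos.ne'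
  have hB : ∀ᶠ t in nhds θ, B t = 0 := by
    filter_upwards [hA.eventually_nhds, isOpen_Ioo.mem_nhds hθ] with t ht ht'
    have e := (h t ht').1.unique
      ((hasDerivAt_const t (0 : ℝ)).congr_of_eventuallyEq (f₁ := A) ht)
    exact (mul_eq_zero.1 e).resolve_left hnu
  have e := (h θ hθ).2.unique
    ((hasDerivAt_const θ (0 : ℝ)).congr_of_eventuallyEq (f₁ := B) hB)
  rw [hA.self_of_nhds, sub_zero] at e
  exact inv_ne_zero (S.f_ne_zero θ) e

theorem frame_mulVec (a b a0 a1 a2 a3 a4 a5 : ℝ) : frame a b *ᵥ ![a0, a1, a2, a3, a4, a5] =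
    ![a * a0 + b * a1, a * a1 - b * a0, a2, a * a3 + b * a4, a * a4 - b * a3, a5] := by
  funext i
  fin_cases i <;> simp [frame, Matrix.mulVec, dotProduct, Fin.sum_univ_six] <;> ring

theorem circlePoint_relations (θ z p q m : ℝ) :
    circlePoint θ z p q m 0 * circlePoint θ z p q m 0 +
        circlePoint θ z p q m 1 * circlePoint θ z p q m 1 = 1 ∧
      circlePoint θ z p q m 0 * circlePoint θ z p q m 3 +
        circlePoint θ z p q m 1 * circlePoint θ z p q m 4 = p ∧
      circlePoint θ z p q m 0 * circlePoint θ z p q m 4 -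
        circlePoint θ z p q m 1 * circlePoint θ z p q m 3 = q := by
  have h := Real.sin_sq_add_cos_sq θ
  refine ⟨?_, ?_, ?_⟩ <;> simp [circlePoint]
  · linear_combination h
  · linear_combination p * h
  · linear_combination q * h

theorem frame_gradient_geometric (θ z p q m : ℝ) :
    (frame (Real.cos θ) (Real.sin θ) *ᵥ fun i => partialDeriv i geometric (circlePoint θ z p q m)) =
      ![2, 0, 0, 0, 0, 0] := by
  have h := Real.sin_sq_add_cos_sq θ
  rw [gradient_geometric, frame_mulVec]
  funext i
  fin_cases i <;> simp [circlePoint]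
  · linear_combination 2 * h
  · ring

theorem frame_gradient_energy (θ z p q m : ℝ) : ∃ r : ℝ,
    (frame (Real.cos θ) (Real.sin θ) *ᵥ fun i => partialDeriv i S.energy (circlePoint θ z p q m)) =
      ![r, (1 / S.nu ^ 2 - 1) * p * q / (S.inertia + S.d),
        -((S.inertia + S.d) * (S.mass * S.grav)) / (S.inertia + S.d),
        p / (S.nu ^ 2 * (S.inertia + S.d)), q / (S.inertia + S.d), m / (S.inertia + S.d)] := by
  have hI0 := S.inertia_pos
  have hd0 := S.d_pos
  have hN : S.inertia + S.d ≠ 0 := by positivity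
  have hn2 : S.nu ^ 2 ≠ 0 := pow_ne_zero 2 S.nu_pos.ne'
  have hdI : S.d / S.inertia = 1 / S.nu ^ 2 - 1 := by
    rw [S.nu_sq]
    field_simp
    ring
  obtain ⟨hx, hp, hq⟩ := circlePoint_relations θ z p q m
  obtain ⟨h0, h1, e, et⟩ := S.gradient_energy _ hx
  rw [hp, hq] at et
  rw [hp] at e
  set x := circlePoint θ z p q m
  have hc : Real.cos θ = x 0 := rfl
  have hs : Real.sin θ = x 1 := rfl
  have hm : m = x 5 := rfl
  rw [e, hc, hs, frame_mulVec, et, hdI, hm]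
  refine ⟨_, congrArg (Matrix.vecCons _) (congrArg (Matrix.vecCons _) ?_)⟩
  refine congrArg₂ Matrix.vecCons ?_ (congrArg₂ Matrix.vecCons ?_ (congrArg₂ Matrix.vecCons ?_ rfl))
  · field_simp
  · rw [← mul_div_assoc, ← mul_div_assoc, ← add_div, ← div_div]
    congr 1
    rw [div_eq_mul_one_div p]
    linear_combination hp + (1 / S.nu ^ 2 - 1) * p * hx
  · rw [← mul_div_assoc, ← mul_div_assoc, ← sub_div]
    congr 1
    linear_combination hq

theorem frame_gradient_J (c : Fin 2 → ℝ) (k : Fin 2) {θ A B : ℝ} (hθ : θ ∈ Set.Ioo 0 Real.pi)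
    (hv3 : S.v3 (c k) k θ = S.normalPart k θ * A + S.tangentPart k θ * B) (z p q : ℝ) {m : ℝ}
    (hm : m ≠ 0) : ∃ r : ℝ,
    (frame (Real.cos θ) (Real.sin θ) *ᵥ fun i =>
      partialDeriv i (S.J c k) (circlePoint θ z p q m)) =
      ![r, (1 - S.nu ^ 2) * S.normalPart k θ * q - S.mass * S.grav * S.d / (S.nu ^ 2 - 1) *
          (S.f θ)⁻¹ * S.tangentPart k θ / m, 0, S.normalPart k θ, S.tangentPart k θ,
        S.mass * S.grav * S.d / (S.nu ^ 2 - 1) *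
          (S.normalPart k θ * A + S.tangentPart k θ * B) / m ^ 2] := by
  obtain ⟨hx, hp, hq⟩ := circlePoint_relations θ z p q m
  obtain ⟨h1, h2, h3⟩ := cos_mem_Ioo hθ
  obtain ⟨j0, j1, e, et⟩ := S.gradient_J c k (circlePoint θ z p q m) h1 h2 h3 hx fun _ => hm
  have har : Real.arccos (circlePoint θ z p q m 0) = θ := Real.arccos_cos hθ.1.le hθ.2.le
  rw [har] at e et
  set x := circlePoint θ z p q m
  have hc : Real.cos θ = x 0 := rfl
  have hs : Real.sin θ = x 1 := rfl
  have hm : m = x 5 := rfl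
  have hn : S.normalPart k θ = x 0 * S.v1 k (x 0, x 1) + x 1 * S.v2 k (x 0, x 1) := rfl
  have ht : S.tangentPart k θ = x 0 * S.v2 k (x 0, x 1) - x 1 * S.v1 k (x 0, x 1) := rfl
  rw [← hn, show x 1 * x 3 - x 0 * x 4 = -q by linarith] at et
  rw [e, hc, hs, frame_mulVec, et, ← hn, ← ht, hv3, ← hm]
  refine ⟨_, congrArg (Matrix.vecCons _) (congrArg₂ Matrix.vecCons ?_ rfl)⟩
  ring

theorem eq_gravityFrame {T : Matrix (Fin 6) (Fin 6) ℝ} (hT : ∀ i j, T i j = -T j i)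
    {e h A A' B N N' p q m : ℝ} (he : e ≠ 0) (hh : h ≠ 0) (hA : A ≠ 0)
    (r1 : T 0 1 = 0) (r2 : T 0 2 = 0) (r3 : T 0 3 = 0) (r4 : T 0 4 = 0) (r5 : T 0 5 = 0)
    (t1 : T 1 2 = 0) (t2 : T 1 4 = 0) (t3 : T 1 5 = 0) (t4 : T 3 5 = N)
    (t5 : A * T 4 5 = B * N) (t6 : A * h * T 2 5 = (A' * p + B * q) * N) (t7 : T 3 4 = N')
    (t8 : e * T 1 3 = -(N' * m)) (t9 : h * T 2 3 = -(q * N' + m * N))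
    (t10 : A * h * T 2 4 = -(m * B * N)) : T = gravityFrame e h A A' B N N' p q m := by
  have hdiag : ∀ i, T i i = 0 := fun i => by linarith [hT i i]
  have s13 : T 1 3 = -(N' * m / e) := by rw [← neg_div, ← t8]; field_simp
  have s23 : T 2 3 = -((q * N' + m * N) / h) := by rw [← neg_div, ← t9]; field_simp
  have s24 : T 2 4 = -(m * B * N / (A * h)) := by rw [← neg_div, ← t10]; field_simp
  have s25 : T 2 5 = (A' * p + B * q) * N / (A * h) := by rw [← t6]; field_simp
  have s45 : T 4 5 = B * N / A := by rw [← t5]; field_simp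
  have e : ∀ i j, i ≤ j → T i j = gravityFrame e h A A' B N N' p q m i j := by
    intro i j hij
    fin_cases i <;> fin_cases j <;> first
      | exact hdiag _
      | assumption
      | exact absurd hij (by decide)
  ext i j
  rcases le_total i j with hij | hij
  · exact e i j hij
  · rw [hT, e j i hij]
    fin_cases i <;> fin_cases j <;> simp [gravityFrame]

/-- The shape of a solution over a vertical line of the cylinder. -/
theorem exists_eq_gravityFrame (hg : S.grav ≠ 0) {c : Fin 2 → ℝ} {G : Set (ℝ × ℝ)} {I : Set ℝ}
    {P : Bivector} (hP : S.IsSolution c G I P)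
    {A B θ : ℝ} (hθ : θ ∈ Set.Ioo 0 Real.pi) (hG : (Real.cos θ, Real.sin θ) ∈ G) (hA : A ≠ 0)
    (hv3 : ∀ k, S.v3 (c k) k θ = S.normalPart k θ * A + S.tangentPart k θ * B) :
    ∃ e h A' : ℝ, e ≠ 0 ∧ h ≠ 0 ∧ A' ≠ 0 ∧ ∀ z ∈ I, ∃ N N' : ℝ, ∀ y : Phase,
      y 0 = Real.cos θ → y 1 = Real.sin θ → y 2 = z → y 5 ≠ 0 →
      P y = (frame (Real.cos θ) (Real.sin θ))ᵀ * gravityFrame e h A A' B N N'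
        (Real.cos θ * y 3 + Real.sin θ * y 4) (-Real.sin θ * y 3 + Real.cos θ * y 4) (y 5) *
        frame (Real.cos θ) (Real.sin θ) := by
  have hI0 := S.inertia_pos
  have hd0 := S.d_pos
  have hm0 := S.mass_pos
  have hn2 : S.nu ^ 2 ≠ 0 := pow_ne_zero 2 S.nu_pos.ne'
  have hl : S.nu ^ 2 - 1 ≠ 0 := by nlinarith [S.nu_pos, S.nu_lt_one]
  have hκ : S.mass * S.grav * S.d / (S.nu ^ 2 - 1) ≠ 0 :=
    div_ne_zero (mul_ne_zero (mul_ne_zero hm0.ne' hg) hd0.ne') hl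
  have hN : S.inertia + S.d ≠ 0 := by positivity
  have hh : (S.inertia + S.d) * (S.mass * S.grav) ≠ 0 := mul_ne_zero hN (mul_ne_zero hm0.ne' hg)
  have hF : (S.f θ)⁻¹ ≠ 0 := inv_ne_zero (S.f_ne_zero θ)
  have hA' : A / S.nu ^ 2 ≠ 0 := div_ne_zero hA hn2
  have hcs : Real.cos θ * Real.cos θ + Real.sin θ * Real.sin θ = 1 := by
    linarith [Real.sin_sq_add_cos_sq θ]
  obtain ⟨W, hW, hW'⟩ := S.exists_wronskian
  have w := hW' θ hθ
  -- The three constants depend on the angle and the model alone, while N and N' may vary with z.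
  -- This separation is needed when differentiating along the fibre.
  refine ⟨_, _, _, mul_ne_zero hκ hF, hh, hA', fun z hz => ?_⟩
  set R := frame (Real.cos θ) (Real.sin θ) with hR
  obtain ⟨K, hK⟩ := exists_affineEval_frame hP.affine hG hz R
  have hpt : ∀ p q m, (circlePoint θ z p q m).config ∈ G ×ˢ I := fun p q m => ⟨hG, hz⟩
  have hT : ∀ p q m i j, (R * P (circlePoint θ z p q m) * Rᵀ) i j =
      -(R * P (circlePoint θ z p q m) * Rᵀ) j i := fun p q m i j => by
    have e : (P (circlePoint θ z p q m))ᵀ = -P (circlePoint θ z p q m) := by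
      ext i j
      exact hP.skew _ (hpt p q m) j i
    rw [← Matrix.transpose_apply (R * P (circlePoint θ z p q m) * Rᵀ) i j, Matrix.transpose_mul,
      Matrix.transpose_mul, Matrix.transpose_transpose, e, ← Matrix.mul_assoc]
    simp
  choose rH eH using fun p q m => S.frame_gradient_energy θ z p q m
  choose r eJ using fun (k : Fin 2) (p q m : ℝ) (hm : m ≠ 0) =>
    S.frame_gradient_J c k hθ (hv3 k) z p q hm
  have hinv := fun (p q m : ℝ) (hm : m ≠ 0) a b => (bivectorBracket_frame hcs P _ _ _).symm.trans
    (hP.involution (circlePoint θ z p q m) (S.mem_phaseSpace_iff.2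
      ⟨⟨hG, hz⟩, (circlePoint_relations θ z p q m).1, fun _ => hm⟩) a b)
  have key := fun (p q m : ℝ) (hm : m ≠ 0) => frame_constraints (hT p q m) hm hN hn2 rfl
    (w.trans_ne hW) (frame_gradient_geometric θ z p q m)
    (eH p q m) (eJ 0 p q m hm)
    (eJ 1 p q m hm) (hinv p q m hm 1 0) (hinv p q m hm 1 2) (hinv p q m hm 1 3)
    (hinv p q m hm 0 2) (hinv p q m hm 0 3) (hinv p q m hm 2 3)
  simp only [hK] at key
  have hl' : 1 - S.nu ^ 2 ≠ 0 := fun h => hl (by linarith)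
  obtain ⟨N, N', hNN⟩ := tangential_entries_eq hκ hh hF hA hA' hl'
    (fun p q m hm => (key p q m hm).2.1) (fun p q m hm => (key p q m hm).2.2.1)
    (fun p q m hm => (key p q m hm).2.2.2)
  refine ⟨N, N', fun y y0 y1 y2 y5 => ?_⟩
  have ey := eq_circlePoint y0 y1
  rw [y2] at ey
  set p := Real.cos θ * y 3 + Real.sin θ * y 4
  set q := -Real.sin θ * y 3 + Real.cos θ * y 4
  set m := y 5
  obtain ⟨r1, r2, r3, r4, r5⟩ := radial_entries_eq_zero hκ hh hF hA' hl'
    (fun p q m hm => (key p q m hm).1.1) (fun p q m hm => (key p q m hm).1.2.1)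
    (fun p q m hm => (key p q m hm).1.2.2) p q m y5
  obtain ⟨t1, t2, t3, t4, t5, t6, t7, t8, t9, t10⟩ := hNN p q m
  simp only [← hK, ← ey] at r1 r2 r3 r4 r5 t1 t2 t3 t4 t5 t6 t7 t8 t9 t10
  have hT' := hT p q m
  rw [← ey] at hT'
  have e := eq_gravityFrame hT' (mul_ne_zero hκ hF) hh hA r1 r2 r3 r4 r5 t1 t2 t3 t4 t5 t6 t7 t8
    t9 t10
  have hRR : Rᵀ * R = 1 := frame_transpose_mul hcs
  rw [← e, ← Matrix.mul_assoc, ← Matrix.mul_assoc, hRR, Matrix.one_mul, Matrix.mul_assoc, hRR,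
    Matrix.mul_one]

end StublerModel

/-- The Jacobi identity forces one of the two parameters of the general form to vanish. -/
theorem mul_eq_zero_of_jacobi {G : Set (ℝ × ℝ)} {I : Set ℝ} (hG : IsOpen G) (hI : IsOpen I)
    {P : Bivector} (hP : AffineInMomenta G I P) {θ z e h A A' B : ℝ}
    (hθ : (Real.cos θ, Real.sin θ) ∈ G) (hs : Real.sin θ ≠ 0) (hz : z ∈ I) (he : e ≠ 0)
    (hh : h ≠ 0) (hA : A ≠ 0) (hA' : A' ≠ 0) {N N' : ℝ → ℝ}
    (hform : ∀ y : Phase, y 0 = Real.cos θ → y 1 = Real.sin θ → y 2 ∈ I → y 5 ≠ 0 →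
      P y = (frame (Real.cos θ) (Real.sin θ))ᵀ * gravityFrame e h A A' B (N (y 2)) (N' (y 2))
        (Real.cos θ * y 3 + Real.sin θ * y 4) (-Real.sin θ * y 3 + Real.cos θ * y 4) (y 5) *
        frame (Real.cos θ) (Real.sin θ))
    (hjac : schouten P P (circlePoint θ z 0 0 1) 0 2 5 = 0) : N z * N' z = 0 := by
  set x := circlePoint θ z 0 0 1 with hx
  have x0 : x 0 = Real.cos θ := rfl
  have x1 : x 1 = Real.sin θ := rfl
  have x2 : x 2 = z := rfl
  have x3 : x 3 = 0 := by simp [hx, circlePoint]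
  have x4 : x 4 = 0 := by simp [hx, circlePoint]
  have x5 : x 5 = 1 := rfl
  have hcs := Real.sin_sq_add_cos_sq θ
  set c := Real.cos θ with hc
  set s := Real.sin θ with hs'
  have hd : ∀ i j, DifferentiableAt ℝ (fun y => P y i j) x := fun i j =>
    (contDiffAt_apply_of_affineInMomenta hG hI hP (x := x) ⟨hθ, hz⟩ i j).differentiableAt (by simp)
  have entry : ∀ y : Phase, y 0 = c → y 1 = s → y 2 ∈ I → y 5 ≠ 0 →
      P y 0 2 = 0 ∧ P y 5 0 = 0 ∧ P y 0 5 = 0 ∧ P y 1 5 = 0 ∧ P y 1 2 = 0 ∧ P y 0 0 = 0 ∧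
      P y 1 0 = 0 ∧ P y 2 0 = 0 ∧ P y 3 0 = -s * c * (N' (y 2) * y 5 / e) ∧
      P y 4 0 = -s * s * (N' (y 2) * y 5 / e) ∧
      P y 2 5 = (A' * (c * y 3 + s * y 4) + B * (-s * y 3 + c * y 4)) * N (y 2) / (A * h) := by
    intro y y0 y1 y2 y5
    rw [hform y y0 y1 y2 y5]
    refine ⟨?_, ?_, ?_, ?_, ?_, ?_, ?_, ?_, ?_, ?_, ?_⟩ <;>
      simp [frame, gravityFrame, Matrix.mul_apply, Fin.sum_univ_six] <;> ring
  -- The columns of P for γ₁, z and M₃ have no γ components, so short lines along them stay where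
  -- the explicit form holds.
  have line : ∀ v : Phase, v 0 = 0 → v 1 = 0 → ∀ᶠ t in nhds (0 : ℝ), (x + t • v) 0 = c ∧
      (x + t • v) 1 = s ∧ (x + t • v) 2 ∈ I ∧ (x + t • v) 5 ≠ 0 := by
    intro v v0 v1
    have hcont : ∀ i, Continuous fun t : ℝ => (x + t • v) i := fun i => by
      simp only [Pi.add_apply, Pi.smul_apply, smul_eq_mul]
      fun_prop
    have e2 := (hcont 2).continuousAt.preimage_mem_nhds (x := 0) (hI.mem_nhds (by simpa [x2] using hz))
    have e5 := (hcont 5).continuousAt.eventually_ne (x := 0) (y := 0) (by simp [x5])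
    filter_upwards [e2, e5] with t h2 h5
    exact ⟨by simp [v0, x0], by simp [v1, x1], h2, h5⟩
  obtain ⟨-, -, p05, p15, p12, p00, p10, p20, p30, p40, -⟩ :=
    entry x x0 x1 (by rwa [x2]) (by rw [x5]; exact one_ne_zero)
  have p02 := (entry x x0 x1 (by rwa [x2]) (by rw [x5]; exact one_ne_zero)).1
  have d1 : fderiv ℝ (fun y => P y 0 2) x (fun m => P x m 5) = 0 :=
    fderiv_apply_eq_of_line (hd 0 2) (hasDerivAt_const 0 (0 : ℝ)) <| by
      filter_upwards [line (fun m => P x m 5) p05 p15] with t ht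
      exact (entry _ ht.1 ht.2.1 ht.2.2.1 ht.2.2.2).1
  have d2 : fderiv ℝ (fun y => P y 5 0) x (fun m => P x m 2) = 0 :=
    fderiv_apply_eq_of_line (hd 5 0) (hasDerivAt_const 0 (0 : ℝ)) <| by
      filter_upwards [line (fun m => P x m 2) p02 p12] with t ht
      exact (entry _ ht.1 ht.2.1 ht.2.2.1 ht.2.2.2).2.1
  -- The Hamiltonian field of γ₁ moves only the normal momentum p, at a rate proportional to N', and
  -- the (z, M₃) entry depends on p with slope A' N/(A h). This is the only surviving term of the
  -- Jacobi identity.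
  have d3 : fderiv ℝ (fun y => P y 2 5) x (fun m => P x m 0) =
      -s * (N' z / e) * (A' * N z / (A * h)) :=
    fderiv_apply_eq_of_line (hd 2 5) (g := fun t => -s * (N' z / e) * (A' * N z / (A * h)) * t)
      (by simpa using (hasDerivAt_id (0 : ℝ)).const_mul (-s * (N' z / e) * (A' * N z / (A * h)))) <| by
      filter_upwards [line (fun m => P x m 0) p00 p10] with t ht
      rw [(entry _ ht.1 ht.2.1 ht.2.2.1 ht.2.2.2).2.2.2.2.2.2.2.2.2.2]
      simp only [Pi.add_apply, Pi.smul_apply, smul_eq_mul, p30, p40, p20, x2, x3, x4, x5]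
      simp only [mul_zero, add_zero, zero_add, mul_one]
      linear_combination (-(s * t * N' z / e) * A' * N z / (A * h)) * hcs
  rw [schouten, schoutenTerm_self, schoutenTerm_self, schoutenTerm_self, d1, d2, d3] at hjac
  have hne : 2 * s * A' / (e * (A * h)) ≠ 0 := by positivity
  refine (mul_eq_zero.1 (show 2 * s * A' / (e * (A * h)) * (N z * N' z) = 0 from ?_)).resolve_left
    hne
  rw [← hjac]
  field_simp
  ring

namespace StublerModel

variable (S : StublerModel)

/-- Rank four at one point would persist at nearby angles, hence at one with A ≠ 0, where the
explicit form bounds the rank by two. -/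
theorem rank_ne_four_of_grav_ne_zero (hg : S.grav ≠ 0) {c : Fin 2 → ℝ} {G : Set (ℝ × ℝ)}
    {I : Set ℝ} (hG : IsOpen G) (hI : IsOpen I)
    (hGdom : ∀ γ ∈ G, -1 < γ.1 ∧ γ.1 < 1 ∧ 0 < γ.2) {P : Bivector} (hP : S.IsSolution c G I P)
    {x : Phase} (hx : x ∈ S.phaseSpace G I) : (P x).rank ≠ 4 := by
  intro hrank
  obtain ⟨⟨hxG, hxI⟩, hx1, hx5⟩ := S.mem_phaseSpace_iff.1 hx
  have x5 := hx5 hg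
  obtain ⟨h1, h2, h3⟩ := hGdom _ hxG
  obtain ⟨hm, hc, hs⟩ := exists_angle h1 h2 h3 hx1
  set θ₀ := Real.arccos (x 0)
  obtain ⟨A, B, hAB⟩ := S.exists_v3_eq c
  have hfreq := S.frequently_ne_zero_of_v3_eq (A := A) (B := B)
    (fun θ hθ => ⟨(hAB θ hθ).1, (hAB θ hθ).2.1⟩) hm
  -- The point is moved along the circle with z and the momenta fixed, so M₃ stays nonzero.
  let y : ℝ → Phase := fun θ => ![Real.cos θ, Real.sin θ, x 2, x 3, x 4, x 5]
  have y0 : y θ₀ = x := by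
    funext i
    fin_cases i <;> simp [y, hc, hs]
  have hy : Continuous y := by
    refine continuous_pi fun i => ?_
    fin_cases i <;> simp [y] <;> fun_prop
  have hcont : ContinuousAt (fun θ => P (y θ)) θ₀ := by
    refine continuousAt_pi.2 fun i => continuousAt_pi.2 fun j => ?_
    have e : ContinuousAt (fun x => P x i j) (y θ₀) := by
      rw [y0]
      exact (contDiffAt_apply_of_affineInMomenta hG hI hP.affine ⟨hxG, hxI⟩ i j).continuousAt
    exact e.comp hy.continuousAt
  have ev1 : ∀ᶠ θ in nhds θ₀, 4 ≤ (P (y θ)).rank :=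
    hcont.preimage_mem_nhds ((isOpen_setOf_le_rank 4).mem_nhds (by rw [y0]; exact hrank.ge))
  have ev2 : ∀ᶠ θ in nhds θ₀, (Real.cos θ, Real.sin θ) ∈ G :=
    (Real.continuous_cos.prodMk Real.continuous_sin).continuousAt.preimage_mem_nhds
      (hG.mem_nhds (by rwa [hc, hs]))
  obtain ⟨θ, hA, h4, hGθ, hθ⟩ :=
    (hfreq.and_eventually (ev1.and (ev2.and (isOpen_Ioo.mem_nhds hm)))).exists
  obtain ⟨e, h, A', he, hh, hA', hform⟩ :=
    S.exists_eq_gravityFrame hg hP hθ hGθ hA (hAB θ hθ).2.2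
  choose! N N' hN using hform
  have hsin := (Real.sin_pos_of_mem_Ioo hθ).ne'
  have hNN : N (x 2) * N' (x 2) = 0 :=
    mul_eq_zero_of_jacobi hG hI hP.affine hGθ hsin hxI he hh hA hA'
      (fun v v0 v1 v2 v5 => hN (v 2) v2 v v0 v1 rfl v5)
      (hP.jacobi (circlePoint θ (x 2) 0 0 1) (S.mem_phaseSpace_iff.2
        ⟨⟨hGθ, hxI⟩, (circlePoint_relations θ _ _ _ _).1, fun _ => one_ne_zero⟩) 0 2 5)
  rw [hN (x 2) hxI (y θ) rfl rfl rfl x5] at h4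
  have h2 := h4.trans ((Matrix.rank_mul_le_left _ _).trans ((Matrix.rank_mul_le_right _ _).trans
    (rank_gravityFrame_le e h (A θ) A' (B θ) (N (x 2)) (N' (x 2)) _ _ _ hh hA hNN)))
  exact absurd h2 (by norm_num)

/-! ### Distinctness of the families and the conclusion. -/

/-- The (z, M₁) entries force equal α, and then the (z, M₂) entries force ρ₁ = ρ₂, which the
Wronskian excludes. -/
theorem familyP_ne (α α' : Config → ℝ) (β β' : ℝ × ℝ → ℝ) (σ σ' : Config → ℝ) {x : Phase}
    (h1 : -1 < x 0) (h2 : x 0 < 1) (h3 : 0 < x 1) (hx : x 0 * x 0 + x 1 * x 1 = 1)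
    (hv : S.v2 0 (x 0, x 1) ≠ 0) (hv' : S.v2 1 (x 0, x 1) ≠ 0) (hα : α x.config ≠ 0) :
    S.familyP 0 α β σ x ≠ S.familyP 1 α' β' σ' x := by
  intro h
  have e1 := congrFun (congrFun h 2) 3
  have e2 := congrFun (congrFun h 2) 4
  simp [familyP] at e1 e2
  rw [← e1] at e2
  exact S.rho_ne h1 h2 h3 hx hv hv' (mul_left_cancel₀ hα e2)

theorem potential_eq_zero_iff : (∀ z, S.potential z = 0) ↔ S.grav = 0 := by
  refine ⟨fun h => ?_, fun h z => by simp [potential, h]⟩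
  have := h 1
  simpa [potential, S.mass_pos.ne'] using this

end StublerModel

theorem mainTheorem2 (S : StublerModel) (c : Fin 2 → ℝ)
    (G : Set (ℝ × ℝ)) (I : Set ℝ) (hG : IsOpen G) (hI : IsOpen I) (hI' : I.OrdConnected)
    (hGdom : ∀ γ ∈ G, -1 < γ.1 ∧ γ.1 < 1 ∧ 0 < γ.2)
    (hGne : ∃ γ ∈ G, γ.1 ^ 2 + γ.2 ^ 2 = 1) (hIne : I.Nonempty) :
    ((∃ P : Bivector, S.IsSolution c G I P ∧ ∃ x ∈ S.phaseSpace G I, (P x).rank = 4) ↔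
      ∀ z, S.potential z = 0) ∧
    ((∀ z, S.potential z = 0) →
      (∀ k : Fin 2, (∀ γ ∈ G, S.v2 k γ ≠ 0) →
        ∀ (α : Config → ℝ) (β : ℝ × ℝ → ℝ),
          ContDiffOn ℝ ∞ α (G ×ˢ I) → (∀ q ∈ G ×ˢ I, α q ≠ 0) → ContDiffOn ℝ ∞ β G →
          (∃ σ : Config → ℝ, S.IsSigma G I k α β σ) ∧
          ∀ σ : Config → ℝ, S.IsSigma G I k α β σ →
            S.IsSolution c G I (S.familyP k α β σ) ∧
            ∀ x ∈ S.phaseSpace G I,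
              hamiltonianField (S.familyP k α β σ) StublerModel.geometric x = 0 ∧
              hamiltonianField (S.familyP k α β σ) (S.J c k) x = 0 ∧
              (β (x 0, x 1) ≠ 0 → (S.familyP k α β σ x).rank = 4)) ∧
      ∀ (α α' : Config → ℝ) (β β' : ℝ × ℝ → ℝ) (σ σ' : Config → ℝ),
        ∀ x ∈ S.phaseSpace G I, S.v2 0 (x 0, x 1) ≠ 0 → S.v2 1 (x 0, x 1) ≠ 0 →
          α x.config ≠ 0 → S.familyP 0 α β σ x ≠ S.familyP 1 α' β' σ' x) := by
  rw [S.potential_eq_zero_iff]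
  refine ⟨⟨fun ⟨P, hP, x, hx, hr⟩ => ?_, fun hg =>
    S.exists_isSolution_rank_four hg c hG hI hGdom hGne hIne⟩, fun hg => ⟨fun k hv α β hα hα0 hβ =>
      ⟨S.exists_isSigma hG hI hI' hIne hGdom k hv hα hα0 hβ, fun σ hσ =>
        ⟨S.isSolution_familyP hg c hG hI hGdom k hv hα hα0 hβ hσ, fun x hx => ?_⟩⟩,
    fun α α' β β' σ σ' x hx hv hv' hα => ?_⟩⟩
  · by_contra hg
    exact S.rank_ne_four_of_grav_ne_zero hg hG hI hGdom hP hx hr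
  · obtain ⟨⟨hxG, hxI⟩, hx1, -⟩ := S.mem_phaseSpace_iff.1 hx
    obtain ⟨h1, h2, h3⟩ := hGdom _ hxG
    rw [S.familyP_eq]
    refine ⟨?_, S.hamiltonianField_J_fiberBivector hg c k _ β x h1 h2 h3 hx1 ?_, fun hb =>
      rank_fiberBivector _ _ β x hx1 hb (Or.inl (hα0 _ ⟨hxG, hxI⟩))⟩
    · rw [hamiltonianField, StublerModel.gradient_geometric, fiberBivector_mulVec_geometric]
    · have hv2 := hv _ hxG
      simp [StublerModel.rho, Phase.config]
      field_simp
      ring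
  · obtain ⟨⟨hxG, hxI⟩, hx1, -⟩ := S.mem_phaseSpace_iff.1 hx
    obtain ⟨h1, h2, h3⟩ := hGdom _ hxG
    exact S.familyP_ne α α' β β' σ σ' h1 h2 h3 hx1 hv hv' hα
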